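/- Let $a_1,a_2>0$ and, for $R>0$, let $$\Omega_R=\Big\{(x_1,x_2,x_3)\in\mathbb R^3:\ \frac{x_1^2}{(a_1R)^2}+\frac{x_2^2}{(a_2R)^2}+x_3^2<1\Big\}.$$ Let $dS$ be the surface measure and $\nu$ the outward unit normal on $\partial\Omega_R$, and let $$\mathcal K_{\partial\Omega_R}[\varphi](x)=\frac1{4\pi}\int_{\partial\Omega_R}\frac{\langle y-x,\nu(y)\rangle}{|x-y|^3}\,\varphi(y)\,dS(y),\qquad x\in\partial\Omega_R,$$ be the Neumann–Poincaré operator. Let $\sigma(\mathcal K_{\partial\Omega_R})\subset\mathbb C$ denote its spectrum on the complex Sobolev space $H^{1/2}(\partial\Omega_R)$, with norm $$\|\varphi\|_{H^{1/2}(\partial\Omega_R)}^2=\int_{\partial\Omega_R}|\varphi|^2\,dS+\int_{\partial\Omega_R}\int_{\partial\Omega_R}\frac{|\varphi(x)-\varphi(y)|^2}{|x-y|^3}\,dS(y)\,dS(x).$$ If $(R_j)$ is any sequence of positive numbers with $R_j\to\infty$, then $$\overline{\bigcup_{j}\sigma(\mathcal K_{\partial\Omega_{R_j}})}=[-1/2,1/2].$$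 Moreover, the negative eigenvalues become dense in $[-1/2,0]$: $$\overline{\bigcup_{j}\big\{\lambda<0:\ \lambda\text{ is an eigenvalue of }\mathcal K_{\partial\Omega_{R_j}}\text{ on }H^{1/2}(\partial\Omega_{R_j})\big\}}=[-1/2,0].$$ -/

import Mathlib

open MeasureTheory

/-- The quadratic form `x₁²/(a₁R)² + x₂²/(a₂R)² + x₃²`. -/
noncomputable def oblateForm (a₁ a₂ R : ℝ) (X : EuclideanSpace ℝ (Fin 3)) : ℝ :=
  X 0 ^ 2 / (a₁ * R) ^ 2 + X 1 ^ 2 / (a₂ * R) ^ 2 + X 2 ^ 2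

/-- The oblate ellipsoid `Ω_R = {x₁²/(a₁R)² + x₂²/(a₂R)² + x₃² < 1}`. -/
def oblateEllipsoid (a₁ a₂ R : ℝ) : Set (EuclideanSpace ℝ (Fin 3)) :=
  {X | oblateForm a₁ a₂ R X < 1}

/-- The outward unit normal of `Ω_R` at a boundary point: the normalized gradient of the form
that defines `Ω_R` as a sublevel set. -/
noncomputable def oblateNormal (a₁ a₂ R : ℝ) (Y : EuclideanSpace ℝ (Fin 3)) :
    EuclideanSpace ℝ (Fin 3) :=
  ‖gradient (oblateForm a₁ a₂ R) Y‖⁻¹ • gradient (oblateForm a₁ a₂ R) Y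

/-- The surface measure of the graph `{(x, f x) : x ∈ U}` of a function on a planar set `U`:
the image under `x ↦ (x, f x)` of the measure `√(1 + |∇f(x)|²) dx` on `U`. -/
noncomputable def graphSurfaceMeasure (U : Set (EuclideanSpace ℝ (Fin 2)))
    (f : EuclideanSpace ℝ (Fin 2) → ℝ) : Measure (EuclideanSpace ℝ (Fin 3)) :=
  ((volume.restrict U).withDensity
    (fun x => ENNReal.ofReal √(1 + ‖gradient f x‖ ^ 2))).map (fun x => !₂[x 0, x 1, f x])

/-- The projection of `Ω_R` onto the plane of the first two coordinates. -/
def oblateShadow (a₁ a₂ R : ℝ) : Set (EuclideanSpace ℝ (Fin 2)) :=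
  (fun X => !₂[X 0, X 1]) '' oblateEllipsoid a₁ a₂ R

/-- `γ_R`, whose graph over the shadow is the upper half of `∂Ω_R`. -/
noncomputable def oblateHeight (a₁ a₂ R : ℝ) (x : EuclideanSpace ℝ (Fin 2)) : ℝ :=
  √(1 - x 0 ^ 2 / (a₁ * R) ^ 2 - x 1 ^ 2 / (a₂ * R) ^ 2)

/-- The surface measure `dS` of `∂Ω_R`, as a measure on `ℝ³`. The boundary is the union of the
graphs of `γ_R` and `-γ_R` over the shadow, up to the equator, which has surface measure zero. -/
noncomputable def oblateSurfaceMeasure (a₁ a₂ R : ℝ) : Measure (EuclideanSpace ℝ (Fin 3)) :=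
  graphSurfaceMeasure (oblateShadow a₁ a₂ R) (oblateHeight a₁ a₂ R) +
    graphSurfaceMeasure (oblateShadow a₁ a₂ R) (fun x => -oblateHeight a₁ a₂ R x)

/-- The shadow is the planar region bounded by an ellipse. -/
theorem mem_oblateShadow (a₁ a₂ R : ℝ) (x : EuclideanSpace ℝ (Fin 2)) :
    x ∈ oblateShadow a₁ a₂ R ↔ x 0 ^ 2 / (a₁ * R) ^ 2 + x 1 ^ 2 / (a₂ * R) ^ 2 < 1 := by
  constructor
  · rintro ⟨X, hX, rfl⟩
    simp only [oblateEllipsoid, oblateForm, Set.mem_ofPred_eq] at hX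
    simp only [Matrix.cons_val_zero, Matrix.cons_val_one]
    nlinarith [sq_nonneg (X 2)]
  · intro h
    refine ⟨!₂[x 0, x 1, 0], ?_, ?_⟩
    · simpa [oblateEllipsoid, oblateForm] using h
    · ext i
      fin_cases i <;> simp

/-- The topological boundary of `Ω_R` is the level surface of the defining form. -/
theorem frontier_oblateEllipsoid (a₁ a₂ R : ℝ) :
    frontier (oblateEllipsoid a₁ a₂ R) = {X | oblateForm a₁ a₂ R X = 1} := by
  have hc : Continuous (oblateForm a₁ a₂ R) := by
    unfold oblateForm
    fun_prop
  apply Set.Subset.antisymm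
  · exact frontier_lt_subset_eq hc continuous_const
  · intro X hX
    have hX1 : oblateForm a₁ a₂ R X = 1 := hX
    have ho : IsOpen (oblateEllipsoid a₁ a₂ R) := isOpen_lt hc continuous_const
    rw [ho.frontier_eq]
    refine ⟨?_, fun h => ?_⟩
    · have hs : ∀ t : ℝ, oblateForm a₁ a₂ R (t • X) = t ^ 2 := by
        intro t
        have : oblateForm a₁ a₂ R (t • X) = t ^ 2 * oblateForm a₁ a₂ R X := by
          simp only [oblateForm, PiLp.smul_apply, smul_eq_mul]
          ring
        rw [this, hX1, mul_one]
      have ht : Filter.Tendsto (fun t : ℝ => t • X) (nhdsWithin 1 (Set.Iio 1)) (nhds X) := by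
        have : Filter.Tendsto (fun t : ℝ => t • X) (nhds 1) (nhds ((1 : ℝ) • X)) :=
          (continuous_id.smul continuous_const).tendsto 1
        rw [one_smul] at this
        exact this.mono_left nhdsWithin_le_nhds
      refine mem_closure_of_tendsto ht ?_
      have h01 : Set.Ioo (0 : ℝ) 1 ∈ nhdsWithin (1 : ℝ) (Set.Iio 1) :=
        Ioo_mem_nhdsLT zero_lt_one
      filter_upwards [h01] with t h01t
      change oblateForm a₁ a₂ R (t • X) < 1
      rw [hs]
      nlinarith [h01t.1, h01t.2]
    · have : oblateForm a₁ a₂ R X < 1 := h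
      linarith

/-- The surface measure is carried by the topological boundary of `Ω_R`. -/
theorem oblateSurfaceMeasure_compl_frontier (a₁ a₂ R : ℝ) :
    oblateSurfaceMeasure a₁ a₂ R (frontier (oblateEllipsoid a₁ a₂ R))ᶜ = 0 := by
  have hm : Measurable (oblateHeight a₁ a₂ R) := by
    have : Continuous (oblateHeight a₁ a₂ R) := by
      unfold oblateHeight
      fun_prop
    exact this.measurable
  have key : ∀ f : EuclideanSpace ℝ (Fin 2) → ℝ, Measurable f →
      (∀ x, f x ^ 2 = oblateHeight a₁ a₂ R x ^ 2) →
      graphSurfaceMeasure (oblateShadow a₁ a₂ R) f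
        (frontier (oblateEllipsoid a₁ a₂ R))ᶜ = 0 := by
    intro f hf hsq
    have hg : Measurable (fun x : EuclideanSpace ℝ (Fin 2) => !₂[x 0, x 1, f x]) := by
      refine (WithLp.measurable_toLp 2 _).comp (measurable_pi_lambda _ fun i => ?_)
      fin_cases i
      · exact (by fun_prop : Measurable fun x : EuclideanSpace ℝ (Fin 2) => x 0)
      · exact (by fun_prop : Measurable fun x : EuclideanSpace ℝ (Fin 2) => x 1)
      · exact hf
    rw [graphSurfaceMeasure, Measure.map_apply hg isClosed_frontier.measurableSet.compl]
    apply withDensity_absolutelyContinuous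
    rw [Measure.restrict_apply (hg isClosed_frontier.measurableSet.compl)]
    convert measure_empty (μ := volume)
    rw [Set.eq_empty_iff_forall_notMem]
    rintro x ⟨hx, hxD⟩
    apply hx
    rw [frontier_oblateEllipsoid]
    rw [mem_oblateShadow] at hxD
    have h2 := hsq x
    rw [oblateHeight, Real.sq_sqrt (by linarith)] at h2
    simp only [oblateForm, Set.mem_ofPred_eq]
    simp [h2]
  rw [oblateSurfaceMeasure, Measure.add_apply, key _ hm (fun _ => rfl),
    key (fun x => -oblateHeight a₁ a₂ R x) hm.neg (fun x => neg_sq _), add_zero]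

/-- The kernel `(1/4π) ⟨y - x, ν(y)⟩ / |x - y|³` of the double layer potential in `ℝ³`, for a
surface with unit normal `ν`. -/
noncomputable def npKernel (ν : EuclideanSpace ℝ (Fin 3) → EuclideanSpace ℝ (Fin 3))
    (X Y : EuclideanSpace ℝ (Fin 3)) : ℝ :=
  1 / (4 * Real.pi) * (inner ℝ (Y - X) (ν Y) / ‖X - Y‖ ^ 3)

/-- `K φ = ψ` almost everywhere on the surface with surface measure `S` and unit normal `ν`, where
`K` is the Neumann-Poincare operator of that surface; the integral has to converge absolutely at
almost every point. -/
def IsNPImage (S : Measure (EuclideanSpace ℝ (Fin 3)))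
    (ν : EuclideanSpace ℝ (Fin 3) → EuclideanSpace ℝ (Fin 3))
    (φ ψ : EuclideanSpace ℝ (Fin 3) → ℂ) : Prop :=
  ∀ᵐ X ∂S, Integrable (fun Y => (npKernel ν X Y : ℂ) * φ Y) S ∧
    ∫ Y, (npKernel ν X Y : ℂ) * φ Y ∂S = ψ X

/-- The square of the Sobolev-Slobodeckij norm of `H^{1/2}` of a surface in `ℝ³` with surface
measure `S`: `‖φ‖²_{L²(S)} + ∬ |φ(x) - φ(y)|² / |x - y|³ dS(y) dS(x)`. -/
noncomputable def sobolevHalfNormSq (S : Measure (EuclideanSpace ℝ (Fin 3)))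
    (φ : EuclideanSpace ℝ (Fin 3) → ℂ) : ENNReal :=
  (∫⁻ X, ‖φ X‖ₑ ^ 2 ∂S) + ∫⁻ X, ∫⁻ Y, ‖φ X - φ Y‖ₑ ^ 2 / ‖X - Y‖ₑ ^ 3 ∂S ∂S

/-- `φ` is a representative of an element of the Sobolev space `H^{1/2}` of the surface. -/
def MemSobolevHalf (S : Measure (EuclideanSpace ℝ (Fin 3)))
    (φ : EuclideanSpace ℝ (Fin 3) → ℂ) : Prop :=
  AEStronglyMeasurable φ S ∧ sobolevHalfNormSq S φ < ⊤

/-- The resolvent set of the Neumann-Poincare operator `K` on `H^{1/2}`: those `z` for which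
`z - K` is a bijection onto `H^{1/2}` with a bounded inverse. Functions are identified when they
agree almost everywhere; `K φ = z φ - ψ` says `(z - K) φ = ψ`. -/
def npResolventSet (S : Measure (EuclideanSpace ℝ (Fin 3)))
    (ν : EuclideanSpace ℝ (Fin 3) → EuclideanSpace ℝ (Fin 3)) : Set ℂ :=
  {z | ∃ C : NNReal, ∀ ψ, MemSobolevHalf S ψ →
    ∃ φ, MemSobolevHalf S φ ∧ IsNPImage S ν φ (fun X => z * φ X - ψ X) ∧
      sobolevHalfNormSq S φ ≤ C * sobolevHalfNormSq S ψ ∧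
      ∀ φ', MemSobolevHalf S φ' → IsNPImage S ν φ' (fun X => z * φ' X - ψ X) → φ' =ᵐ[S] φ}

/-- `σ(K)`, the spectrum of the Neumann-Poincare operator on `H^{1/2}` of the surface. -/
def npSpectrum (S : Measure (EuclideanSpace ℝ (Fin 3)))
    (ν : EuclideanSpace ℝ (Fin 3) → EuclideanSpace ℝ (Fin 3)) : Set ℂ :=
  (npResolventSet S ν)ᶜ

/-- `z` is an eigenvalue of the Neumann-Poincare operator on `H^{1/2}` of the surface. -/
def IsNPEigenvalue (S : Measure (EuclideanSpace ℝ (Fin 3)))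
    (ν : EuclideanSpace ℝ (Fin 3) → EuclideanSpace ℝ (Fin 3)) (z : ℂ) : Prop :=
  ∃ φ, MemSobolevHalf S φ ∧ ¬ φ =ᵐ[S] (fun _ => 0) ∧ IsNPImage S ν φ (fun X => z * φ X)

/-! Let A = diag(a₁R, a₂R, 1), which maps the unit sphere onto the ellipsoid. Pulled back by A, the
Neumann–Poincaré operator becomes an average of reflections: (Kf)(θ) = ½ E f(ρ_u θ), where u = A⁻¹Y,
Y is a standard Gaussian vector and ρ_u is the reflection in the plane orthogonal to u
(`lintegral_npKernel`). Indeed, the kernel times the surface density at ω is a constant times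
|ω-θ|²/|A(ω-θ)|³. The direction of A⁻¹Y has density proportional to |Au|⁻³ on the sphere, u is
parallel to ω-θ when ω = ρ_u θ, and the change of variables from u to ω contributes |ω-θ|⁻¹.

Upper bound. Reflections are involutions that preserve the sphere measure, so half their average is
self-adjoint on L² with norm at most 1/2. As isometries they also preserve the weighted measure
|x-y|⁻³ on pairs of points, and the same L² estimate applied to f(x) - f(y) controls the Sobolev
seminorm. This bounds the resolvent on H^{1/2} at every z off [-1/2, 1/2]
(`exists_sobolev_resolvent`).

Density. The average preserves homogeneous polynomials of degree n and acts on their coefficient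
tensors through the Hermitian matrix M = ½ E ρ_u^{⊗n}. As R → ∞ the direction of u tends to ±e₃, and
ρ_{e₃} exchanges v = e₁ + i e₃ and its conjugate. With n ≈ τR the small deviations of u accumulate
to a phase: ρ_u^{⊗n} v^{⊗n} is close to exp(-2iτY₁/(a₁Y₃)) times the conjugate tensor (coordinates
numbered from 1). Hence M nearly exchanges v^{⊗n} and its conjugate with the real factor l = ½ E
exp(-2iτY₁/(a₁Y₃)), and their sum and difference are approximate eigenvectors for l and -l
(`exists_eigenvector_averageMatrix`). By symmetry of M there are true eigenvalues nearby, and they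
are eigenvalues of K (`isNPEigenvalue_of_tensor`). Varying τ makes l run through (0, 1/2), which
yields both signs (`eventually_exists_isNPEigenvalue`). -/

/-! ### Averages of measure preserving involutions as operators on L². -/

section AveragedReflections

variable {Ω X : Type*} [MeasurableSpace Ω] [MeasurableSpace X]

/-- A jointly measurable family of measure preserving involutions. -/
structure IsReflectionFamily (s : Ω → X → X) (m : Measure X) : Prop where
  measurable : Measurable (fun p : Ω × X => s p.1 p.2)
  involutive : ∀ ω x, s ω (s ω x) = x
  preserving : ∀ ω, MeasurePreserving (s ω) m m

/-- Half of the average of `f` over the images of a point under a random involution. -/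
def IsHalfAverage (γ : Measure Ω) (s : Ω → X → X) (m : Measure X) (f g : X → ℂ) : Prop :=
  ∀ᵐ x ∂m, Integrable (fun ω => f (s ω x)) γ ∧ (1 / 2 : ℂ) * ∫ ω, f (s ω x) ∂γ = g x

variable {γ : Measure Ω} [IsProbabilityMeasure γ] {m : Measure X} [IsFiniteMeasure m]
  {s : Ω → X → X}

theorem IsReflectionFamily.measurePreserving_prod (h : IsReflectionFamily s m) :
    MeasurePreserving (fun p : Ω × X => (p.1, s p.1 p.2)) (γ.prod m) (γ.prod m) :=
  (MeasurePreserving.id γ).skew_product h.measurable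
    (Filter.Eventually.of_forall fun ω => (h.preserving ω).map_eq)

/-- Composition with the random involution, as an isometry of `L²(γ × m)`. -/
noncomputable def reflectionIsometry (γ : Measure Ω) [IsProbabilityMeasure γ]
    (h : IsReflectionFamily s m) : Lp ℂ 2 (γ.prod m) →ₗᵢ[ℂ] Lp ℂ 2 (γ.prod m) :=
  Lp.compMeasurePreservingₗᵢ ℂ _ h.measurePreserving_prod

/-- Functions on `X`, as functions on `Ω × X`. -/
noncomputable def constIsometry (γ : Measure Ω) [IsProbabilityMeasure γ] (m : Measure X)
    [IsFiniteMeasure m] : Lp ℂ 2 m →ₗᵢ[ℂ] Lp ℂ 2 (γ.prod m) :=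
  Lp.compMeasurePreservingₗᵢ ℂ Prod.snd measurePreserving_snd

/-- Half of the average of a family of involutions, as an operator on `L²`. -/
noncomputable def halfAverage (γ : Measure Ω) [IsProbabilityMeasure γ]
    (h : IsReflectionFamily s m) : Lp ℂ 2 m →L[ℂ] Lp ℂ 2 m :=
  (1 / 2 : ℂ) • ((constIsometry γ m).toContinuousLinearMap.adjoint ∘L
    (reflectionIsometry γ h).toContinuousLinearMap ∘L (constIsometry γ m).toContinuousLinearMap)

theorem coeFn_constIsometry (f : Lp ℂ 2 m) :
    constIsometry γ m f =ᵐ[γ.prod m] fun p => f p.2 :=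
  Lp.coeFn_compMeasurePreserving f measurePreserving_snd

theorem coeFn_reflectionIsometry (h : IsReflectionFamily s m) (F : Lp ℂ 2 (γ.prod m)) :
    reflectionIsometry γ h F =ᵐ[γ.prod m] fun p => F (p.1, s p.1 p.2) :=
  Lp.coeFn_compMeasurePreserving F h.measurePreserving_prod

theorem reflectionIsometry_involutive (h : IsReflectionFamily s m) (F : Lp ℂ 2 (γ.prod m)) :
    reflectionIsometry γ h (reflectionIsometry γ h F) = F := by
  apply Lp.ext
  refine (coeFn_reflectionIsometry h _).trans ?_
  have := h.measurePreserving_prod (γ := γ).quasiMeasurePreserving.ae_eq_comp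
    (coeFn_reflectionIsometry h F)
  refine this.trans (Filter.Eventually.of_forall fun p => ?_)
  simp [h.involutive]

/-- The operator is ½ J*UJ with J an isometric embedding. The isometry U squares to the identity, so
it is its own adjoint. -/
theorem isSelfAdjoint_halfAverage (h : IsReflectionFamily s m) :
    IsSelfAdjoint (halfAverage γ h) := by
  rw [ContinuousLinearMap.isSelfAdjoint_iff_isSymmetric]
  intro f g
  have key : ∀ F G,
      inner ℂ (reflectionIsometry γ h F) G = inner ℂ F (reflectionIsometry γ h G) := by
    intro F G
    conv_rhs => rw [← reflectionIsometry_involutive h F]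
    exact ((reflectionIsometry γ h).inner_map_map _ _).symm
  simp only [halfAverage, ContinuousLinearMap.coe_coe, smul_apply,
    ContinuousLinearMap.comp_apply, inner_smul_left, inner_smul_right,
    ContinuousLinearMap.adjoint_inner_left, ContinuousLinearMap.adjoint_inner_right,
    LinearIsometry.coe_toContinuousLinearMap, key]
  rw [show (starRingEnd ℂ) (1 / 2) = 1 / 2 by simp [Complex.conj_ofNat]]

theorem norm_halfAverage_le (h : IsReflectionFamily s m) : ‖halfAverage γ h‖ ≤ 1 / 2 := by
  rw [halfAverage, norm_smul]
  have h1 := (constIsometry γ m).norm_toContinuousLinearMap_le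
  have h2 := (reflectionIsometry γ h).norm_toContinuousLinearMap_le
  have h3 : ‖(constIsometry γ m).toContinuousLinearMap.adjoint‖ ≤ 1 := by
    rwa [LinearIsometryEquiv.norm_map]
  have h4 := ContinuousLinearMap.opNorm_comp_le (reflectionIsometry γ h).toContinuousLinearMap
    (constIsometry γ m).toContinuousLinearMap
  have h5 := ContinuousLinearMap.opNorm_comp_le (constIsometry γ m).toContinuousLinearMap.adjoint
    ((reflectionIsometry γ h).toContinuousLinearMap ∘L (constIsometry γ m).toContinuousLinearMap)
  have h6 := mul_le_one₀ h2 (norm_nonneg _) h1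
  have h7 := mul_le_one₀ h3 (norm_nonneg _) (h4.trans h6)
  have : ‖(1 / 2 : ℂ)‖ = 1 / 2 := by norm_num
  rw [this]
  linarith

/-- The adjoint of the embedding integrates out ω; testing against indicators of sets in `X` and
Fubini identify it. This turns the abstract operator into a pointwise average. -/
theorem coeFn_adjoint_constIsometry (F : Lp ℂ 2 (γ.prod m)) :
    (constIsometry γ m).toContinuousLinearMap.adjoint F =ᵐ[m] fun x => ∫ ω, F (ω, x) ∂γ := by
  have hF : Integrable F (γ.prod m) := (Lp.memLp F).integrable (by norm_num)
  refine Integrable.ae_eq_of_forall_setIntegral_eq _ _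
    ((Lp.memLp _).integrable (by norm_num)) hF.integral_prod_right fun t ht _ => ?_
  have h1 : ∫ x in t, ((constIsometry γ m).toContinuousLinearMap.adjoint F) x ∂m =
      inner ℂ (indicatorConstLp 2 ht (measure_ne_top m t) (1 : ℂ))
        ((constIsometry γ m).toContinuousLinearMap.adjoint F) := by
    rw [L2.inner_indicatorConstLp_one]
  rw [h1, ContinuousLinearMap.adjoint_inner_right]
  have h2 : (constIsometry γ m) (indicatorConstLp 2 ht (measure_ne_top m t) (1 : ℂ)) =
      indicatorConstLp 2 (measurable_snd ht : MeasurableSet ((Prod.snd : Ω × X → X) ⁻¹' t))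
        (measure_ne_top (γ.prod m) _) (1 : ℂ) := by
    apply Lp.ext
    refine (coeFn_constIsometry _).trans ?_
    have h3 := (measurePreserving_snd (μ := γ) (ν := m)).quasiMeasurePreserving.ae_eq_comp
      (indicatorConstLp_coeFn (p := 2) (hs := ht) (hμs := measure_ne_top m t) (c := (1 : ℂ)))
    refine h3.trans (Filter.EventuallyEq.trans ?_ indicatorConstLp_coeFn.symm)
    exact Filter.Eventually.of_forall fun p => rfl
  rw [LinearIsometry.coe_toContinuousLinearMap, h2, L2.inner_indicatorConstLp_one]
  rw [← integral_indicator (measurable_snd ht), integral_prod_symm _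
    (hF.indicator (measurable_snd ht)), ← integral_indicator ht]
  refine integral_congr_ae (Filter.Eventually.of_forall fun x => ?_)
  by_cases hx : x ∈ t <;> simp [Set.indicator, hx]

theorem isHalfAverage_halfAverage (h : IsReflectionFamily s m) (f : Lp ℂ 2 m) :
    IsHalfAverage γ s m f (halfAverage γ h f) := by
  have e1 : halfAverage γ h f =ᵐ[m]
      fun x => (1 / 2 : ℂ) * ∫ ω, reflectionIsometry γ h (constIsometry γ m f) (ω, x) ∂γ := by
    refine (Lp.coeFn_smul (1 / 2 : ℂ) ((constIsometry γ m).toContinuousLinearMap.adjoint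
      (reflectionIsometry γ h (constIsometry γ m f)))).trans ?_
    filter_upwards [coeFn_adjoint_constIsometry (reflectionIsometry γ h (constIsometry γ m f))]
      with x hx
    simp [hx]
  have e2 : reflectionIsometry γ h (constIsometry γ m f) =ᵐ[γ.prod m] fun p => f (s p.1 p.2) := by
    refine (coeFn_reflectionIsometry h _).trans ?_
    exact h.measurePreserving_prod.quasiMeasurePreserving.ae_eq_comp (coeFn_constIsometry f)
  have hI : Integrable (fun p : Ω × X => f (s p.1 p.2)) (γ.prod m) :=
    ((Lp.memLp (reflectionIsometry γ h (constIsometry γ m f))).integrable (by norm_num)).congr e2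
  have e3 : ∀ᵐ x ∂m, ∀ᵐ ω ∂γ,
      reflectionIsometry γ h (constIsometry γ m f) (ω, x) = f (s ω x) := by
    have := (Measure.measurePreserving_swap (μ := m) (ν := γ)).quasiMeasurePreserving.ae_eq_comp e2
    exact Measure.ae_ae_of_ae_prod this
  filter_upwards [e1, e3, hI.prod_left_ae] with x h1 h2 h3
  exact ⟨h3, by rw [h1, integral_congr_ae h2]⟩

/-- Changing `f` on a null set changes `f (s ω x)` only on a null set of pairs, because (ω, x) ↦ s ω
x carries the product measure to `m`; Fubini then gives almost every `x`. -/
theorem IsHalfAverage.congr {f f' g g' : X → ℂ} (h : IsReflectionFamily s m)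
    (hf : f =ᵐ[m] f') (hg : g =ᵐ[m] g') (H : IsHalfAverage γ s m f g) :
    IsHalfAverage γ s m f' g' := by
  have e2 : (fun p : Ω × X => f (s p.1 p.2)) =ᵐ[γ.prod m] fun p => f' (s p.1 p.2) :=
    (measurePreserving_snd.comp h.measurePreserving_prod).quasiMeasurePreserving.ae_eq_comp hf
  have e3 : ∀ᵐ x ∂m, ∀ᵐ ω ∂γ, f (s ω x) = f' (s ω x) := by
    have := (Measure.measurePreserving_swap (μ := m) (ν := γ)).quasiMeasurePreserving.ae_eq_comp e2
    exact Measure.ae_ae_of_ae_prod this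
  filter_upwards [H, hg, e3] with x h1 h2 h3
  exact ⟨h1.1.congr h3, by rw [← h2, ← h1.2, integral_congr_ae h3]⟩

theorem isHalfAverage_iff_halfAverage (h : IsReflectionFamily s m) {f g : X → ℂ}
    (hf : MemLp f 2 m) (hg : MemLp g 2 m) :
    IsHalfAverage γ s m f g ↔ halfAverage γ h (hf.toLp f) = hg.toLp g := by
  have key := (isHalfAverage_halfAverage (γ := γ) h (hf.toLp f)).congr h hf.coeFn_toLp
    Filter.EventuallyEq.rfl
  constructor
  · intro H
    apply Lp.ext
    filter_upwards [H, key, hg.coeFn_toLp] with x h1 h2 h3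
    rw [h3, ← h1.2, ← h2.2]
  · intro H
    rw [H] at key
    exact key.congr h Filter.EventuallyEq.rfl hg.coeFn_toLp

end AveragedReflections

/-! ### Resolvent of a self-adjoint operator of norm at most 1/2. -/

section Resolvent

/-- The numbers off the segment `[-1/2, 1/2]` of the real line. -/
def offSegment : Set ℂ := ((fun t : ℝ => (t : ℂ)) '' Set.Icc (-(1 / 2) : ℝ) (1 / 2))ᶜ

variable {H : Type*} [NormedAddCommGroup H] [InnerProductSpace ℂ H]

/-- The bound depends on `z` only, not on the space or the operator; later it is needed for
infinitely many measures at once. For real `z` it is |z| - 1/2, by the triangle inequality.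
Otherwise it is |Im z|, because ⟨f, Tf⟩ is real. -/
theorem exists_norm_sub_apply_ge {z : ℂ} (hz : z ∈ offSegment) : ∃ c : ℝ, 0 < c ∧
    ∀ {H : Type*} [NormedAddCommGroup H] [InnerProductSpace ℂ H] [CompleteSpace H]
      (T : H →L[ℂ] H), IsSelfAdjoint T → ‖T‖ ≤ 1 / 2 → ∀ f : H, c * ‖f‖ ≤ ‖z • f - T f‖ := by
  by_cases him : z.im = 0
  · refine ⟨|z.re| - 1 / 2, ?_, ?_⟩
    · by_contra hcon
      apply hz
      refine ⟨z.re, ?_, Complex.ext (by simp) (by simp [him])⟩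
      exact abs_le.1 (by linarith)
    · intro H _ _ _ T _ hn f
      have h1 : ‖T f‖ ≤ 1 / 2 * ‖f‖ := T.le_of_opNorm_le hn f
      have h2 : ‖z • f‖ = |z.re| * ‖f‖ := by
        rw [norm_smul]
        congr 1
        have : z = (z.re : ℂ) := Complex.ext (by simp) (by simp [him])
        rw [this]
        simp
      have h3 := norm_sub_norm_le (z • f) (T f)
      rw [h2] at h3
      linarith
  · refine ⟨|z.im|, abs_pos.2 him, ?_⟩
    intro H _ _ _ T hT hn f
    rcases eq_or_ne f 0 with rfl | hf
    · simp
    have hreal : (inner ℂ f (T f)).im = 0 := by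
      have := (ContinuousLinearMap.isSelfAdjoint_iff_isSymmetric.1 hT).im_inner_self_apply f
      simpa using this
    have h1 : (inner ℂ f (z • f - T f)).im = z.im * ‖f‖ ^ 2 := by
      rw [inner_sub_right, inner_smul_right, Complex.sub_im, hreal, inner_self_eq_norm_sq_to_K]
      simp [← Complex.ofReal_pow]
    have h2 : |z.im| * ‖f‖ ^ 2 ≤ ‖f‖ * ‖z • f - T f‖ := by
      calc |z.im| * ‖f‖ ^ 2 = |(inner ℂ f (z • f - T f)).im| := by
            rw [h1, abs_mul, abs_of_nonneg (sq_nonneg ‖f‖)]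
        _ ≤ ‖inner ℂ f (z • f - T f)‖ := Complex.abs_im_le_norm _
        _ ≤ _ := norm_inner_le_norm _ _
    have h3 : 0 < ‖f‖ := norm_pos_iff.2 hf
    nlinarith

theorem exists_sub_apply_eq [CompleteSpace H] {z : ℂ} (hz : z ∈ offSegment) (T : H →L[ℂ] H)
    (hT : IsSelfAdjoint T) (hn : ‖T‖ ≤ 1 / 2) (g : H) : ∃ f, z • f - T f = g := by
  have hmem : z ∉ spectrum ℂ T := by
    intro hs
    apply hz
    have h1 : z = (z.re : ℂ) := hT.mem_spectrum_eq_re hs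
    rcases subsingleton_or_nontrivial H with hH | hH
    · exact absurd hs (by simp [spectrum.of_subsingleton])
    have h2 := (spectrum.norm_le_norm_of_mem hs).trans hn
    rw [h1, Complex.norm_real] at h2
    exact ⟨z.re, abs_le.1 h2, h1.symm⟩
  rw [spectrum.notMem_iff] at hmem
  obtain ⟨u, hu⟩ := hmem
  refine ⟨(↑u⁻¹ : H →L[ℂ] H) g, ?_⟩
  have : ((u : H →L[ℂ] H) * ((u⁻¹ : (H →L[ℂ] H)ˣ) : H →L[ℂ] H)) g = g := by simp
  rw [hu] at this
  simpa [Algebra.algebraMap_eq_smul_one] using this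

end Resolvent

/-! ### The resolvent equation for functions, with uniform bounds. -/

section AveragedReflections

variable {Ω X : Type*} [MeasurableSpace Ω] [MeasurableSpace X]
  {γ : Measure Ω} [IsProbabilityMeasure γ] {m : Measure X} [IsFiniteMeasure m]
  {s : Ω → X → X}

theorem exists_isHalfAverage_sub (h : IsReflectionFamily s m) {z : ℂ} (hz : z ∈ offSegment)
    {g : X → ℂ} (hg : MemLp g 2 m) :
    ∃ f, StronglyMeasurable f ∧ MemLp f 2 m ∧ IsHalfAverage γ s m f (fun x => z * f x - g x) := by
  obtain ⟨f, hf⟩ := exists_sub_apply_eq hz (halfAverage γ h) (isSelfAdjoint_halfAverage h)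
    (norm_halfAverage_le h) (hg.toLp g)
  refine ⟨f, Lp.stronglyMeasurable f, Lp.memLp f, ?_⟩
  have hzg : MemLp (fun x => z * f x - g x) 2 m := ((Lp.memLp f).const_mul z).sub hg
  rw [isHalfAverage_iff_halfAverage h (Lp.memLp f) hzg]
  have h1 : halfAverage γ h f = z • f - hg.toLp g := by rw [← hf]; abel
  rw [Lp.toLp_coeFn, h1]
  apply Lp.ext
  filter_upwards [hzg.coeFn_toLp,
    Lp.coeFn_sub (z • f) (hg.toLp g), Lp.coeFn_smul z f, hg.coeFn_toLp] with x h1 h2 h3 h4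
  rw [h1, h2]
  simp [h3, h4]

theorem exists_lintegral_sq_le_of_isHalfAverage {z : ℂ} (hz : z ∈ offSegment) :
    ∃ C : NNReal, ∀ {Ω X : Type*} [MeasurableSpace Ω] [MeasurableSpace X]
      {γ : Measure Ω} [IsProbabilityMeasure γ] {m : Measure X} [IsFiniteMeasure m]
      {s : Ω → X → X}, IsReflectionFamily s m → ∀ {f g : X → ℂ}, MemLp f 2 m →
      AEStronglyMeasurable g m →
      IsHalfAverage γ s m f (fun x => z * f x - g x) →
      ∫⁻ x, ‖f x‖ₑ ^ 2 ∂m ≤ C * ∫⁻ x, ‖g x‖ₑ ^ 2 ∂m := by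
  obtain ⟨c, hc, H⟩ := exists_norm_sub_apply_ge hz
  -- A nonzero constant makes the bound trivial when `g` has infinite L² norm, so that `g` need not
  -- be assumed square integrable.
  have hne : ((c.toNNReal⁻¹ ^ 2 : NNReal) : ENNReal) ≠ 0 := by
    simp [hc]
  refine ⟨c.toNNReal⁻¹ ^ 2, ?_⟩
  intro Ω X _ _ γ _ m _ s h f g hf hg' hfg
  by_cases htop : ∫⁻ x, ‖g x‖ₑ ^ 2 ∂m = ⊤
  · rw [htop, ENNReal.mul_top hne]
    exact le_top
  have hsq : ∀ {f : X → ℂ}, eLpNorm f 2 m ^ 2 = ∫⁻ x, ‖f x‖ₑ ^ 2 ∂m := by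
    intro f
    have := eLpNorm_nnreal_pow_eq_lintegral (μ := m) (f := f) (p := 2) (by norm_num)
    simpa using this
  have hg : MemLp g 2 m := by
    refine ⟨hg', ?_⟩
    by_contra hcon
    apply htop
    rw [← hsq, top_le_iff.1 (not_lt.1 hcon)]
    simp
  have hzg : MemLp (fun x => z * f x - g x) 2 m := (hf.const_mul z).sub hg
  have key := (isHalfAverage_iff_halfAverage h hf hzg).1 hfg
  have h1 : z • hf.toLp f - halfAverage γ h (hf.toLp f) = hg.toLp g := by
    rw [key]
    have : hzg.toLp _ = z • hf.toLp f - hg.toLp g := rfl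
    rw [this]
    abel
  have h2 := H (halfAverage γ h) (isSelfAdjoint_halfAverage h) (norm_halfAverage_le h) (hf.toLp f)
  rw [h1] at h2
  have h3 : ‖hf.toLp f‖ₑ ≤ c.toNNReal⁻¹ * ‖hg.toLp g‖ₑ := by
    have h4 : ‖hf.toLp f‖ ≤ c⁻¹ * ‖hg.toLp g‖ := by
      rw [inv_mul_eq_div, le_div_iff₀ hc]
      linarith
    simp only [enorm, ← ENNReal.coe_mul, ENNReal.coe_le_coe]
    rw [← NNReal.coe_le_coe]
    simpa [hc.le, ENNReal.coe_toNNReal_eq_toReal] using h4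
  rw [Lp.enorm_toLp, Lp.enorm_toLp] at h3
  calc ∫⁻ x, ‖f x‖ₑ ^ 2 ∂m = eLpNorm f 2 m ^ 2 := hsq.symm
    _ ≤ (c.toNNReal⁻¹ * eLpNorm g 2 m) ^ 2 := by gcongr
    _ = _ := by rw [mul_pow, hsq, ENNReal.coe_pow]

end AveragedReflections

/-! ### Integration in Cartesian coordinates and scaling. -/

section Coordinates

variable {α : Type*} [MeasurableSpace α]

@[fun_prop]
theorem Measurable.vecThree {f g h : α → ℝ} (hf : Measurable f) (hg : Measurable g)
    (hh : Measurable h) : Measurable (fun x => !₂[f x, g x, h x]) := by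
  refine (WithLp.measurable_toLp 2 _).comp (measurable_pi_lambda _ fun i => ?_)
  fin_cases i
  exacts [hf, hg, hh]

theorem measurePreserving_vecTwo (μ : Measure ℝ) [SigmaFinite μ] :
    MeasurePreserving (fun p : ℝ × ℝ => !₂[p.1, p.2]) (μ.prod μ)
      ((Measure.pi fun _ : Fin 2 => μ).map (WithLp.toLp 2)) := by
  have h1 := (measurePreserving_finTwoArrow μ).symm
  have h2 : MeasurePreserving (WithLp.toLp 2 : (Fin 2 → ℝ) → _)
      (Measure.pi fun _ : Fin 2 => μ) _ := (WithLp.measurable_toLp 2 _).measurePreserving _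
  exact h2.comp h1

theorem measurePreserving_vecThree (μ : Measure ℝ) [SigmaFinite μ] :
    MeasurePreserving (fun p : (ℝ × ℝ) × ℝ => !₂[p.1.1, p.1.2, p.2]) ((μ.prod μ).prod μ)
      ((Measure.pi fun _ : Fin 3 => μ).map (WithLp.toLp 2)) := by
  have h1 := (measurePreserving_finTwoArrow μ).symm
  have h2 : MeasurePreserving (WithLp.toLp 2 : (Fin 3 → ℝ) → _)
      (Measure.pi fun _ : Fin 3 => μ) _ := (WithLp.measurable_toLp 2 _).measurePreserving _
  have h3 := (measurePreserving_piFinSuccAbove (fun _ : Fin 3 => μ) 2).symm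
  have h4 := h2.comp (h3.comp (((MeasurePreserving.id μ).prod h1).comp
    (Measure.measurePreserving_swap (μ := μ.prod μ) (ν := μ))))
  convert h4 using 1
  ext p i
  fin_cases i <;> rfl

theorem lintegral_plane {f : EuclideanSpace ℝ (Fin 2) → ENNReal} (hf : Measurable f) :
    ∫⁻ x, f x = ∫⁻ p : ℝ × ℝ, f !₂[p.1, p.2] := by
  have h := measurePreserving_vecTwo (volume : Measure ℝ)
  have h2 := (PiLp.volume_preserving_toLp (Fin 2)).map_eq
  rw [volume_pi] at h2
  rw [h2] at h
  exact (h.lintegral_comp hf).symm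

theorem lintegral_space {f : EuclideanSpace ℝ (Fin 3) → ENNReal} (hf : Measurable f) :
    ∫⁻ x, f x = ∫⁻ z : ℝ, ∫⁻ p : ℝ × ℝ, f !₂[p.1, p.2, z] := by
  have h := measurePreserving_vecThree (volume : Measure ℝ)
  have h2 := (PiLp.volume_preserving_toLp (Fin 3)).map_eq
  rw [volume_pi] at h2
  rw [h2] at h
  rw [← h.lintegral_comp hf, lintegral_prod_symm' _ (by fun_prop)]
  rfl

theorem lintegral_Ioi_comp_mul {c : ℝ} (hc : 0 < c) (f : ℝ → ENNReal) :
    ∫⁻ x in Set.Ioi 0, f x = ∫⁻ x in Set.Ioi 0, ENNReal.ofReal c * f (c * x) := by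
  have h := lintegral_image_eq_lintegral_abs_deriv_mul (s := Set.Ioi (0 : ℝ)) (f := fun x => c * x)
    (f' := fun _ => c) measurableSet_Ioi
    (fun x _ => by simpa using ((hasDerivAt_id' x).const_mul c).hasDerivWithinAt)
    (fun x _ y _ hxy => by simpa [hc.ne'] using hxy) f
  have h2 : (fun x => c * x) '' Set.Ioi (0 : ℝ) = Set.Ioi 0 := by
    rw [Set.image_mul_left_Ioi hc, mul_zero]
  rw [h2, abs_of_pos hc] at h
  exact h

theorem lintegral_comp_mul {c : ℝ} (hc : 0 < c) (f : ℝ → ENNReal) :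
    ∫⁻ x, f x = ENNReal.ofReal c * ∫⁻ x, f (c * x) := by
  have h := lintegral_image_eq_lintegral_abs_deriv_mul (s := Set.univ) (f := fun x => c * x)
    (f' := fun _ => c) MeasurableSet.univ
    (fun x _ => by simpa using (hasDerivAt_id' x).const_mul c)
    (fun x _ y _ hxy => by simpa [hc.ne'] using hxy) f
  have h2 : (fun x => c * x) '' Set.univ = Set.univ := by
    rw [Set.image_univ]
    exact (mul_left_surjective₀ hc.ne').range_eq
  rw [h2, abs_of_pos hc] at h
  simpa [lintegral_const_mul'] using h

theorem lintegral_prod_comp_mul {a b : ℝ} (ha : 0 < a) (hb : 0 < b) {f : ℝ × ℝ → ENNReal}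
    (hf : Measurable f) :
    ∫⁻ p, f p = ENNReal.ofReal (a * b) * ∫⁻ p : ℝ × ℝ, f (a * p.1, b * p.2) := by
  rw [Measure.volume_eq_prod, lintegral_prod _ hf.aemeasurable,
    lintegral_prod _ (by fun_prop), lintegral_comp_mul ha, ENNReal.ofReal_mul ha.le, mul_assoc]
  congr 1
  rw [← lintegral_const_mul' _ _ (by simp)]
  exact lintegral_congr fun x => lintegral_comp_mul hb _

end Coordinates

/-! ### The surface measure of the sphere and polar coordinates in space. -/

section Sphere

open Real Set

/-- The unit sphere in cylindrical coordinates: height and longitude. -/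
noncomputable def spherePoint (z φ : ℝ) : EuclideanSpace ℝ (Fin 3) :=
  !₂[√(1 - z ^ 2) * cos φ, √(1 - z ^ 2) * sin φ, z]

/-- The surface measure of the unit sphere, which has density one in cylindrical coordinates. -/
noncomputable def sphereSurface : Measure (EuclideanSpace ℝ (Fin 3)) :=
  (((volume : Measure ℝ).restrict (Ioo (-1) 1)).prod
    ((volume : Measure ℝ).restrict (Ioo (-π) π))).map fun p => spherePoint p.1 p.2

@[fun_prop]
theorem measurable_spherePoint : Measurable (fun p : ℝ × ℝ => spherePoint p.1 p.2) := by
  unfold spherePoint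
  fun_prop

theorem lintegral_sphereSurface {f : EuclideanSpace ℝ (Fin 3) → ENNReal} (hf : Measurable f) :
    ∫⁻ x, f x ∂sphereSurface = ∫⁻ z in Ioo (-1) 1, ∫⁻ φ in Ioo (-π) π, f (spherePoint z φ) := by
  rw [sphereSurface, lintegral_map hf measurable_spherePoint, lintegral_prod]
  exact (hf.comp measurable_spherePoint).aemeasurable

theorem sphereSurface_univ : sphereSurface univ = ENNReal.ofReal (4 * π) := by
  rw [← lintegral_one, lintegral_sphereSurface measurable_const]
  simp only [lintegral_one, Measure.restrict_apply_univ, Real.volume_Ioo, setLIntegral_const]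
  rw [← ENNReal.ofReal_mul (by linarith [pi_pos])]
  congr 1
  ring

instance : IsFiniteMeasure sphereSurface := ⟨sphereSurface_univ ▸ ENNReal.ofReal_lt_top⟩

theorem norm_spherePoint {z : ℝ} (hz : z ∈ Ioo (-1 : ℝ) 1) (φ : ℝ) : ‖spherePoint z φ‖ = 1 := by
  have h : 0 ≤ 1 - z ^ 2 := by nlinarith [hz.1, hz.2]
  rw [EuclideanSpace.norm_eq, Fin.sum_univ_three]
  simp only [spherePoint, norm_eq_abs, sq_abs, Matrix.cons_val, mul_pow, sq_sqrt h]
  rw [show (1 - z ^ 2) * cos φ ^ 2 + (1 - z ^ 2) * sin φ ^ 2 + z ^ 2 = 1 by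
    linear_combination (1 - z ^ 2) * sin_sq_add_cos_sq φ]
  exact sqrt_one

theorem ae_norm_eq_one : ∀ᵐ x ∂sphereSurface, ‖x‖ = 1 := by
  rw [sphereSurface, ae_map_iff (by fun_prop) (measurableSet_eq_fun (by fun_prop) (by fun_prop)),
    Measure.prod_restrict, ae_restrict_iff' (measurableSet_Ioo.prod measurableSet_Ioo)]
  exact Filter.Eventually.of_forall fun p hp => norm_spherePoint hp.1 _

theorem hasDerivAt_sqrt_one_sub_sq {z : ℝ} (hz : z ∈ Ioo (-1 : ℝ) 1) :
    HasDerivAt (fun z => √(1 - z ^ 2)) (-z / √(1 - z ^ 2)) z := by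
  have h : 0 < 1 - z ^ 2 := by nlinarith [hz.1, hz.2]
  have := (((hasDerivAt_id' z).pow 2).const_sub 1).sqrt h.ne'
  refine HasDerivAt.congr_deriv (f := fun z => √(1 - z ^ 2)) this ?_
  change -(((2 : ℕ) : ℝ) * z ^ (2 - 1) * 1) / (2 * √(1 - z ^ 2)) = -z / √(1 - z ^ 2)
  norm_num
  ring

theorem image_mul_div_sqrt_one_sub_sq {c : ℝ} (hc : 0 < c) :
    (fun z => c * (z / √(1 - z ^ 2))) '' Ioo (-1) 1 = univ := by
  -- The solution z of c z / √(1 - z²) = t.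
  refine eq_univ_of_forall fun t => ⟨t / √(c ^ 2 + t ^ 2), ?_, ?_⟩
  · have h : |t| < √(c ^ 2 + t ^ 2) := by
      rw [← sqrt_sq_eq_abs]
      exact sqrt_lt_sqrt (sq_nonneg _) (by nlinarith)
    have h0 := (abs_nonneg t).trans_lt h
    rw [mem_Ioo, ← abs_lt, abs_div, abs_of_pos h0, div_lt_one h0]
    exact h
  · have h : 0 < c ^ 2 + t ^ 2 := by positivity
    have h1 : 1 - (t / √(c ^ 2 + t ^ 2)) ^ 2 = (c / √(c ^ 2 + t ^ 2)) ^ 2 := by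
      rw [div_pow, div_pow, sq_sqrt h.le]
      field_simp
      ring
    have h2 := sqrt_pos.2 h
    simp only [h1]
    rw [sqrt_sq (by positivity)]
    field_simp

/-- On the cylinder of radius `c` about the axis, c z / √(1 - z²) is the height reached by a ray
whose direction has height z on the unit sphere. -/
theorem lintegral_eq_lintegral_Ioo_comp {c : ℝ} (hc : 0 < c) (f : ℝ → ENNReal) :
    ∫⁻ t, f t = ∫⁻ z in Ioo (-1) 1,
      ENNReal.ofReal (c / √(1 - z ^ 2) ^ 3) * f (c * (z / √(1 - z ^ 2))) := by
  have hd : ∀ z ∈ Ioo (-1 : ℝ) 1, HasDerivAt (fun z => c * (z / √(1 - z ^ 2)))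
      (c / √(1 - z ^ 2) ^ 3) z := by
    intro z hz
    have h : 0 < 1 - z ^ 2 := by nlinarith [hz.1, hz.2]
    have h2 := sqrt_pos.2 h
    refine HasDerivAt.congr_deriv (f := fun z => c * (z / √(1 - z ^ 2)))
      (((hasDerivAt_id' z).div (hasDerivAt_sqrt_one_sub_sq hz) h2.ne').const_mul c) ?_
    field_simp
    rw [sq_sqrt h.le]
    ring
  have hpos : ∀ z ∈ Ioo (-1 : ℝ) 1, 0 < c / √(1 - z ^ 2) ^ 3 := by
    intro z hz
    have h : 0 < 1 - z ^ 2 := by nlinarith [hz.1, hz.2]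
    have h2 := sqrt_pos.2 h
    positivity
  have hmono : StrictMonoOn (fun z => c * (z / √(1 - z ^ 2))) (Ioo (-1) 1) := by
    refine strictMonoOn_of_deriv_pos (convex_Ioo _ _)
      (fun z hz => (hd z hz).continuousAt.continuousWithinAt) fun z hz => ?_
    rw [interior_Ioo] at hz
    rw [(hd z hz).deriv]
    exact hpos z hz
  have h := lintegral_image_eq_lintegral_abs_deriv_mul measurableSet_Ioo
    (fun z hz => (hd z hz).hasDerivWithinAt) hmono.injOn f
  rw [image_mul_div_sqrt_one_sub_sq hc, Measure.restrict_univ] at h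
  rw [h]
  refine setLIntegral_congr_fun measurableSet_Ioo fun z hz => ?_
  simp only [abs_of_pos (hpos z hz)]

/-- Integration in polar coordinates. -/
theorem lintegral_polar {f : EuclideanSpace ℝ (Fin 3) → ENNReal} (hf : Measurable f) :
    ∫⁻ x, f x = ∫⁻ ω, (∫⁻ r in Ioi (0 : ℝ), ENNReal.ofReal (r ^ 2) * f (r • ω)) ∂sphereSurface := by
  have hm : Measurable fun q : EuclideanSpace ℝ (Fin 3) × ℝ =>
      ENNReal.ofReal (q.2 ^ 2) * f (q.2 • q.1) := by fun_prop
  rw [lintegral_sphereSurface (hm.lintegral_prod_right'), lintegral_space hf]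
  have h1 : ∀ z : ℝ, ∫⁻ p : ℝ × ℝ, f !₂[p.1, p.2, z] = ∫⁻ ρ in Ioi (0 : ℝ),
      ∫⁻ φ in Ioo (-π) π, ENNReal.ofReal ρ * f !₂[ρ * cos φ, ρ * sin φ, z] := by
    intro z
    rw [← lintegral_comp_polarCoord_symm, polarCoord_target, Measure.volume_eq_prod,
      ← Measure.prod_restrict, lintegral_prod]
    · rfl
    · simp only [polarCoord_symm_apply, smul_eq_mul]
      fun_prop
  simp only [h1]
  rw [lintegral_lintegral_swap (by
    have : Measurable fun q : (ℝ × ℝ) × ℝ =>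
      ENNReal.ofReal q.1.2 * f !₂[q.1.2 * cos q.2, q.1.2 * sin q.2, q.1.1] := by fun_prop
    exact (this.lintegral_prod_right').aemeasurable)]
  -- At fixed distance ρ from the axis, the height in space is traded for the height of the
  -- direction.
  have h2 : ∀ ρ ∈ Ioi (0 : ℝ), ∫⁻ z : ℝ, ∫⁻ φ in Ioo (-π) π,
      ENNReal.ofReal ρ * f !₂[ρ * cos φ, ρ * sin φ, z] =
      ∫⁻ z in Ioo (-1) 1, ∫⁻ φ in Ioo (-π) π, ENNReal.ofReal (ρ ^ 2 / √(1 - z ^ 2) ^ 3) *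
        f !₂[ρ * cos φ, ρ * sin φ, ρ * (z / √(1 - z ^ 2))] := by
    intro ρ hρ
    rw [lintegral_eq_lintegral_Ioo_comp hρ]
    refine lintegral_congr fun z => ?_
    rw [← lintegral_const_mul' _ _ (by simp)]
    refine lintegral_congr fun φ => ?_
    rw [← mul_assoc, mul_comm (ENNReal.ofReal _), ← ENNReal.ofReal_mul (le_of_lt hρ)]
    congr 2
    ring
  rw [setLIntegral_congr_fun measurableSet_Ioi h2, lintegral_lintegral_swap (by
    have : Measurable fun q : (ℝ × ℝ) × ℝ =>
      ENNReal.ofReal (q.1.1 ^ 2 / √(1 - q.1.2 ^ 2) ^ 3) *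
      f !₂[q.1.1 * cos q.2, q.1.1 * sin q.2, q.1.1 * (q.1.2 / √(1 - q.1.2 ^ 2))] := by fun_prop
    exact (this.lintegral_prod_right').aemeasurable)]
  refine setLIntegral_congr_fun measurableSet_Ioo fun z hz => ?_
  have hz0 : 0 < 1 - z ^ 2 := by nlinarith [hz.1, hz.2]
  have hz1 := sqrt_pos.2 hz0
  rw [lintegral_lintegral_swap (by fun_prop)]
  refine lintegral_congr fun φ => ?_
  -- With the direction fixed, ρ = r √(1 - z²) brings in the distance r from the origin.
  rw [lintegral_Ioi_comp_mul hz1]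
  refine setLIntegral_congr_fun measurableSet_Ioi fun r hr => ?_
  have hr : 0 < r := hr
  rw [← mul_assoc, ← ENNReal.ofReal_mul hz1.le]
  congr 2
  · field_simp
  · rw [spherePoint]
    ext i
    fin_cases i
    · simp; ring
    · simp; ring
    · simp; field_simp

end Sphere

/-! ### Directions of Gaussian vectors and the invariance of the sphere measure. -/

section Gaussian

open Real Set ProbabilityTheory

/-- The linear map that stretches the first two coordinates. -/
noncomputable def stretch (a b : ℝ) : EuclideanSpace ℝ (Fin 3) →ₗ[ℝ] EuclideanSpace ℝ (Fin 3) where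
  toFun X := !₂[a * X 0, b * X 1, X 2]
  map_add' X Y := by
    ext i
    fin_cases i <;> simp <;> ring
  map_smul' c X := by
    ext i
    fin_cases i <;> simp <;> ring

theorem stretch_apply (a b : ℝ) (X : EuclideanSpace ℝ (Fin 3)) :
    stretch a b X = !₂[a * X 0, b * X 1, X 2] := rfl

@[fun_prop]
theorem measurable_stretch (a b : ℝ) : Measurable (stretch a b) :=
  (LinearMap.continuous_of_finiteDimensional _).measurable

theorem stretch_inv_stretch {a b : ℝ} (ha : 0 < a) (hb : 0 < b) (X : EuclideanSpace ℝ (Fin 3)) :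
    stretch a⁻¹ b⁻¹ (stretch a b X) = X := by
  ext i
  fin_cases i <;> simp [stretch_apply, ha.ne', hb.ne']

theorem stretch_stretch_inv {a b : ℝ} (ha : 0 < a) (hb : 0 < b) (X : EuclideanSpace ℝ (Fin 3)) :
    stretch a b (stretch a⁻¹ b⁻¹ X) = X := by
  ext i
  fin_cases i <;> simp [stretch_apply, ha.ne', hb.ne']

theorem stretch_ne_zero {a b : ℝ} (ha : 0 < a) (hb : 0 < b) {X : EuclideanSpace ℝ (Fin 3)}
    (hX : X ≠ 0) : stretch a b X ≠ 0 := by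
  intro h
  apply hX
  rw [← stretch_inv_stretch ha hb X, h, map_zero]

theorem lintegral_comp_stretch {a b : ℝ} (ha : 0 < a) (hb : 0 < b)
    {f : EuclideanSpace ℝ (Fin 3) → ENNReal} (hf : Measurable f) :
    ∫⁻ x, f x = ENNReal.ofReal (a * b) * ∫⁻ x, f (stretch a b x) := by
  rw [lintegral_space hf, lintegral_space (by fun_prop), ← lintegral_const_mul' _ _ (by simp)]
  refine lintegral_congr fun z => ?_
  rw [lintegral_prod_comp_mul ha hb (by fun_prop)]
  rfl

/-- The radial profile of the standard Gaussian density on space. -/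
noncomputable def gaussianProfile (r : ℝ) : ENNReal :=
  ENNReal.ofReal ((√(2 * π))⁻¹ ^ 3 * exp (-r ^ 2 / 2))

@[fun_prop]
theorem measurable_gaussianProfile : Measurable gaussianProfile := by
  unfold gaussianProfile
  fun_prop

theorem lintegral_stdGaussian_prod {f : EuclideanSpace ℝ (Fin 3) → ENNReal} (hf : Measurable f) :
    ∫⁻ x, f x ∂stdGaussian (EuclideanSpace ℝ (Fin 3)) =
      ∫⁻ p, f !₂[p.1.1, p.1.2, p.2] ∂(((gaussianReal 0 1).prod (gaussianReal 0 1)).prod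
        (gaussianReal 0 1)) := by
  rw [← map_pi_eq_stdGaussian]
  exact ((measurePreserving_vecThree (gaussianReal 0 1)).lintegral_comp hf).symm

theorem lintegral_stdGaussian {f : EuclideanSpace ℝ (Fin 3) → ENNReal} (hf : Measurable f) :
    ∫⁻ x, f x ∂stdGaussian (EuclideanSpace ℝ (Fin 3)) = ∫⁻ x, gaussianProfile ‖x‖ * f x := by
  rw [lintegral_stdGaussian_prod hf, gaussianReal_of_var_ne_zero _ one_ne_zero,
    prod_withDensity (by fun_prop) (by fun_prop), prod_withDensity (by fun_prop) (by fun_prop),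
    lintegral_withDensity_eq_lintegral_mul _ (by fun_prop) (by fun_prop),
    lintegral_space (by fun_prop), lintegral_prod_symm' _ (by fun_prop)]
  refine lintegral_congr fun z => lintegral_congr fun p => ?_
  simp only [Pi.mul_apply]
  congr 1
  rw [gaussianPDF, gaussianPDF, gaussianPDF, ← ENNReal.ofReal_mul (gaussianPDFReal_nonneg _ _ _),
    ← ENNReal.ofReal_mul (mul_nonneg (gaussianPDFReal_nonneg _ _ _) (gaussianPDFReal_nonneg _ _ _)),
    gaussianProfile]
  congr 1
  rw [EuclideanSpace.real_norm_sq_eq, Fin.sum_univ_three]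
  simp only [gaussianPDFReal, Matrix.cons_val]
  have : exp (-(p.1 ^ 2 + p.2 ^ 2 + z ^ 2) / 2) =
      exp (-(p.1 ^ 2) / 2) * exp (-(p.2 ^ 2) / 2) * exp (-(z ^ 2) / 2) := by
    rw [← exp_add, ← exp_add]
    ring_nf
  rw [this]
  simp
  ring

/-- The radial integral that relates the standard Gaussian to the surface of the sphere. -/
noncomputable def gaussianRadial : ENNReal :=
  ∫⁻ r in Ioi (0 : ℝ), ENNReal.ofReal (r ^ 2) * gaussianProfile r

theorem lintegral_Ioi_gaussianProfile_mul {c : ℝ} (hc : 0 < c) :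
    ∫⁻ r in Ioi (0 : ℝ), ENNReal.ofReal (r ^ 2) * gaussianProfile (r * c) =
      ENNReal.ofReal (c⁻¹ ^ 3) * gaussianRadial := by
  rw [gaussianRadial, lintegral_Ioi_comp_mul hc (fun r => _ * gaussianProfile r),
    ← lintegral_const_mul' _ _ (by simp)]
  refine lintegral_congr fun r => ?_
  rw [← mul_assoc, ← mul_assoc, ← ENNReal.ofReal_mul (by positivity),
    ← ENNReal.ofReal_mul (by positivity), mul_comm r c]
  congr 2
  field_simp

/-- With A the stretch, this says that the direction of A⁻¹Y has a density proportional to |Aω|⁻³ on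
the sphere. In polar coordinates the radial integral at ω is that of the profile rescaled by |Aω|.
-/
theorem lintegral_stdGaussian_stretch {a b : ℝ} (ha : 0 < a) (hb : 0 < b)
    {g : EuclideanSpace ℝ (Fin 3) → ENNReal} (hg : Measurable g)
    (hhom : ∀ r : ℝ, 0 < r → ∀ x, g (r • x) = g x) :
    ∫⁻ y, g (stretch a⁻¹ b⁻¹ y) ∂stdGaussian (EuclideanSpace ℝ (Fin 3)) =
      ENNReal.ofReal (a * b) * gaussianRadial *
        ∫⁻ ω, ENNReal.ofReal (‖stretch a b ω‖⁻¹ ^ 3) * g ω ∂sphereSurface := by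
  rw [lintegral_stdGaussian (by fun_prop), lintegral_comp_stretch ha hb (by fun_prop), mul_assoc]
  congr 1
  simp only [stretch_inv_stretch ha hb]
  rw [lintegral_polar (by fun_prop), ← lintegral_const_mul _ (by fun_prop)]
  refine lintegral_congr_ae ?_
  filter_upwards [ae_norm_eq_one] with ω hω
  have h0 : ω ≠ 0 := by
    rintro rfl
    simp at hω
  have hc : 0 < ‖stretch a b ω‖ := norm_pos_iff.2 (stretch_ne_zero ha hb h0)
  calc ∫⁻ r in Ioi (0 : ℝ), ENNReal.ofReal (r ^ 2) *
        (gaussianProfile ‖stretch a b (r • ω)‖ * g (r • ω))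
      = ∫⁻ r in Ioi (0 : ℝ), ENNReal.ofReal (r ^ 2) * gaussianProfile (r * ‖stretch a b ω‖) * g ω :=
        setLIntegral_congr_fun measurableSet_Ioi fun r hr => by
          have hr : 0 < r := hr
          rw [map_smul, norm_smul, norm_eq_abs, abs_of_pos hr, hhom r hr, mul_assoc]
    _ = _ := by
      rw [lintegral_mul_const _ (by fun_prop), lintegral_Ioi_gaussianProfile_mul hc]
      ring

theorem stretch_one : stretch 1 1 = LinearMap.id := by
  ext X i
  fin_cases i <;> simp [stretch_apply]

theorem lintegral_stdGaussian_of_homogeneous {g : EuclideanSpace ℝ (Fin 3) → ENNReal}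
    (hg : Measurable g) (hhom : ∀ r : ℝ, 0 < r → ∀ x, g (r • x) = g x) :
    ∫⁻ y, g y ∂stdGaussian (EuclideanSpace ℝ (Fin 3)) =
      gaussianRadial * ∫⁻ ω, g ω ∂sphereSurface := by
  have h := lintegral_stdGaussian_stretch one_pos one_pos hg hhom
  simp only [inv_one, stretch_one, LinearMap.id_coe, id, mul_one, ENNReal.ofReal_one, one_mul] at h
  rw [h]
  congr 1
  refine lintegral_congr_ae ?_
  filter_upwards [ae_norm_eq_one] with ω hω
  simp [hω]

/-- No radial integral is computed: integrating the constant 1 compares the total masses 1 and 4π.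
-/
theorem gaussianRadial_eq : gaussianRadial = ENNReal.ofReal (4 * π)⁻¹ := by
  have h := lintegral_stdGaussian_of_homogeneous (g := fun _ => 1) measurable_const
    (fun _ _ _ => rfl)
  rw [lintegral_one, lintegral_one, measure_univ, sphereSurface_univ] at h
  have hp : 0 < 4 * π := by positivity
  rw [ENNReal.ofReal_inv_of_pos hp]
  exact ENNReal.eq_inv_of_mul_eq_one_left h.symm

theorem lintegral_sphereSurface_eq_lintegral_stdGaussian
    {g : EuclideanSpace ℝ (Fin 3) → ENNReal} (hg : Measurable g) :
    ∫⁻ ω, g ω ∂sphereSurface = ENNReal.ofReal (4 * π) *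
      ∫⁻ y, g (‖y‖⁻¹ • y) ∂stdGaussian (EuclideanSpace ℝ (Fin 3)) := by
  have hp : 0 < 4 * π := by positivity
  rw [lintegral_stdGaussian_of_homogeneous (g := fun y => g (‖y‖⁻¹ • y)) (by fun_prop),
    gaussianRadial_eq, ← mul_assoc, ← ENNReal.ofReal_mul hp.le, mul_inv_cancel₀ hp.ne',
    ENNReal.ofReal_one, one_mul]
  · refine lintegral_congr_ae ?_
    filter_upwards [ae_norm_eq_one] with ω hω
    simp [hω]
  · intro r hr x
    rw [norm_smul, norm_eq_abs, abs_of_pos hr, smul_smul, mul_inv, mul_right_comm,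
      inv_mul_cancel₀ hr.ne', one_mul]

/-- Inherited from the standard Gaussian: the sphere measure is 4π times the law of its direction.
-/
theorem measurePreserving_sphereSurface
    (T : EuclideanSpace ℝ (Fin 3) ≃ₗᵢ[ℝ] EuclideanSpace ℝ (Fin 3)) :
    MeasurePreserving T sphereSurface sphereSurface := by
  have hT : Measurable T := T.continuous.measurable
  refine ⟨hT, ?_⟩
  ext A hA
  have hg : Measurable (A.indicator (1 : EuclideanSpace ℝ (Fin 3) → ENNReal)) :=
    measurable_one.indicator hA
  rw [← lintegral_indicator_one hA, ← lintegral_indicator_one hA, lintegral_map hg hT,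
    lintegral_sphereSurface_eq_lintegral_stdGaussian hg,
    lintegral_sphereSurface_eq_lintegral_stdGaussian (g := fun x => A.indicator 1 (T x))
      (hg.comp hT)]
  congr 1
  conv_rhs => rw [← stdGaussian_map T, lintegral_map (by fun_prop) hT]
  simp

end Gaussian

/-! ### The law of a random reflection of a point on the sphere. -/

section Reflection

open Real Set

/-- The reflection of `x` in the plane orthogonal to `u`. -/
noncomputable def reflect (u x : EuclideanSpace ℝ (Fin 3)) : EuclideanSpace ℝ (Fin 3) :=
  x - (2 * inner ℝ u x / ‖u‖ ^ 2) • u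

theorem reflect_eq_reflection (u x : EuclideanSpace ℝ (Fin 3)) :
    reflect u x = (Submodule.span ℝ {u})ᗮ.reflection x := by
  rw [Submodule.reflection_orthogonal_apply, Submodule.reflection_singleton_apply, reflect]
  simp only [RCLike.ofReal_real_eq_id, id, neg_sub, two_smul, ← add_smul]
  ring_nf

@[fun_prop]
theorem Measurable.reflect {α : Type*} [MeasurableSpace α] {f g : α → EuclideanSpace ℝ (Fin 3)}
    (hf : Measurable f) (hg : Measurable g) : Measurable fun x => reflect (f x) (g x) := by
  unfold _root_.reflect
  fun_prop

theorem measurePreserving_reflect (u : EuclideanSpace ℝ (Fin 3)) :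
    MeasurePreserving (reflect u) sphereSurface sphereSurface := by
  have h : reflect u = (Submodule.span ℝ {u})ᗮ.reflection := funext (reflect_eq_reflection u)
  rw [h]
  exact measurePreserving_sphereSurface _

theorem reflect_reflect (u x : EuclideanSpace ℝ (Fin 3)) : reflect u (reflect u x) = x := by
  simp [reflect_eq_reflection]

theorem norm_reflect (u x : EuclideanSpace ℝ (Fin 3)) : ‖reflect u x‖ = ‖x‖ := by
  rw [reflect_eq_reflection, LinearIsometryEquiv.norm_map]

theorem norm_reflect_sub_reflect (u x y : EuclideanSpace ℝ (Fin 3)) :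
    ‖reflect u x - reflect u y‖ = ‖x - y‖ := by
  rw [reflect_eq_reflection, reflect_eq_reflection, ← map_sub, LinearIsometryEquiv.norm_map]

theorem reflect_smul_left {r : ℝ} (hr : r ≠ 0) (u x : EuclideanSpace ℝ (Fin 3)) :
    reflect (r • u) x = reflect u x := by
  rw [reflect, reflect, norm_smul, smul_smul, inner_smul_left, norm_eq_abs, mul_pow, sq_abs]
  congr 2
  -- For `u = 0` both coefficients are quotients by zero, hence zero.
  rcases eq_or_ne ‖u‖ 0 with h | h
  · simp [h]
  · simp only [conj_trivial]
    field_simp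

theorem reflect_map (T : EuclideanSpace ℝ (Fin 3) ≃ₗᵢ[ℝ] EuclideanSpace ℝ (Fin 3))
    (u x : EuclideanSpace ℝ (Fin 3)) : reflect (T u) (T x) = T (reflect u x) := by
  simp [reflect]

theorem Ioo_ae_eq_union : Ioo (-1 : ℝ) 1 =ᵐ[volume] (Ioo (-1) 0 ∪ Ioo 0 1 : Set ℝ) := by
  have : (Ioo (-1) 0 ∪ Ioo 0 1 : Set ℝ) = Ioo (-1) 1 \ {0} := by
    ext x
    simp only [mem_union, mem_Ioo, Set.mem_sdiff, mem_singleton_iff]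
    constructor
    · rintro (h | h)
      · exact ⟨⟨h.1, by linarith⟩, h.2.ne⟩
      · exact ⟨⟨by linarith, h.2⟩, h.1.ne'⟩
    · rintro ⟨h, h0⟩
      rcases lt_or_gt_of_ne h0 with h1 | h1
      · exact Or.inl ⟨h.1, h1⟩
      · exact Or.inr ⟨h1, h.2⟩
  rw [this]
  exact (sdiff_null_ae_eq_self (by simp)).symm

/-- Needed because u and -u define the same reflection: the map from u to the reflected point is
injective only on a half sphere. -/
theorem lintegral_sphereSurface_of_even {f : EuclideanSpace ℝ (Fin 3) → ENNReal}
    (hf : Measurable f) (heven : ∀ x, f (-x) = f x) :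
    ∫⁻ x, f x ∂sphereSurface =
      2 * ∫⁻ z in Ioo (-1) 0, ∫⁻ φ in Ioo (-π) π, f (spherePoint z φ) := by
  have half : ∀ S : Set ℝ, MeasurableSet S → S ⊆ Ioo (-1) 1 →
      ∫⁻ x, S.indicator 1 (x 2) * f x ∂sphereSurface =
        ∫⁻ z in S, ∫⁻ φ in Ioo (-π) π, f (spherePoint z φ) := by
    intro S hS hsub
    have hm : Measurable (S.indicator (1 : ℝ → ENNReal)) := measurable_one.indicator hS
    rw [lintegral_sphereSurface (by fun_prop), ← Measure.restrict_restrict_of_subset hsub,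
      ← lintegral_indicator hS]
    refine lintegral_congr fun z => ?_
    by_cases hz : z ∈ S <;> simp [hz, spherePoint]
  have h1 := half (Ioo (-1) 0) measurableSet_Ioo (Ioo_subset_Ioo_right zero_le_one)
  have h2 := half (Ioo 0 1) measurableSet_Ioo (Ioo_subset_Ioo_left (by norm_num))
  have h3 : ∫⁻ x, (Ioo (0 : ℝ) 1).indicator 1 (x 2) * f x ∂sphereSurface =
      ∫⁻ x, (Ioo (-1 : ℝ) 0).indicator 1 (x 2) * f x ∂sphereSurface := by
    have hm : Measurable ((Ioo (0 : ℝ) 1).indicator (1 : ℝ → ENNReal)) :=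
      measurable_one.indicator measurableSet_Ioo
    rw [← (measurePreserving_sphereSurface (LinearIsometryEquiv.neg ℝ)).lintegral_comp
      (by fun_prop)]
    refine lintegral_congr fun x => ?_
    simp only [LinearIsometryEquiv.coe_neg, heven, PiLp.neg_apply]
    congr 1
    simp [indicator, and_comm, neg_lt]
  rw [lintegral_sphereSurface hf, setLIntegral_congr Ioo_ae_eq_union,
    lintegral_union measurableSet_Ioo (by
      rw [Set.disjoint_left]
      rintro x hx hy
      exact lt_asymm hx.2 hy.1), ← h1, ← h2, h3, two_mul]

theorem norm_spherePoint_sub_pole {z : ℝ} (hz : z ∈ Ioo (-1 : ℝ) 1) (φ : ℝ) :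
    ‖spherePoint z φ - !₂[0, 0, 1]‖ = √(2 - 2 * z) := by
  have h : 0 ≤ 1 - z ^ 2 := by nlinarith [hz.1, hz.2]
  rw [EuclideanSpace.norm_eq, Fin.sum_univ_three]
  congr 1
  simp only [spherePoint, norm_eq_abs, sq_abs, Matrix.cons_val, PiLp.sub_apply, sub_zero, mul_pow,
    sq_sqrt h]
  linear_combination (1 - z ^ 2) * sin_sq_add_cos_sq φ

/-- Reflecting the pole by a unit vector of height z gives height 1 - 2z². For z < 0 the longitude
is kept, which is why the lower half is used; the substitution is thus one-dimensional. -/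
theorem lintegral_reflect_pole {g : EuclideanSpace ℝ (Fin 3) → ENNReal} (hg : Measurable g) :
    ∫⁻ u, g (reflect u !₂[0, 0, 1]) ∂sphereSurface =
      ∫⁻ ω, ENNReal.ofReal ‖ω - !₂[0, 0, 1]‖⁻¹ * g ω ∂sphereSurface := by
  rw [lintegral_sphereSurface_of_even (by fun_prop) (fun x => by
      rw [← neg_one_smul ℝ x, reflect_smul_left (by norm_num)]),
    lintegral_sphereSurface (by fun_prop)]
  have hd : ∀ z ∈ Ioo (-1 : ℝ) 0, HasDerivWithinAt (fun z : ℝ => 1 - 2 * z ^ 2) (-(4 * z))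
      (Ioo (-1 : ℝ) 0) z := by
    intro z _
    refine HasDerivAt.hasDerivWithinAt ?_
    refine HasDerivAt.congr_deriv (f := fun z : ℝ => 1 - 2 * z ^ 2)
      ((((hasDerivAt_id' z).pow 2).const_mul 2).const_sub 1) ?_
    norm_num
    ring
  have hinj : InjOn (fun z : ℝ => 1 - 2 * z ^ 2) (Ioo (-1 : ℝ) 0) := by
    intro x hx y hy hxy
    have : (x - y) * (x + y) = 0 := by
      simp only at hxy
      linarith
    rcases mul_eq_zero.1 this with h | h
    · linarith
    · linarith [hx.2, hy.2]
  have himg : (fun z : ℝ => 1 - 2 * z ^ 2) '' Ioo (-1 : ℝ) 0 = Ioo (-1) 1 := by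
    ext t
    constructor
    · rintro ⟨z, hz, rfl⟩
      constructor <;> simp only <;> nlinarith [hz.1, hz.2]
    · intro ht
      have h1 : 0 < (1 - t) / 2 := by linarith [ht.2]
      refine ⟨-√((1 - t) / 2), ⟨?_, ?_⟩, ?_⟩
      · rw [neg_lt_neg_iff, sqrt_lt' one_pos]
        linarith [ht.1]
      · simpa using h1
      · simp only [neg_sq, sq_sqrt h1.le]
        ring
  rw [← himg, lintegral_image_eq_lintegral_abs_deriv_mul measurableSet_Ioo hd hinj,
    ← lintegral_const_mul' _ _ (by simp)]
  refine setLIntegral_congr_fun measurableSet_Ioo fun z hz => ?_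
  have hz' : 1 - 2 * z ^ 2 ∈ Ioo (-1 : ℝ) 1 := himg ▸ mem_image_of_mem _ hz
  have hz2 : z ∈ Ioo (-1 : ℝ) 1 := ⟨hz.1, by linarith [hz.2]⟩
  have hs : √(2 - 2 * (1 - 2 * z ^ 2)) = -(2 * z) := by
    rw [show 2 - 2 * (1 - 2 * z ^ 2) = (-(2 * z)) ^ 2 by ring, sqrt_sq (by linarith [hz.2])]
  have hr : √(1 - (1 - 2 * z ^ 2) ^ 2) = -(2 * z) * √(1 - z ^ 2) := by
    rw [show 1 - (1 - 2 * z ^ 2) ^ 2 = (-(2 * z)) ^ 2 * (1 - z ^ 2) by ring,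
      sqrt_mul (sq_nonneg _), sqrt_sq (by linarith [hz.2])]
  have hpt : ∀ φ, reflect (spherePoint z φ) !₂[0, 0, 1] = spherePoint (1 - 2 * z ^ 2) φ := by
    intro φ
    rw [reflect, norm_spherePoint hz2]
    ext i
    fin_cases i
    · simp [spherePoint, PiLp.inner_apply, Fin.sum_univ_three, hr]
      ring
    · simp [spherePoint, PiLp.inner_apply, Fin.sum_univ_three, hr]
      ring
    · simp [spherePoint, PiLp.inner_apply, Fin.sum_univ_three]
      ring
  simp only [hpt, norm_spherePoint_sub_pole hz', hs]
  rw [lintegral_const_mul' _ _ (by simp), ← mul_assoc,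
    ← ENNReal.ofReal_mul (abs_nonneg _), abs_of_pos (by linarith [hz.2])]
  congr 1
  have : z ≠ 0 := hz.2.ne
  -- The Jacobian 4|z| times the reciprocal 1/(2|z|) of the distance to the pole is the factor 2
  -- coming from the two half spheres.
  rw [show -(4 * z) * (-(2 * z))⁻¹ = 2 by field_simp; norm_num]
  simp

/-- Reflections of a point in random planes, in terms of the surface measure. -/
theorem lintegral_reflect {g : EuclideanSpace ℝ (Fin 3) → ENNReal} (hg : Measurable g)
    {θ : EuclideanSpace ℝ (Fin 3)} (hθ : ‖θ‖ = 1) :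
    ∫⁻ u, g (reflect u θ) ∂sphereSurface =
      ∫⁻ ω, ENNReal.ofReal ‖ω - θ‖⁻¹ * g ω ∂sphereSurface := by
  have hn : ‖(!₂[0, 0, 1] : EuclideanSpace ℝ (Fin 3))‖ = ‖θ‖ := by
    rw [hθ, EuclideanSpace.norm_eq, Fin.sum_univ_three]
    simp
  -- An isometry that moves the pole to θ reduces the general case to the pole.
  obtain ⟨T, hT⟩ : ∃ T : EuclideanSpace ℝ (Fin 3) ≃ₗᵢ[ℝ] EuclideanSpace ℝ (Fin 3),
      T !₂[0, 0, 1] = θ := ⟨_, Submodule.reflection_sub hn⟩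
  have hTm : Measurable T := T.continuous.measurable
  rw [← (measurePreserving_sphereSurface T).lintegral_comp
      (f := fun u => g (reflect u θ)) (by fun_prop),
    ← (measurePreserving_sphereSurface T).lintegral_comp
      (f := fun ω => ENNReal.ofReal ‖ω - θ‖⁻¹ * g ω) (by fun_prop)]
  have h1 := lintegral_reflect_pole (g := g ∘ T) (hg.comp hTm)
  simp only [Function.comp_def, ← reflect_map, hT] at h1
  rw [h1]
  refine lintegral_congr fun ω => ?_
  rw [← hT, ← map_sub, LinearIsometryEquiv.norm_map]

end Reflection

/-! ### Surface integrals over graphs, and the sphere as two graphs over the disk. -/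

section Graph

open Real Set

theorem measurable_gradient {n : ℕ} (f : EuclideanSpace ℝ (Fin n) → ℝ) :
    Measurable (gradient f) := by
  unfold gradient
  exact (InnerProductSpace.toDual ℝ _).symm.continuous.measurable.comp (measurable_fderiv ℝ f)

theorem lintegral_graphSurfaceMeasure {U : Set (EuclideanSpace ℝ (Fin 2))}
    {h : EuclideanSpace ℝ (Fin 2) → ℝ} (hh : Measurable h)
    {f : EuclideanSpace ℝ (Fin 3) → ENNReal} (hf : Measurable f) :
    ∫⁻ Y, f Y ∂graphSurfaceMeasure U h =
      ∫⁻ x in U, ENNReal.ofReal √(1 + ‖gradient h x‖ ^ 2) * f !₂[x 0, x 1, h x] := by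
  have h0 : ∀ i : Fin 2, Measurable fun x : EuclideanSpace ℝ (Fin 2) => x i := by
    intro i
    fun_prop
  have hg := measurable_gradient h
  have hF : Measurable fun x => f !₂[x 0, x 1, h x] := hf.comp ((h0 0).vecThree (h0 1) hh)
  rw [graphSurfaceMeasure, lintegral_map hf ((h0 0).vecThree (h0 1) hh),
    lintegral_withDensity_eq_lintegral_mul _ (by fun_prop) hF]
  rfl

/-- Polar coordinates with ρ = √(1 - z²): then ρ dρ / √(1 - ρ²) = dz up to orientation. The number
`ε` selects the upper or lower sheet. -/
theorem lintegral_disk {F : EuclideanSpace ℝ (Fin 3) → ENNReal} (hF : Measurable F) (ε : ℝ) :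
    ∫⁻ p in {p : ℝ × ℝ | p.1 ^ 2 + p.2 ^ 2 < 1}, ENNReal.ofReal (√(1 - p.1 ^ 2 - p.2 ^ 2))⁻¹ *
        F !₂[p.1, p.2, ε * √(1 - p.1 ^ 2 - p.2 ^ 2)] =
      ∫⁻ z in Ioo (0 : ℝ) 1, ∫⁻ φ in Ioo (-π) π,
        F !₂[√(1 - z ^ 2) * cos φ, √(1 - z ^ 2) * sin φ, ε * z] := by
  have hD : MeasurableSet {p : ℝ × ℝ | p.1 ^ 2 + p.2 ^ 2 < 1} :=
    measurableSet_lt (by fun_prop) (by fun_prop)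
  have hsq : ∀ ρ φ : ℝ, (ρ * cos φ) ^ 2 + (ρ * sin φ) ^ 2 = ρ ^ 2 := by
    intro ρ φ
    linear_combination ρ ^ 2 * sin_sq_add_cos_sq φ
  have hsq' : ∀ ρ φ : ℝ, 1 - (ρ * cos φ) ^ 2 - (ρ * sin φ) ^ 2 = 1 - ρ ^ 2 := by
    intro ρ φ
    linear_combination -(ρ ^ 2) * sin_sq_add_cos_sq φ
  have h1 : ∫⁻ p in {p : ℝ × ℝ | p.1 ^ 2 + p.2 ^ 2 < 1},
        ENNReal.ofReal (√(1 - p.1 ^ 2 - p.2 ^ 2))⁻¹ *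
        F !₂[p.1, p.2, ε * √(1 - p.1 ^ 2 - p.2 ^ 2)] =
      ∫⁻ ρ in Ioi (0 : ℝ), ∫⁻ φ in Ioo (-π) π, ENNReal.ofReal ρ *
        (Ioo (0 : ℝ) 1).indicator (fun ρ => ENNReal.ofReal (√(1 - ρ ^ 2))⁻¹ *
          F !₂[ρ * cos φ, ρ * sin φ, ε * √(1 - ρ ^ 2)]) ρ := by
    rw [← lintegral_indicator hD, ← lintegral_comp_polarCoord_symm, polarCoord_target,
      Measure.volume_eq_prod, ← Measure.prod_restrict, lintegral_prod]
    · refine setLIntegral_congr_fun measurableSet_Ioi fun ρ hρ => lintegral_congr fun φ => ?_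
      have hρ : 0 < ρ := hρ
      simp only [polarCoord_symm_apply, smul_eq_mul]
      congr 1
      have : (ρ * cos φ, ρ * sin φ) ∈ {p : ℝ × ℝ | p.1 ^ 2 + p.2 ^ 2 < 1} ↔ ρ ∈ Ioo (0 : ℝ) 1 := by
        simp only [mem_ofPred_eq, hsq, mem_Ioo, hρ, true_and, sq_lt_one_iff₀ hρ.le]
      by_cases h : ρ ∈ Ioo (0 : ℝ) 1
      · rw [indicator_of_mem h, indicator_of_mem (this.2 h)]
        simp only [hsq']
      · rw [indicator_of_notMem h, indicator_of_notMem (fun hc => h (this.1 hc))]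
    · simp only [polarCoord_symm_apply, smul_eq_mul]
      refine Measurable.aemeasurable (Measurable.mul (by fun_prop) ?_)
      refine Measurable.comp (g := indicator _ _) (Measurable.indicator ?_ hD) ?_ <;> fun_prop
  have h2 : ∀ ρ : ℝ, ∫⁻ φ in Ioo (-π) π, ENNReal.ofReal ρ *
        (Ioo (0 : ℝ) 1).indicator (fun ρ => ENNReal.ofReal (√(1 - ρ ^ 2))⁻¹ *
          F !₂[ρ * cos φ, ρ * sin φ, ε * √(1 - ρ ^ 2)]) ρ =
      (Ioo (0 : ℝ) 1).indicator (fun ρ => ∫⁻ φ in Ioo (-π) π, ENNReal.ofReal ρ *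
        (ENNReal.ofReal (√(1 - ρ ^ 2))⁻¹ *
          F !₂[ρ * cos φ, ρ * sin φ, ε * √(1 - ρ ^ 2)])) ρ := by
    intro ρ
    by_cases h : ρ ∈ Ioo (0 : ℝ) 1 <;> simp [h]
  have hd : ∀ z ∈ Ioo (0 : ℝ) 1, HasDerivWithinAt (fun z => √(1 - z ^ 2)) (-z / √(1 - z ^ 2))
      (Ioo (0 : ℝ) 1) z := fun z hz =>
    (hasDerivAt_sqrt_one_sub_sq ⟨by linarith [hz.1], hz.2⟩).hasDerivWithinAt
  have hss : ∀ z ∈ Ioo (0 : ℝ) 1, √(1 - √(1 - z ^ 2) ^ 2) = z := by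
    intro z hz
    rw [sq_sqrt (by nlinarith [hz.1, hz.2]), sub_sub_cancel, sqrt_sq hz.1.le]
  have hinj : InjOn (fun z : ℝ => √(1 - z ^ 2)) (Ioo (0 : ℝ) 1) := by
    intro x hx y hy hxy
    rw [← hss x hx, ← hss y hy]
    simp only at hxy
    rw [hxy]
  have hmaps : ∀ z ∈ Ioo (0 : ℝ) 1, √(1 - z ^ 2) ∈ Ioo (0 : ℝ) 1 := by
    intro z hz
    refine ⟨sqrt_pos.2 (by nlinarith [hz.1, hz.2]), ?_⟩
    rw [sqrt_lt' one_pos]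
    nlinarith [hz.1]
  have himg : (fun z : ℝ => √(1 - z ^ 2)) '' Ioo (0 : ℝ) 1 = Ioo 0 1 := by
    apply Subset.antisymm
    · rintro _ ⟨z, hz, rfl⟩
      exact hmaps z hz
    · exact fun z hz => ⟨_, hmaps z hz, hss z hz⟩
  rw [h1]
  simp only [h2]
  rw [setLIntegral_indicator measurableSet_Ioo,
    inter_eq_left.2 (Ioo_subset_Ioi_self : Ioo (0 : ℝ) 1 ⊆ Ioi 0), ← himg,
    lintegral_image_eq_lintegral_abs_deriv_mul measurableSet_Ioo hd hinj, himg]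
  refine setLIntegral_congr_fun measurableSet_Ioo fun z hz => ?_
  have hz1 := (hmaps z hz).1
  have hz0 := hz.1
  simp only [hss z hz]
  rw [← lintegral_const_mul' _ _ (by simp)]
  refine lintegral_congr fun φ => ?_
  rw [← mul_assoc, ← mul_assoc, ← ENNReal.ofReal_mul (abs_nonneg _),
    ← ENNReal.ofReal_mul (by positivity), abs_div, abs_neg, abs_of_pos hz0, abs_of_pos hz1,
    show z / √(1 - z ^ 2) * √(1 - z ^ 2) * z⁻¹ = 1 by field_simp]
  simp

theorem lintegral_sphereSurface_eq_disk {F : EuclideanSpace ℝ (Fin 3) → ENNReal}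
    (hF : Measurable F) :
    ∫⁻ ω, F ω ∂sphereSurface =
      (∫⁻ p in {p : ℝ × ℝ | p.1 ^ 2 + p.2 ^ 2 < 1}, ENNReal.ofReal (√(1 - p.1 ^ 2 - p.2 ^ 2))⁻¹ *
        F !₂[p.1, p.2, 1 * √(1 - p.1 ^ 2 - p.2 ^ 2)]) +
      ∫⁻ p in {p : ℝ × ℝ | p.1 ^ 2 + p.2 ^ 2 < 1}, ENNReal.ofReal (√(1 - p.1 ^ 2 - p.2 ^ 2))⁻¹ *
        F !₂[p.1, p.2, -1 * √(1 - p.1 ^ 2 - p.2 ^ 2)] := by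
  rw [lintegral_disk hF, lintegral_disk hF, lintegral_sphereSurface hF,
    setLIntegral_congr Ioo_ae_eq_union,
    lintegral_union measurableSet_Ioo (by
      rw [Set.disjoint_left]
      rintro x hx hy
      exact lt_asymm hx.2 hy.1), add_comm]
  congr 1
  · simp only [one_mul, spherePoint]
  · have h := (Measure.measurePreserving_neg (volume : Measure ℝ)).setLIntegral_comp_emb
      (MeasurableEquiv.neg ℝ).measurableEmbedding
      (fun z => ∫⁻ φ in Ioo (-π) π, F (spherePoint z φ)) (Ioo 0 1)
    have himg : (Neg.neg '' Ioo (0 : ℝ) 1) = Ioo (-1) 0 := by simp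
    have h' : ∫⁻ z in Ioo (0 : ℝ) 1, ∫⁻ φ in Ioo (-π) π, F (spherePoint (-z) φ) =
        ∫⁻ z in Ioo (-1 : ℝ) 0, ∫⁻ φ in Ioo (-π) π, F (spherePoint z φ) := by
      rw [← himg]
      exact h
    rw [← h']
    simp [spherePoint]

end Graph

/-! ### The ellipsoid as a stretched sphere: area element, normal and kernel. -/

section Ellipsoid

open Real Set

variable {a₁ a₂ R : ℝ}

theorem hasFDerivAt_coord {n : ℕ} (i : Fin n) (Y : EuclideanSpace ℝ (Fin n)) :
    HasFDerivAt (fun X : EuclideanSpace ℝ (Fin n) => X i)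
      (EuclideanSpace.proj i : EuclideanSpace ℝ (Fin n) →L[ℝ] ℝ) Y :=
  (EuclideanSpace.proj i : EuclideanSpace ℝ (Fin n) →L[ℝ] ℝ).hasFDerivAt

theorem gradient_oblateForm (Y : EuclideanSpace ℝ (Fin 3)) :
    gradient (oblateForm a₁ a₂ R) Y =
      (2 : ℝ) • !₂[Y 0 / (a₁ * R) ^ 2, Y 1 / (a₂ * R) ^ 2, Y 2] := by
  apply HasGradientAt.gradient
  rw [hasGradientAt_iff_hasFDerivAt]
  have h := ((((hasFDerivAt_coord 0 Y).pow 2).mul_const ((a₁ * R) ^ 2)⁻¹).add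
    (((hasFDerivAt_coord 1 Y).pow 2).mul_const ((a₂ * R) ^ 2)⁻¹)).add
      ((hasFDerivAt_coord 2 Y).pow 2)
  refine HasFDerivAt.congr_fderiv (f := oblateForm a₁ a₂ R) h ?_
  ext v
  simp [PiLp.inner_apply, Fin.sum_univ_three]
  ring

theorem norm_gradient_oblateHeight {ε : ℝ} (hε : ε ^ 2 = 1) {x : EuclideanSpace ℝ (Fin 2)}
    (hx : 0 < 1 - x 0 ^ 2 / (a₁ * R) ^ 2 - x 1 ^ 2 / (a₂ * R) ^ 2) :
    ‖gradient (fun x => ε * oblateHeight a₁ a₂ R x) x‖ ^ 2 =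
      ((x 0 / (a₁ * R) ^ 2) ^ 2 + (x 1 / (a₂ * R) ^ 2) ^ 2) / oblateHeight a₁ a₂ R x ^ 2 := by
  have hpos : 0 < oblateHeight a₁ a₂ R x := sqrt_pos.2 hx
  have hg : gradient (fun x => ε * oblateHeight a₁ a₂ R x) x =
      (-ε / oblateHeight a₁ a₂ R x) • !₂[x 0 / (a₁ * R) ^ 2, x 1 / (a₂ * R) ^ 2] := by
    apply HasGradientAt.gradient
    rw [hasGradientAt_iff_hasFDerivAt]
    have h := (((((hasFDerivAt_coord 0 x).pow 2).mul_const ((a₁ * R) ^ 2)⁻¹).const_sub 1).sub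
      (((hasFDerivAt_coord 1 x).pow 2).mul_const ((a₂ * R) ^ 2)⁻¹)).sqrt hx.ne'
    refine HasFDerivAt.congr_fderiv (f := fun x => ε * oblateHeight a₁ a₂ R x) (h.const_mul ε) ?_
    ext v
    have : √(1 - x 0 ^ 2 * ((a₁ * R) ^ 2)⁻¹ - x 1 ^ 2 * ((a₂ * R) ^ 2)⁻¹) =
      oblateHeight a₁ a₂ R x := rfl
    simp [PiLp.inner_apply, Fin.sum_univ_two]
    rw [this]
    ring
  rw [hg, norm_smul, mul_pow, EuclideanSpace.real_norm_sq_eq, Fin.sum_univ_two, norm_eq_abs, sq_abs,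
    div_pow, neg_sq, hε]
  simp only [Matrix.cons_val]
  ring

theorem measurable_oblateHeight : Measurable (oblateHeight a₁ a₂ R) := by
  have : Continuous (oblateHeight a₁ a₂ R) := by
    unfold oblateHeight
    fun_prop
  exact this.measurable

/-- At the image Aω of a point of the sphere, √(1 + |∇γ|²) equals |A⁻¹ω| divided by the height of ω.
The division is absorbed by the area element of the sphere over the disk, and a₁R·a₂R is the
Jacobian of the stretch in the plane. -/
theorem lintegral_oblate_sheet (h₁ : 0 < a₁ * R) (h₂ : 0 < a₂ * R) {ε : ℝ} (hε : ε ^ 2 = 1)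
    {f : EuclideanSpace ℝ (Fin 3) → ENNReal} (hf : Measurable f) :
    ∫⁻ Y, f Y ∂graphSurfaceMeasure (oblateShadow a₁ a₂ R) (fun x => ε * oblateHeight a₁ a₂ R x) =
      ENNReal.ofReal ((a₁ * R) * (a₂ * R)) *
      ∫⁻ p in {p : ℝ × ℝ | p.1 ^ 2 + p.2 ^ 2 < 1}, ENNReal.ofReal (√(1 - p.1 ^ 2 - p.2 ^ 2))⁻¹ *
        (fun ω => ENNReal.ofReal ‖stretch (a₁ * R)⁻¹ (a₂ * R)⁻¹ ω‖ *
          f (stretch (a₁ * R) (a₂ * R) ω)) !₂[p.1, p.2, ε * √(1 - p.1 ^ 2 - p.2 ^ 2)] := by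
  have hD : MeasurableSet {p : ℝ × ℝ | p.1 ^ 2 + p.2 ^ 2 < 1} :=
    measurableSet_lt (by fun_prop) (by fun_prop)
  have hU : MeasurableSet (oblateShadow a₁ a₂ R) := by
    have : oblateShadow a₁ a₂ R = {x | x 0 ^ 2 / (a₁ * R) ^ 2 + x 1 ^ 2 / (a₂ * R) ^ 2 < 1} :=
      Set.ext (mem_oblateShadow a₁ a₂ R)
    rw [this]
    exact measurableSet_lt (by fun_prop) (by fun_prop)
  have hh : Measurable (fun x => ε * oblateHeight a₁ a₂ R x) :=
    measurable_oblateHeight.const_mul ε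
  have hg := measurable_gradient (fun x => ε * oblateHeight a₁ a₂ R x)
  have hc : ∀ i : Fin 2, Measurable fun x : EuclideanSpace ℝ (Fin 2) => x i := by
    intro i
    fun_prop
  have hF : Measurable fun x => f !₂[x 0, x 1, ε * oblateHeight a₁ a₂ R x] :=
    hf.comp ((hc 0).vecThree (hc 1) hh)
  rw [lintegral_graphSurfaceMeasure hh hf, ← lintegral_indicator hU, lintegral_plane
    (Measurable.indicator (by fun_prop) hU),
    lintegral_prod_comp_mul h₁ h₂, ← lintegral_indicator hD]
  · congr 1
    refine lintegral_congr fun p => ?_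
    have e1 : (a₁ * R * p.1) ^ 2 / (a₁ * R) ^ 2 = p.1 ^ 2 := by
      rw [mul_pow, mul_div_cancel_left₀ _ (pow_ne_zero _ h₁.ne')]
    have e2 : (a₂ * R * p.2) ^ 2 / (a₂ * R) ^ 2 = p.2 ^ 2 := by
      rw [mul_pow, mul_div_cancel_left₀ _ (pow_ne_zero _ h₂.ne')]
    have hmem : (!₂[a₁ * R * p.1, a₂ * R * p.2] : EuclideanSpace ℝ (Fin 2)) ∈ oblateShadow a₁ a₂ R ↔
        p ∈ {p : ℝ × ℝ | p.1 ^ 2 + p.2 ^ 2 < 1} := by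
      rw [mem_oblateShadow]
      simp only [Matrix.cons_val_zero, Matrix.cons_val_one, e1, e2, mem_ofPred_eq]
    by_cases hp : p ∈ {p : ℝ × ℝ | p.1 ^ 2 + p.2 ^ 2 < 1}
    · rw [indicator_of_mem hp, indicator_of_mem (hmem.2 hp)]
      have hp' : 0 < 1 - p.1 ^ 2 - p.2 ^ 2 := by
        have : p.1 ^ 2 + p.2 ^ 2 < 1 := hp
        linarith
      have hht : oblateHeight a₁ a₂ R !₂[a₁ * R * p.1, a₂ * R * p.2] =
          √(1 - p.1 ^ 2 - p.2 ^ 2) := by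
        simp only [oblateHeight, Matrix.cons_val_zero, Matrix.cons_val_one, e1, e2]
      have hs := sqrt_pos.2 hp'
      have hgr := norm_gradient_oblateHeight (a₁ := a₁) (a₂ := a₂) (R := R)
        (x := !₂[a₁ * R * p.1, a₂ * R * p.2]) hε
        (by simpa only [Matrix.cons_val_zero, Matrix.cons_val_one, e1, e2] using hp')
      simp only [hgr, hht]
      rw [← mul_assoc, ← ENNReal.ofReal_mul (by positivity)]
      congr 2
      · rw [EuclideanSpace.norm_eq, Fin.sum_univ_three, ← sqrt_inv, ← sqrt_mul (by positivity),
          sq_sqrt hp'.le]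
        congr 1
        generalize a₁ * R = a at h₁
        generalize a₂ * R = b at h₂
        simp only [stretch_apply, Matrix.cons_val, norm_eq_abs, sq_abs, mul_pow, hε, sq_sqrt hp'.le]
        field_simp
        ring
    · rw [indicator_of_notMem hp, indicator_of_notMem (fun h => hp (hmem.1 h))]
  · refine Measurable.comp (g := indicator _ _) (Measurable.indicator
      (by fun_prop) hU) (by fun_prop)

theorem lintegral_oblateSurfaceMeasure (h₁ : 0 < a₁ * R) (h₂ : 0 < a₂ * R)
    {f : EuclideanSpace ℝ (Fin 3) → ENNReal} (hf : Measurable f) :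
    ∫⁻ Y, f Y ∂oblateSurfaceMeasure a₁ a₂ R = ENNReal.ofReal ((a₁ * R) * (a₂ * R)) *
      ∫⁻ ω, ENNReal.ofReal ‖stretch (a₁ * R)⁻¹ (a₂ * R)⁻¹ ω‖ *
        f (stretch (a₁ * R) (a₂ * R) ω) ∂sphereSurface := by
  rw [lintegral_sphereSurface_eq_disk (F := fun ω =>
      ENNReal.ofReal ‖stretch (a₁ * R)⁻¹ (a₂ * R)⁻¹ ω‖ * f (stretch (a₁ * R) (a₂ * R) ω))
      (by fun_prop), mul_add,
    ← lintegral_oblate_sheet h₁ h₂ (by norm_num) hf,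
    ← lintegral_oblate_sheet h₁ h₂ (by norm_num) hf, oblateSurfaceMeasure, lintegral_add_measure]
  simp only [one_mul, neg_mul]

theorem oblateNormal_stretch (ω : EuclideanSpace ℝ (Fin 3)) :
    oblateNormal a₁ a₂ R (stretch (a₁ * R) (a₂ * R) ω) =
      ‖stretch (a₁ * R)⁻¹ (a₂ * R)⁻¹ ω‖⁻¹ • stretch (a₁ * R)⁻¹ (a₂ * R)⁻¹ ω := by
  have h : gradient (oblateForm a₁ a₂ R) (stretch (a₁ * R) (a₂ * R) ω) =
      (2 : ℝ) • stretch (a₁ * R)⁻¹ (a₂ * R)⁻¹ ω := by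
    rw [gradient_oblateForm]
    congr 1
    ext i
    fin_cases i
    · simp only [stretch_apply]
      simp
      field_simp
    · simp only [stretch_apply]
      simp
      field_simp
    · simp [stretch_apply]
  rw [oblateNormal, h, norm_smul, smul_smul, mul_inv]
  congr 1
  norm_num
  ring

/-- The normal at Aω is A⁻¹ω normalized, so the inner product with A(ω - θ) no longer contains A: ⟨ω
- θ, ω⟩ = |ω - θ|²/2 on the unit sphere. The density |A⁻¹ω| cancels the normalization. -/
theorem norm_mul_npKernel_stretch (h₁ : 0 < a₁ * R) (h₂ : 0 < a₂ * R)
    {θ ω : EuclideanSpace ℝ (Fin 3)} (hθ : ‖θ‖ = 1) (hω : ‖ω‖ = 1) :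
    ‖stretch (a₁ * R)⁻¹ (a₂ * R)⁻¹ ω‖ * npKernel (oblateNormal a₁ a₂ R)
        (stretch (a₁ * R) (a₂ * R) θ) (stretch (a₁ * R) (a₂ * R) ω) =
      (8 * π)⁻¹ * (‖ω - θ‖ ^ 2 / ‖stretch (a₁ * R) (a₂ * R) (ω - θ)‖ ^ 3) := by
  have h0 : 0 < ‖stretch (a₁ * R)⁻¹ (a₂ * R)⁻¹ ω‖ := by
    refine norm_pos_iff.2 (stretch_ne_zero (inv_pos.2 h₁) (inv_pos.2 h₂) ?_)
    rintro rfl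
    simp at hω
  have h3 : inner ℝ (stretch (a₁ * R) (a₂ * R) (ω - θ)) (stretch (a₁ * R)⁻¹ (a₂ * R)⁻¹ ω) =
      ‖ω - θ‖ ^ 2 / 2 := by
    have : inner ℝ (stretch (a₁ * R) (a₂ * R) (ω - θ)) (stretch (a₁ * R)⁻¹ (a₂ * R)⁻¹ ω) =
        inner ℝ (ω - θ) ω := by
      simp only [PiLp.inner_apply, Fin.sum_univ_three, stretch_apply, Matrix.cons_val,
        RCLike.inner_apply, conj_trivial]
      generalize a₁ * R = a at h₁
      generalize a₂ * R = b at h₂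
      simp only [PiLp.sub_apply]
      field_simp
    rw [this, norm_sub_sq_real, inner_sub_left, real_inner_self_eq_norm_sq, hω, hθ,
      real_inner_comm]
    ring
  rw [npKernel, oblateNormal_stretch, ← map_sub, inner_smul_right, h3,
    norm_sub_rev (stretch _ _ θ), ← map_sub]
  generalize ‖stretch (a₁ * R) (a₂ * R) (ω - θ)‖ = c
  generalize ‖stretch (a₁ * R)⁻¹ (a₂ * R)⁻¹ ω‖ = d at h0
  field_simp
  ring


/-- These u are the ones that fix θ. The law of the reflected point gives {θ} no mass: at ω = θ the
weight ‖ω - θ‖⁻¹ is 0⁻¹ = 0, and elsewhere the indicator vanishes. -/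
theorem sphereSurface_orthogonal {θ : EuclideanSpace ℝ (Fin 3)} (hθ : ‖θ‖ = 1) :
    ∀ᵐ u ∂sphereSurface, inner ℝ u θ ≠ 0 := by
  have h := lintegral_reflect (g := ({θ} : Set (EuclideanSpace ℝ (Fin 3))).indicator 1)
    (measurable_one.indicator (measurableSet_singleton θ)) hθ
  have h2 : ∀ ω, ENNReal.ofReal ‖ω - θ‖⁻¹ *
      ({θ} : Set (EuclideanSpace ℝ (Fin 3))).indicator 1 ω = 0 := by
    intro ω
    by_cases hω : ω = θ <;> simp [hω]
  simp only [h2, lintegral_zero] at h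
  rw [lintegral_eq_zero_iff (by
    exact (measurable_one.indicator (measurableSet_singleton θ)).comp (by fun_prop))] at h
  filter_upwards [h] with u hu hcon
  simp [reflect, hcon] at hu

/-- The double layer kernel on the ellipsoid is half of the law of a random reflection. -/
theorem lintegral_npKernel (h₁ : 0 < a₁ * R) (h₂ : 0 < a₂ * R)
    {θ : EuclideanSpace ℝ (Fin 3)} (hθ : ‖θ‖ = 1)
    {f : EuclideanSpace ℝ (Fin 3) → ENNReal} (hf : Measurable f)
    (hK : Measurable fun Y => npKernel (oblateNormal a₁ a₂ R) (stretch (a₁ * R) (a₂ * R) θ) Y) :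
    ∫⁻ Y, ENNReal.ofReal (npKernel (oblateNormal a₁ a₂ R) (stretch (a₁ * R) (a₂ * R) θ) Y) * f Y
        ∂oblateSurfaceMeasure a₁ a₂ R =
      2⁻¹ * ∫⁻ y, f (stretch (a₁ * R) (a₂ * R) (reflect (stretch (a₁ * R)⁻¹ (a₂ * R)⁻¹ y) θ))
        ∂ProbabilityTheory.stdGaussian (EuclideanSpace ℝ (Fin 3)) := by
  have hπ := pi_pos
  have hhom : ∀ r : ℝ, 0 < r → ∀ x, f (stretch (a₁ * R) (a₂ * R) (reflect (r • x) θ)) =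
      f (stretch (a₁ * R) (a₂ * R) (reflect x θ)) := fun r hr x => by
    rw [reflect_smul_left hr.ne']
  rw [lintegral_oblateSurfaceMeasure h₁ h₂ (by fun_prop),
    lintegral_stdGaussian_stretch h₁ h₂
      (g := fun y => f (stretch (a₁ * R) (a₂ * R) (reflect y θ))) (by fun_prop) hhom,
    gaussianRadial_eq, mul_assoc (ENNReal.ofReal _), mul_left_comm (2⁻¹ : ENNReal)]
  congr 1
  -- For ω = ρ_u θ the vector ω - θ is a multiple of u, so the density |Au|⁻³ becomes a function of
  -- ω. With the weight |ω - θ|⁻¹ from `lintegral_reflect` this gives |ω - θ|²/|A(ω - θ)|³, as in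
  -- the kernel; the constants agree since 1/(8π) = ½ · 1/(4π).
  let G : EuclideanSpace ℝ (Fin 3) → ENNReal := fun ω =>
    ENNReal.ofReal ((‖ω - θ‖ / ‖stretch (a₁ * R) (a₂ * R) (ω - θ)‖) ^ 3) *
      f (stretch (a₁ * R) (a₂ * R) ω)
  have hG : Measurable G := by fun_prop
  have e1 : ∫⁻ u, ENNReal.ofReal (‖stretch (a₁ * R) (a₂ * R) u‖⁻¹ ^ 3) *
        f (stretch (a₁ * R) (a₂ * R) (reflect u θ)) ∂sphereSurface =
      ∫⁻ u, G (reflect u θ) ∂sphereSurface := by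
    refine lintegral_congr_ae ?_
    filter_upwards [sphereSurface_orthogonal hθ, ae_norm_eq_one] with u hu hu1
    have h3 : reflect u θ - θ = (-(2 * inner ℝ u θ)) • u := by
      rw [reflect, hu1]
      simp
    have h4 : 0 < ‖-(2 * inner ℝ u θ)‖ := by simp [hu]
    simp only [G, h3, map_smul, norm_smul, hu1]
    congr 3
    field_simp
  rw [e1, lintegral_reflect hG hθ, ← lintegral_const_mul _ (by fun_prop),
    ← lintegral_const_mul _ (by fun_prop)]
  refine lintegral_congr_ae ?_
  filter_upwards [ae_norm_eq_one] with ω hω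
  simp only [G]
  rw [← mul_assoc, ← ENNReal.ofReal_mul (norm_nonneg _), norm_mul_npKernel_stretch h₁ h₂ hθ hω]
  have : (2⁻¹ : ENNReal) = ENNReal.ofReal 2⁻¹ := by
    rw [ENNReal.ofReal_inv_of_pos two_pos]
    simp
  rw [this, ← mul_assoc, ← mul_assoc, ← mul_assoc, ← ENNReal.ofReal_mul (by positivity),
    ← ENNReal.ofReal_mul (by positivity), ← ENNReal.ofReal_mul (by positivity)]
  congr 2
  rcases eq_or_ne ‖ω - θ‖ 0 with h | h
  · simp [h]
  · field_simp
    norm_num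

end Ellipsoid

/-! ### Comparison of Sobolev norms under changes of measure and of variables. -/

section Sobolev

variable {φ φ' : EuclideanSpace ℝ (Fin 3) → ℂ} {μ ν : Measure (EuclideanSpace ℝ (Fin 3))}

theorem sobolevHalfNormSq_congr (h : φ =ᵐ[μ] φ') :
    sobolevHalfNormSq μ φ = sobolevHalfNormSq μ φ' := by
  rw [sobolevHalfNormSq, sobolevHalfNormSq]
  congr 1
  · refine lintegral_congr_ae ?_
    filter_upwards [h] with x hx
    rw [hx]
  · refine lintegral_congr_ae ?_
    filter_upwards [h] with x hx
    refine lintegral_congr_ae ?_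
    filter_upwards [h] with y hy
    rw [hx, hy]

theorem sobolevHalfNormSq_le_of_le {c : ENNReal} (hc : c ≠ ⊤) (h : μ ≤ c • ν) :
    sobolevHalfNormSq μ φ ≤ (c + c * c) * sobolevHalfNormSq ν φ := by
  have key : ∀ f : EuclideanSpace ℝ (Fin 3) → ENNReal,
      ∫⁻ x, f x ∂μ ≤ c * ∫⁻ x, f x ∂ν := fun f => by
    calc ∫⁻ x, f x ∂μ ≤ ∫⁻ x, f x ∂(c • ν) := lintegral_mono' h le_rfl
      _ = _ := by rw [lintegral_smul_measure, smul_eq_mul]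
  rw [sobolevHalfNormSq, sobolevHalfNormSq, mul_add]
  refine add_le_add ?_ ?_
  · exact (key _).trans (mul_le_mul_left le_self_add _)
  · calc ∫⁻ X, ∫⁻ Y, ‖φ X - φ Y‖ₑ ^ 2 / ‖X - Y‖ₑ ^ 3 ∂μ ∂μ
        ≤ c * ∫⁻ X, c * ∫⁻ Y, ‖φ X - φ Y‖ₑ ^ 2 / ‖X - Y‖ₑ ^ 3 ∂ν ∂ν :=
          (lintegral_mono fun X => key _).trans (key _)
      _ = c * c * ∫⁻ X, ∫⁻ Y, ‖φ X - φ Y‖ₑ ^ 2 / ‖X - Y‖ₑ ^ 3 ∂ν ∂ν := by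
          rw [lintegral_const_mul' _ _ hc, mul_assoc]
      _ ≤ _ := mul_le_mul_left le_add_self _

theorem sobolevHalfNormSq_map_le (e : EuclideanSpace ℝ (Fin 3) ≃ᵐ EuclideanSpace ℝ (Fin 3))
    {C : NNReal} (hC : ∀ x y, ‖x - y‖ₑ ≤ C * ‖e x - e y‖ₑ) :
    sobolevHalfNormSq (μ.map e) φ ≤ (1 + C ^ 3 : NNReal) * sobolevHalfNormSq μ (φ ∘ e) := by
  rw [sobolevHalfNormSq, sobolevHalfNormSq, lintegral_map_equiv, lintegral_map_equiv, mul_add]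
  simp only [lintegral_map_equiv]
  refine add_le_add ?_ ?_
  · refine le_mul_of_one_le_left' ?_
    simp
  · calc ∫⁻ X, ∫⁻ Y, ‖φ (e X) - φ (e Y)‖ₑ ^ 2 / ‖e X - e Y‖ₑ ^ 3 ∂μ ∂μ
        ≤ ∫⁻ X, ∫⁻ Y, (C ^ 3 : NNReal) * (‖φ (e X) - φ (e Y)‖ₑ ^ 2 / ‖X - Y‖ₑ ^ 3) ∂μ ∂μ := by
          refine lintegral_mono fun X => lintegral_mono fun Y => ?_
          rcases eq_or_ne X Y with rfl | hXY
          · simp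
          have h0 : ‖X - Y‖ₑ ≠ 0 := by simpa [sub_eq_zero] using hXY
          have hC0 : (C : ENNReal) ≠ 0 := by
            intro h
            have := hC X Y
            rw [h, zero_mul] at this
            exact h0 (le_antisymm this zero_le)
          have h1 : ‖e X - e Y‖ₑ⁻¹ ≤ C * ‖X - Y‖ₑ⁻¹ := by
            calc ‖e X - e Y‖ₑ⁻¹ = C * (C * ‖e X - e Y‖ₑ)⁻¹ := by
                  rw [ENNReal.mul_inv (Or.inl hC0) (Or.inl ENNReal.coe_ne_top), ← mul_assoc,
                    ENNReal.mul_inv_cancel hC0 ENNReal.coe_ne_top, one_mul]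
              _ ≤ _ := by
                  gcongr
                  exact hC X Y
          rw [div_eq_mul_inv, div_eq_mul_inv, ENNReal.inv_pow, ENNReal.inv_pow, mul_left_comm,
            ENNReal.coe_pow, ← mul_pow]
          gcongr
      _ ≤ _ := by
          simp only [lintegral_const_mul' _ _ ENNReal.coe_ne_top, Function.comp_apply]
          gcongr
          simp

end Sobolev

/-! ### Transfer of the operator and of H^{1/2} from the ellipsoid to the sphere. -/

section Ellipsoid

open Real Set ProbabilityTheory

variable {a₁ a₂ R : ℝ}

theorem measurable_oblateNormal : Measurable (oblateNormal a₁ a₂ R) := by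
  have h := measurable_gradient (oblateForm a₁ a₂ R)
  unfold oblateNormal
  fun_prop

theorem measurable_npKernel (X : EuclideanSpace ℝ (Fin 3)) :
    Measurable (npKernel (oblateNormal a₁ a₂ R) X) := by
  have h := measurable_oblateNormal (a₁ := a₁) (a₂ := a₂) (R := R)
  unfold npKernel
  fun_prop

/-- The linear map that takes the unit sphere to the ellipsoid, as a measurable equivalence. -/
noncomputable def stretchEquiv (h₁ : 0 < a₁ * R) (h₂ : 0 < a₂ * R) :
    EuclideanSpace ℝ (Fin 3) ≃ᵐ EuclideanSpace ℝ (Fin 3) where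
  toFun := stretch (a₁ * R) (a₂ * R)
  invFun := stretch (a₁ * R)⁻¹ (a₂ * R)⁻¹
  left_inv := stretch_inv_stretch h₁ h₂
  right_inv := stretch_stretch_inv h₁ h₂
  measurable_toFun := measurable_stretch _ _
  measurable_invFun := measurable_stretch _ _

/-- The density of the surface measure of the ellipsoid relative to that of the sphere. -/
noncomputable def oblateDensity (a₁ a₂ R : ℝ) (ω : EuclideanSpace ℝ (Fin 3)) : ENNReal :=
  ENNReal.ofReal ((a₁ * R) * (a₂ * R)) * ENNReal.ofReal ‖stretch (a₁ * R)⁻¹ (a₂ * R)⁻¹ ω‖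

theorem measurable_oblateDensity : Measurable (oblateDensity a₁ a₂ R) := by
  unfold oblateDensity
  fun_prop

theorem oblateSurfaceMeasure_eq_map (h₁ : 0 < a₁ * R) (h₂ : 0 < a₂ * R) :
    oblateSurfaceMeasure a₁ a₂ R =
      (sphereSurface.withDensity (oblateDensity a₁ a₂ R)).map (stretchEquiv h₁ h₂) := by
  ext A hA
  have hm : Measurable (A.indicator (1 : EuclideanSpace ℝ (Fin 3) → ENNReal)) :=
    measurable_one.indicator hA
  have he : Measurable (stretchEquiv h₁ h₂) := (stretchEquiv h₁ h₂).measurable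
  rw [← lintegral_indicator_one hA, ← lintegral_indicator_one hA,
    lintegral_oblateSurfaceMeasure h₁ h₂ hm, lintegral_map hm he,
    lintegral_withDensity_eq_lintegral_mul _ measurable_oblateDensity
      (g := fun ω => A.indicator 1 (stretchEquiv h₁ h₂ ω)) (hm.comp he),
    ← lintegral_const_mul' _ _ (by simp)]
  refine lintegral_congr fun ω => ?_
  rw [← mul_assoc]
  rfl

theorem oblateDensity_ne_zero (h₁ : 0 < a₁ * R) (h₂ : 0 < a₂ * R) :
    ∀ᵐ ω ∂sphereSurface, oblateDensity a₁ a₂ R ω ≠ 0 := by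
  filter_upwards [ae_norm_eq_one] with ω hω
  have h0 : stretch (a₁ * R)⁻¹ (a₂ * R)⁻¹ ω ≠ 0 := by
    refine stretch_ne_zero (inv_pos.2 h₁) (inv_pos.2 h₂) ?_
    rintro rfl
    simp at hω
  rw [oblateDensity, mul_ne_zero_iff, ENNReal.ofReal_ne_zero_iff, ENNReal.ofReal_ne_zero_iff]
  exact ⟨mul_pos h₁ h₂, norm_pos_iff.2 h0⟩

theorem ae_oblateSurfaceMeasure_iff (h₁ : 0 < a₁ * R) (h₂ : 0 < a₂ * R)
    {p : EuclideanSpace ℝ (Fin 3) → Prop} :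
    (∀ᵐ Y ∂oblateSurfaceMeasure a₁ a₂ R, p Y) ↔
      ∀ᵐ ω ∂sphereSurface, p (stretch (a₁ * R) (a₂ * R) ω) := by
  rw [oblateSurfaceMeasure_eq_map h₁ h₂, (stretchEquiv h₁ h₂).measurableEmbedding.ae_map_iff,
    ae_withDensity_iff measurable_oblateDensity]
  constructor
  · intro h
    filter_upwards [h, oblateDensity_ne_zero h₁ h₂] with ω h1 h2 using h1 h2
  · intro h
    filter_upwards [h] with ω h1 _ using h1

theorem aestronglyMeasurable_oblateSurfaceMeasure_iff (h₁ : 0 < a₁ * R) (h₂ : 0 < a₂ * R)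
    {φ : EuclideanSpace ℝ (Fin 3) → ℂ} :
    AEStronglyMeasurable φ (oblateSurfaceMeasure a₁ a₂ R) ↔
      AEStronglyMeasurable (φ ∘ stretch (a₁ * R) (a₂ * R)) sphereSurface := by
  rw [oblateSurfaceMeasure_eq_map h₁ h₂,
    (stretchEquiv h₁ h₂).measurableEmbedding.aestronglyMeasurable_map_iff]
  exact ⟨fun h => h.mono_ac (withDensity_absolutelyContinuous'
    measurable_oblateDensity.aemeasurable (oblateDensity_ne_zero h₁ h₂)),
    fun h => h.mono_ac (withDensity_absolutelyContinuous _ _)⟩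

theorem exists_norm_stretch_le (a b : ℝ) :
    ∃ C : NNReal, ∀ X, ‖stretch a b X‖ₑ ≤ C * ‖X‖ₑ := by
  refine ⟨‖LinearMap.toContinuousLinearMap (stretch a b)‖₊, fun X => ?_⟩
  have := (LinearMap.toContinuousLinearMap (stretch a b)).le_opNNNorm X
  simp only [enorm]
  exact_mod_cast this

/-- The stretch is bi-Lipschitz and the density of the surface measure is bounded above and below.
The constant may depend on `R`: only boundedness of the resolvent for each ellipsoid is at stake. -/
theorem exists_sobolevHalfNormSq_equiv (h₁ : 0 < a₁ * R) (h₂ : 0 < a₂ * R) :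
    ∃ C : NNReal, ∀ φ : EuclideanSpace ℝ (Fin 3) → ℂ,
      sobolevHalfNormSq (oblateSurfaceMeasure a₁ a₂ R) φ ≤
        C * sobolevHalfNormSq sphereSurface (φ ∘ stretch (a₁ * R) (a₂ * R)) ∧
      sobolevHalfNormSq sphereSurface (φ ∘ stretch (a₁ * R) (a₂ * R)) ≤
        C * sobolevHalfNormSq (oblateSurfaceMeasure a₁ a₂ R) φ := by
  obtain ⟨C, hC⟩ := exists_norm_stretch_le (a₁ * R) (a₂ * R)
  obtain ⟨D, hD⟩ := exists_norm_stretch_le (a₁ * R)⁻¹ (a₂ * R)⁻¹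
  set e := stretchEquiv h₁ h₂ with he
  set p : NNReal := Real.toNNReal ((a₁ * R) * (a₂ * R)) with hp
  have hp0 : p ≠ 0 := (Real.toNNReal_pos.2 (mul_pos h₁ h₂)).ne'
  have hle : oblateSurfaceMeasure a₁ a₂ R ≤ ((p * D : NNReal) : ENNReal) • sphereSurface.map e := by
    rw [oblateSurfaceMeasure_eq_map h₁ h₂, ← Measure.map_smul]
    refine Measure.map_mono ?_ e.measurable
    rw [← withDensity_const]
    refine withDensity_mono ?_
    filter_upwards [ae_norm_eq_one] with ω hω
    have h := hD ω
    rw [← ofReal_norm ω, hω, ENNReal.ofReal_one, mul_one, ← ofReal_norm] at h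
    rw [oblateDensity, ENNReal.coe_mul]
    gcongr
    exact le_rfl
  have hge : sphereSurface.map e ≤
      ((p⁻¹ * C : NNReal) : ENNReal) • oblateSurfaceMeasure a₁ a₂ R := by
    rw [oblateSurfaceMeasure_eq_map h₁ h₂, ← Measure.map_smul]
    refine Measure.map_mono ?_ e.measurable
    rw [← withDensity_smul _ measurable_oblateDensity]
    conv_lhs => rw [← withDensity_one (μ := sphereSurface)]
    refine withDensity_mono ?_
    filter_upwards [ae_norm_eq_one] with ω hω
    have h := hC (stretch (a₁ * R)⁻¹ (a₂ * R)⁻¹ ω)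
    rw [stretch_stretch_inv h₁ h₂, ← ofReal_norm ω, hω, ENNReal.ofReal_one, ← ofReal_norm] at h
    simp only [Pi.one_apply, Pi.smul_apply, smul_eq_mul, oblateDensity]
    calc (1 : ENNReal) ≤ C * ENNReal.ofReal ‖stretch (a₁ * R)⁻¹ (a₂ * R)⁻¹ ω‖ := h
      _ = (p⁻¹ * p : NNReal) * (C * ENNReal.ofReal ‖stretch (a₁ * R)⁻¹ (a₂ * R)⁻¹ ω‖) := by
        rw [inv_mul_cancel₀ hp0]
        simp
      _ = _ := by
        rw [ENNReal.coe_mul, ENNReal.coe_mul,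
          show ENNReal.ofReal ((a₁ * R) * (a₂ * R)) = p from rfl]
        ring
  have h1 : ∀ φ, sobolevHalfNormSq (sphereSurface.map e) φ ≤
      (1 + D ^ 3 : NNReal) * sobolevHalfNormSq sphereSurface (φ ∘ e) := fun φ =>
    sobolevHalfNormSq_map_le e fun x y => by
      have h := hD (stretch (a₁ * R) (a₂ * R) x - stretch (a₁ * R) (a₂ * R) y)
      rw [map_sub, stretch_inv_stretch h₁ h₂, stretch_inv_stretch h₁ h₂] at h
      exact h
  have h2 : ∀ φ, sobolevHalfNormSq sphereSurface (φ ∘ e) ≤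
      (1 + C ^ 3 : NNReal) * sobolevHalfNormSq (sphereSurface.map e) φ := fun φ => by
    have h := sobolevHalfNormSq_map_le (μ := sphereSurface.map e) (φ := φ ∘ e) e.symm (C := C)
      fun x y => by
        have h := hC (stretch (a₁ * R)⁻¹ (a₂ * R)⁻¹ x - stretch (a₁ * R)⁻¹ (a₂ * R)⁻¹ y)
        rw [map_sub, stretch_stretch_inv h₁ h₂, stretch_stretch_inv h₁ h₂] at h
        exact h
    rw [MeasurableEquiv.map_symm_map] at h
    simpa [Function.comp_assoc] using h
  refine ⟨((p * D + p * D * (p * D)) * (1 + D ^ 3)) +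
    (1 + C ^ 3) * (p⁻¹ * C + p⁻¹ * C * (p⁻¹ * C)), fun φ => ⟨?_, ?_⟩⟩
  · refine (sobolevHalfNormSq_le_of_le ENNReal.coe_ne_top hle).trans ?_
    refine (mul_le_mul_right (h1 φ) _).trans ?_
    rw [← mul_assoc, ← ENNReal.coe_mul, ← ENNReal.coe_add, ← ENNReal.coe_mul]
    refine mul_le_mul_left ?_ _
    exact_mod_cast le_self_add
  · refine (h2 φ).trans ((mul_le_mul_right
      (sobolevHalfNormSq_le_of_le ENNReal.coe_ne_top hge) _).trans ?_)
    rw [← mul_assoc, ← ENNReal.coe_mul, ← ENNReal.coe_add, ← ENNReal.coe_mul]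
    refine mul_le_mul_left ?_ _
    exact_mod_cast le_add_self

theorem memSobolevHalf_oblate_iff (h₁ : 0 < a₁ * R) (h₂ : 0 < a₂ * R)
    {φ : EuclideanSpace ℝ (Fin 3) → ℂ} :
    MemSobolevHalf (oblateSurfaceMeasure a₁ a₂ R) φ ↔
      MemSobolevHalf sphereSurface (φ ∘ stretch (a₁ * R) (a₂ * R)) := by
  obtain ⟨C, hC⟩ := exists_sobolevHalfNormSq_equiv h₁ h₂
  rw [MemSobolevHalf, MemSobolevHalf, aestronglyMeasurable_oblateSurfaceMeasure_iff h₁ h₂]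
  refine and_congr_right fun _ => ⟨fun h => ?_, fun h => ?_⟩
  · exact (hC φ).2.trans_lt (ENNReal.mul_lt_top ENNReal.coe_lt_top h)
  · exact (hC φ).1.trans_lt (ENNReal.mul_lt_top ENNReal.coe_lt_top h)

/-- The reflection of a point of the unit sphere in the plane orthogonal to the image of `y` under
the inverse of the map onto the ellipsoid. -/
noncomputable def oblateReflect (a₁ a₂ R : ℝ) (y x : EuclideanSpace ℝ (Fin 3)) :
    EuclideanSpace ℝ (Fin 3) :=
  reflect (stretch (a₁ * R)⁻¹ (a₂ * R)⁻¹ y) x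

theorem withDensity_npKernel (h₁ : 0 < a₁ * R) (h₂ : 0 < a₂ * R)
    {θ : EuclideanSpace ℝ (Fin 3)} (hθ : ‖θ‖ = 1) :
    (oblateSurfaceMeasure a₁ a₂ R).withDensity (fun Y => ENNReal.ofReal
        (npKernel (oblateNormal a₁ a₂ R) (stretch (a₁ * R) (a₂ * R) θ) Y)) =
      (2⁻¹ : ENNReal) • (stdGaussian (EuclideanSpace ℝ (Fin 3))).map
        (fun y => stretch (a₁ * R) (a₂ * R) (oblateReflect a₁ a₂ R y θ)) := by
  have hK := measurable_npKernel (a₁ := a₁) (a₂ := a₂) (R := R) (stretch (a₁ * R) (a₂ * R) θ)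
  have hr : Measurable fun y => stretch (a₁ * R) (a₂ * R) (oblateReflect a₁ a₂ R y θ) := by
    unfold oblateReflect
    fun_prop
  ext A hA
  have hm : Measurable (A.indicator (1 : EuclideanSpace ℝ (Fin 3) → ENNReal)) :=
    measurable_one.indicator hA
  rw [← lintegral_indicator_one hA, ← lintegral_indicator_one hA, lintegral_smul_measure,
    lintegral_map hm hr, lintegral_withDensity_eq_lintegral_mul _ hK.ennreal_ofReal hm]
  refine (lintegral_npKernel h₁ h₂ hθ hm hK).trans ?_
  rfl

theorem npKernel_nonneg (h₁ : 0 < a₁ * R) (h₂ : 0 < a₂ * R)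
    {θ : EuclideanSpace ℝ (Fin 3)} (hθ : ‖θ‖ = 1) :
    ∀ᵐ Y ∂oblateSurfaceMeasure a₁ a₂ R,
      0 ≤ npKernel (oblateNormal a₁ a₂ R) (stretch (a₁ * R) (a₂ * R) θ) Y := by
  rw [ae_oblateSurfaceMeasure_iff h₁ h₂]
  filter_upwards [ae_norm_eq_one] with ω hω
  have h0 : 0 < ‖stretch (a₁ * R)⁻¹ (a₂ * R)⁻¹ ω‖ := by
    refine norm_pos_iff.2 (stretch_ne_zero (inv_pos.2 h₁) (inv_pos.2 h₂) ?_)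
    rintro rfl
    simp at hω
  have h := norm_mul_npKernel_stretch h₁ h₂ hθ hω
  refine nonneg_of_mul_nonneg_right (h.symm ▸ ?_) h0
  have := pi_pos
  positivity

/-- The kernel is nonnegative, so it can be used as a density; the identity of measures in
`withDensity_npKernel` then extends from nonnegative to complex functions. -/
theorem integrable_npKernel_iff (h₁ : 0 < a₁ * R) (h₂ : 0 < a₂ * R)
    {θ : EuclideanSpace ℝ (Fin 3)} (hθ : ‖θ‖ = 1) {φ : EuclideanSpace ℝ (Fin 3) → ℂ}
    (hφ : AEStronglyMeasurable φ (oblateSurfaceMeasure a₁ a₂ R)) :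
    (Integrable (fun Y => (npKernel (oblateNormal a₁ a₂ R) (stretch (a₁ * R) (a₂ * R) θ) Y : ℂ) *
        φ Y) (oblateSurfaceMeasure a₁ a₂ R) ↔
      Integrable (fun y => φ (stretch (a₁ * R) (a₂ * R) (oblateReflect a₁ a₂ R y θ)))
        (stdGaussian (EuclideanSpace ℝ (Fin 3)))) ∧
    ∫ Y, (npKernel (oblateNormal a₁ a₂ R) (stretch (a₁ * R) (a₂ * R) θ) Y : ℂ) * φ Y
        ∂oblateSurfaceMeasure a₁ a₂ R =
      (1 / 2 : ℂ) * ∫ y, φ (stretch (a₁ * R) (a₂ * R) (oblateReflect a₁ a₂ R y θ))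
        ∂stdGaussian (EuclideanSpace ℝ (Fin 3)) := by
  have hK := measurable_npKernel (a₁ := a₁) (a₂ := a₂) (R := R) (stretch (a₁ * R) (a₂ * R) θ)
  have hr : Measurable fun y => stretch (a₁ * R) (a₂ * R) (oblateReflect a₁ a₂ R y θ) := by
    unfold oblateReflect
    fun_prop
  have hwd := withDensity_npKernel h₁ h₂ hθ
  have hc : (fun Y => (npKernel (oblateNormal a₁ a₂ R) (stretch (a₁ * R) (a₂ * R) θ) Y : ℂ) * φ Y)
      =ᵐ[oblateSurfaceMeasure a₁ a₂ R] fun Y => (npKernel (oblateNormal a₁ a₂ R)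
        (stretch (a₁ * R) (a₂ * R) θ) Y).toNNReal • φ Y := by
    filter_upwards [npKernel_nonneg h₁ h₂ hθ] with Y hY
    rw [NNReal.smul_def, Real.coe_toNNReal _ hY, Complex.real_smul]
  have h2 : (2⁻¹ : ENNReal) ≠ 0 := by simp
  -- The law of the reflected point is absolutely continuous with respect to the surface measure,
  -- since half of it has the kernel as density.
  have hφ' : AEStronglyMeasurable φ ((stdGaussian (EuclideanSpace ℝ (Fin 3))).map
        (fun y => stretch (a₁ * R) (a₂ * R) (oblateReflect a₁ a₂ R y θ))) := by
    refine hφ.mono_ac (Measure.AbsolutelyContinuous.trans ?_ (withDensity_absolutelyContinuous _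
      (fun Y => ENNReal.ofReal
        (npKernel (oblateNormal a₁ a₂ R) (stretch (a₁ * R) (a₂ * R) θ) Y))))
    rw [hwd]
    exact Measure.absolutelyContinuous_smul h2
  constructor
  · rw [integrable_congr hc, ← integrable_withDensity_iff_integrable_smul hK.real_toNNReal]
    change Integrable φ (Measure.withDensity _ fun Y => ENNReal.ofReal _) ↔ _
    rw [hwd, integrable_smul_measure h2 (by simp), integrable_map_measure hφ' hr.aemeasurable]
    rfl
  · rw [integral_congr_ae hc, ← integral_withDensity_eq_integral_smul hK.real_toNNReal]
    change ∫ Y, φ Y ∂(Measure.withDensity _ fun Y => ENNReal.ofReal _) = _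
    rw [hwd, integral_smul_measure, integral_map hr.aemeasurable hφ',
      Complex.real_smul]
    simp

theorem isNPImage_oblate_iff (h₁ : 0 < a₁ * R) (h₂ : 0 < a₂ * R)
    {φ ψ : EuclideanSpace ℝ (Fin 3) → ℂ}
    (hφ : AEStronglyMeasurable φ (oblateSurfaceMeasure a₁ a₂ R)) :
    IsNPImage (oblateSurfaceMeasure a₁ a₂ R) (oblateNormal a₁ a₂ R) φ ψ ↔
      IsHalfAverage (stdGaussian (EuclideanSpace ℝ (Fin 3))) (oblateReflect a₁ a₂ R) sphereSurface
        (φ ∘ stretch (a₁ * R) (a₂ * R)) (ψ ∘ stretch (a₁ * R) (a₂ * R)) := by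
  rw [IsNPImage, IsHalfAverage, ae_oblateSurfaceMeasure_iff h₁ h₂]
  refine Filter.eventually_congr ?_
  filter_upwards [ae_norm_eq_one] with θ hθ
  have h := integrable_npKernel_iff h₁ h₂ hθ hφ
  rw [h.1, h.2]
  rfl

theorem isReflectionFamily_oblateReflect :
    IsReflectionFamily (oblateReflect a₁ a₂ R) sphereSurface where
  measurable := by
    unfold oblateReflect
    fun_prop
  involutive y x := reflect_reflect _ _
  preserving y := measurePreserving_reflect _

end Ellipsoid

/-! ### The Sobolev seminorm as an L² norm on pairs, and the resolvent on H^{1/2}. -/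

section Energy

variable {Ω X : Type*} [MeasurableSpace Ω] [MeasurableSpace X] {m : Measure X}
  {s : Ω → X → X}

theorem MeasureTheory.MeasurePreserving.withDensity {f : X → X} (hf : MeasurePreserving f m m)
    {w : X → ENNReal} (hw : Measurable w) (hinv : ∀ x, w (f x) = w x) :
    MeasurePreserving f (m.withDensity w) (m.withDensity w) := by
  refine ⟨hf.measurable, ?_⟩
  ext A hA
  rw [Measure.map_apply hf.measurable hA, withDensity_apply _ (hf.measurable hA),
    withDensity_apply _ hA, ← hf.setLIntegral_comp_preimage hA hw]
  simp only [hinv]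

theorem IsReflectionFamily.prod [SFinite m] (h : IsReflectionFamily s m) :
    IsReflectionFamily (fun ω (p : X × X) => (s ω p.1, s ω p.2)) (m.prod m) where
  measurable := by
    have := h.measurable
    exact (this.comp (measurable_fst.prodMk (measurable_fst.comp measurable_snd))).prodMk
      (this.comp (measurable_fst.prodMk (measurable_snd.comp measurable_snd)))
  involutive ω p := by simp [h.involutive]
  preserving ω := (h.preserving ω).prod (h.preserving ω)

theorem IsReflectionFamily.withDensity (h : IsReflectionFamily s m) {w : X → ENNReal}
    (hw : Measurable w) (hinv : ∀ ω x, w (s ω x) = w x) :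
    IsReflectionFamily s (m.withDensity w) where
  measurable := h.measurable
  involutive := h.involutive
  preserving ω := (h.preserving ω).withDensity hw (hinv ω)

theorem IsReflectionFamily.restrict (h : IsReflectionFamily s m) {A : Set X}
    (hA : MeasurableSet A) (hinv : ∀ ω x, s ω x ∈ A ↔ x ∈ A) :
    IsReflectionFamily s (m.restrict A) where
  measurable := h.measurable
  involutive := h.involutive
  preserving ω := by
    have := (h.preserving ω).restrict_preimage hA
    rwa [show s ω ⁻¹' A = A from Set.ext (hinv ω)] at this

theorem eLpNorm_two_sq (f : X → ℂ) : eLpNorm f 2 m ^ 2 = ∫⁻ x, ‖f x‖ₑ ^ 2 ∂m := by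
  have := eLpNorm_nnreal_pow_eq_lintegral (μ := m) (f := f) (p := 2) (by norm_num)
  simpa using this

theorem memLp_two_of_lintegral_lt_top {f : X → ℂ} (hf : AEStronglyMeasurable f m)
    (h : ∫⁻ x, ‖f x‖ₑ ^ 2 ∂m < ⊤) : MemLp f 2 m := by
  refine ⟨hf, ?_⟩
  rw [← eLpNorm_two_sq] at h
  by_contra hcon
  rw [top_le_iff.1 (not_lt.1 hcon)] at h
  simp at h

/-- The set of pairs of points at distance more than `1 / (n + 1)`. -/
def separatedPairs (n : ℕ) : Set (EuclideanSpace ℝ (Fin 3) × EuclideanSpace ℝ (Fin 3)) :=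
  {p | 1 / ((n : ℝ) + 1) < ‖p.1 - p.2‖}

theorem measurableSet_separatedPairs (n : ℕ) : MeasurableSet (separatedPairs n) :=
  measurableSet_lt (by fun_prop) (by fun_prop)

theorem monotone_separatedPairs : Monotone separatedPairs := by
  intro i j hij p hp
  have hp : 1 / ((i : ℝ) + 1) < ‖p.1 - p.2‖ := hp
  refine lt_of_le_of_lt ?_ hp
  gcongr

theorem iUnion_separatedPairs :
    ⋃ n, separatedPairs n = {p | p.1 ≠ p.2} := by
  ext p
  simp only [Set.mem_iUnion, separatedPairs, Set.mem_ofPred_eq]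
  constructor
  · rintro ⟨n, hn⟩ heq
    rw [heq, sub_self, norm_zero] at hn
    exact absurd hn (not_lt.2 (by positivity))
  · intro h
    exact exists_nat_one_div_lt (norm_pos_iff.2 (sub_ne_zero.2 h))

/-- The weight of the Sobolev seminorm. -/
noncomputable def pairWeight (p : EuclideanSpace ℝ (Fin 3) × EuclideanSpace ℝ (Fin 3)) : ENNReal :=
  (‖p.1 - p.2‖ₑ ^ 3)⁻¹

theorem measurable_pairWeight : Measurable pairWeight := by
  unfold pairWeight
  fun_prop

variable {μ : Measure (EuclideanSpace ℝ (Fin 3))}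

/-- The measure of the Sobolev seminorm, away from the diagonal. -/
noncomputable def pairMeasure (μ : Measure (EuclideanSpace ℝ (Fin 3))) (n : ℕ) :
    Measure (EuclideanSpace ℝ (Fin 3) × EuclideanSpace ℝ (Fin 3)) :=
  ((μ.prod μ).withDensity pairWeight).restrict (separatedPairs n)

/-- The weight |x - y|⁻³ may fail to be integrable near the diagonal. Truncating there gives finite
measures, to which the L² theory applies; isometries respect the truncation. -/
theorem pairMeasure_le (n : ℕ) :
    pairMeasure μ n ≤ ((((n : NNReal) + 1) ^ 3 : NNReal) : ENNReal) • (μ.prod μ) := by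
  rw [pairMeasure, restrict_withDensity (measurableSet_separatedPairs n)]
  have h1 : ((μ.prod μ).restrict (separatedPairs n)).withDensity pairWeight ≤
      ((μ.prod μ).restrict (separatedPairs n)).withDensity
        (fun _ => (((n : NNReal) + 1) ^ 3 : NNReal)) := by
    refine withDensity_mono ?_
    rw [Filter.EventuallyLE, ae_restrict_iff' (measurableSet_separatedPairs n)]
    refine Filter.Eventually.of_forall fun p hp => ?_
    have hp : 1 / ((n : ℝ) + 1) < ‖p.1 - p.2‖ := hp
    rw [pairWeight, ENNReal.inv_pow, ENNReal.coe_pow]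
    gcongr
    rw [ENNReal.inv_le_iff_inv_le, ← ENNReal.coe_inv (by positivity)]
    change (((n : NNReal) + 1)⁻¹ : NNReal) ≤ ((‖p.1 - p.2‖₊ : NNReal) : ENNReal)
    rw [ENNReal.coe_le_coe, ← NNReal.coe_le_coe]
    simpa using hp.le
  refine h1.trans ?_
  rw [← restrict_withDensity (measurableSet_separatedPairs n), withDensity_const]
  exact Measure.restrict_le_self

instance [IsFiniteMeasure μ] (n : ℕ) : IsFiniteMeasure (pairMeasure μ n) :=
  have := Measure.smul_finite (μ.prod μ) (ENNReal.coe_ne_top (r := ((n : NNReal) + 1) ^ 3))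
  isFiniteMeasure_of_le _ (pairMeasure_le n)

theorem pairMeasure_absolutelyContinuous (n : ℕ) : pairMeasure μ n ≪ μ.prod μ :=
  Measure.restrict_le_self.absolutelyContinuous.trans (withDensity_absolutelyContinuous _ _)

/-- Monotone convergence along the truncations. The diagonal, where the weight is infinite,
contributes nothing because the difference vanishes there. -/
theorem iSup_lintegral_pairMeasure [IsFiniteMeasure μ] {φ : EuclideanSpace ℝ (Fin 3) → ℂ}
    (hφ : StronglyMeasurable φ) :
    ⨆ n, ∫⁻ p, ‖φ p.1 - φ p.2‖ₑ ^ 2 ∂pairMeasure μ n =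
      ∫⁻ X, ∫⁻ Y, ‖φ X - φ Y‖ₑ ^ 2 / ‖X - Y‖ₑ ^ 3 ∂μ ∂μ := by
  have hm := hφ.measurable
  have hD : MeasurableSet
      {p : EuclideanSpace ℝ (Fin 3) × EuclideanSpace ℝ (Fin 3) | p.1 ≠ p.2} :=
    (measurableSet_eq_fun measurable_fst measurable_snd).compl
  simp only [pairMeasure]
  rw [← setLIntegral_iUnion_of_directed _ monotone_separatedPairs.directed_le,
    iUnion_separatedPairs, ← lintegral_indicator hD]
  have h : ({p | p.1 ≠ p.2} : Set (EuclideanSpace ℝ (Fin 3) × EuclideanSpace ℝ (Fin 3))).indicator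
      (fun p => ‖φ p.1 - φ p.2‖ₑ ^ 2) = fun p => ‖φ p.1 - φ p.2‖ₑ ^ 2 := by
    refine Set.indicator_eq_self.2 fun p hp => ?_
    intro heq
    simp [heq] at hp
  rw [h, lintegral_withDensity_eq_lintegral_mul _ measurable_pairWeight (by fun_prop),
    lintegral_prod _ (by
      have := measurable_pairWeight
      fun_prop)]
  refine lintegral_congr fun X => lintegral_congr fun Y => ?_
  rw [Pi.mul_apply, mul_comm, ENNReal.div_eq_inv_mul, mul_comm]
  rfl

theorem lintegral_pairMeasure_le [IsFiniteMeasure μ] {φ : EuclideanSpace ℝ (Fin 3) → ℂ}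
    (hφ : StronglyMeasurable φ)
    (n : ℕ) : ∫⁻ p, ‖φ p.1 - φ p.2‖ₑ ^ 2 ∂pairMeasure μ n ≤
      ∫⁻ X, ∫⁻ Y, ‖φ X - φ Y‖ₑ ^ 2 / ‖X - Y‖ₑ ^ 3 ∂μ ∂μ := by
  rw [← iSup_lintegral_pairMeasure hφ]
  exact le_iSup (fun n => ∫⁻ p, ‖φ p.1 - φ p.2‖ₑ ^ 2 ∂pairMeasure μ n) n

variable {γ : Measure Ω}
  {r : Ω → EuclideanSpace ℝ (Fin 3) → EuclideanSpace ℝ (Fin 3)}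

theorem IsHalfAverage.sub {f g f' g' : X → ℂ} (h : IsHalfAverage γ s m f g)
    (h' : IsHalfAverage γ s m f' g') :
    IsHalfAverage γ s m (fun x => f x - f' x) (fun x => g x - g' x) := by
  filter_upwards [h, h'] with x hx hx'
  refine ⟨hx.1.sub hx'.1, ?_⟩
  rw [integral_sub hx.1 hx'.1, mul_sub, hx.2, hx'.2]

theorem IsHalfAverage.prod [SFinite m] {f g : X → ℂ} (h : IsHalfAverage γ s m f g) :
    IsHalfAverage γ (fun ω (p : X × X) => (s ω p.1, s ω p.2)) (m.prod m)
      (fun p => f p.1 - f p.2) (fun p => g p.1 - g p.2) := by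
  filter_upwards [Measure.quasiMeasurePreserving_fst.ae h,
    Measure.quasiMeasurePreserving_snd.ae h] with p h1 h2
  refine ⟨h1.1.sub h2.1, ?_⟩
  rw [integral_sub h1.1 h2.1, mul_sub, h1.2, h2.2]

theorem isReflectionFamily_pairMeasure [IsFiniteMeasure μ] (h : IsReflectionFamily r μ)
    (hr : ∀ ω x y, ‖r ω x - r ω y‖ = ‖x - y‖) (n : ℕ) :
    IsReflectionFamily (fun ω (p : _ × _) => (r ω p.1, r ω p.2)) (pairMeasure μ n) := by
  refine (h.prod.withDensity measurable_pairWeight fun ω p => ?_).restrict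
    (measurableSet_separatedPairs n) fun ω p => ?_
  · simp only [pairWeight, ← ofReal_norm, hr]
  · simp only [separatedPairs, Set.mem_ofPred_eq, hr]

/-- Off the segment `[-1/2, 1/2]`, half of the average of isometric reflections has a resolvent that
is bounded in the Sobolev norm. -/
theorem exists_sobolev_resolvent [IsFiniteMeasure μ] [IsProbabilityMeasure γ] {z : ℂ}
    (hz : z ∈ offSegment) (h : IsReflectionFamily r μ)
    (hr : ∀ ω x y, ‖r ω x - r ω y‖ = ‖x - y‖) :
    ∃ C : NNReal, ∀ g, MemSobolevHalf μ g →
      ∃ f, MemSobolevHalf μ f ∧ IsHalfAverage γ r μ f (fun x => z * f x - g x) ∧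
        sobolevHalfNormSq μ f ≤ C * sobolevHalfNormSq μ g ∧
        ∀ f', MemSobolevHalf μ f' → IsHalfAverage γ r μ f' (fun x => z * f' x - g x) →
          f' =ᵐ[μ] f := by
  obtain ⟨C, hC⟩ := exists_lintegral_sq_le_of_isHalfAverage hz
  refine ⟨C, fun g hg => ?_⟩
  have hmem : ∀ {φ}, MemSobolevHalf μ φ → MemLp φ 2 μ := fun {φ} hφ =>
    memLp_two_of_lintegral_lt_top hφ.1 (le_self_add.trans_lt hφ.2)
  have hgL := hmem hg
  obtain ⟨f, hfm, hfL, hf⟩ := exists_isHalfAverage_sub (γ := γ) h hz hgL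
  -- A strongly measurable representative is needed for the integrals over pairs.
  have hgm := hg.1.stronglyMeasurable_mk
  have hf' : IsHalfAverage γ r μ f (fun x => z * f x - hg.1.mk g x) := by
    refine hf.congr h Filter.EventuallyEq.rfl ?_
    filter_upwards [hg.1.ae_eq_mk] with x hx
    rw [hx]
  -- The differences f(x) - f(y) solve the same resolvent equation on pairs. The constant from the
  -- L² bound depends on `z` alone, hence serves on the sphere and for every truncation, and
  -- survives the supremum.
  have hN : sobolevHalfNormSq μ f ≤ C * sobolevHalfNormSq μ g := by
    rw [sobolevHalfNormSq_congr hg.1.ae_eq_mk, sobolevHalfNormSq, sobolevHalfNormSq, mul_add]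
    refine add_le_add (hC h hfL hgm.aestronglyMeasurable hf') ?_
    rw [← iSup_lintegral_pairMeasure hfm]
    refine iSup_le fun n => ?_
    refine le_trans (hC (γ := γ) (isReflectionFamily_pairMeasure h hr n)
      (f := fun p => f p.1 - f p.2)
      (g := fun p => hg.1.mk g p.1 - hg.1.mk g p.2) ?_ ?_ ?_)
      (mul_le_mul_right (lintegral_pairMeasure_le hgm n) _)
    · have h2 : MemLp (fun p : _ × _ => f p.1 - f p.2) 2 (μ.prod μ) :=
        (hfL.comp_fst μ).sub (hfL.comp_snd μ)
      exact h2.of_measure_le_smul (by simp) (pairMeasure_le n)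
    · exact ((hgm.comp_measurable measurable_fst).sub
        (hgm.comp_measurable measurable_snd)).aestronglyMeasurable
    · have h2 := (pairMeasure_absolutelyContinuous n).ae_le hf'.prod
      filter_upwards [h2] with p hp
      refine ⟨hp.1, hp.2.trans ?_⟩
      ring
  refine ⟨f, ⟨hfm.aestronglyMeasurable, hN.trans_lt (ENNReal.mul_lt_top ENNReal.coe_lt_top hg.2)⟩,
    hf, hN, fun f' hf'm hf'eq => ?_⟩
  -- Uniqueness: the difference of two solutions solves the equation with right-hand side zero.
  have hd := hC h ((hmem hf'm).sub hfL) (g := fun _ => 0) aestronglyMeasurable_const (by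
    filter_upwards [hf'eq.sub hf] with x hx
    refine ⟨hx.1, hx.2.trans ?_⟩
    simp only [Pi.sub_apply]
    ring)
  simp only [enorm_zero, ne_eq, OfNat.ofNat_ne_zero, not_false_eq_true, zero_pow, lintegral_zero,
    mul_zero, nonpos_iff_eq_zero] at hd
  rw [lintegral_eq_zero_iff' (((hf'm.1.sub hfL.1).enorm.pow_const 2))] at hd
  filter_upwards [hd] with x hx
  simpa [sub_eq_zero] using hx

end Energy

/-! ### The spectrum lies in [-1/2, 1/2], and eigenvalues belong to it. -/

section Spectrum

open ProbabilityTheory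

variable {a₁ a₂ R : ℝ}

theorem npSpectrum_oblate_subset (h₁ : 0 < a₁ * R) (h₂ : 0 < a₂ * R) :
    npSpectrum (oblateSurfaceMeasure a₁ a₂ R) (oblateNormal a₁ a₂ R) ⊆
      (fun t : ℝ => (t : ℂ)) '' Set.Icc (-(1 / 2) : ℝ) (1 / 2) := by
  rw [npSpectrum, Set.compl_subset_comm]
  intro z hz
  obtain ⟨C, hC⟩ := exists_sobolev_resolvent (μ := sphereSurface)
    (γ := stdGaussian (EuclideanSpace ℝ (Fin 3))) hz
    (isReflectionFamily_oblateReflect (a₁ := a₁) (a₂ := a₂) (R := R))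
    (fun y x x' => norm_reflect_sub_reflect _ _ _)
  obtain ⟨D, hD⟩ := exists_sobolevHalfNormSq_equiv h₁ h₂
  -- One factor `D` for each passage between ellipsoid and sphere, and `C` for the resolvent on the
  -- sphere.
  refine ⟨D * (C * D), fun ψ hψ => ?_⟩
  obtain ⟨f, hf, hfa, hfn, hfu⟩ := hC _ ((memSobolevHalf_oblate_iff h₁ h₂).1 hψ)
  have hfe : (f ∘ stretch (a₁ * R)⁻¹ (a₂ * R)⁻¹) ∘ stretch (a₁ * R) (a₂ * R) = f := by
    funext x
    simp only [Function.comp_apply, stretch_inv_stretch h₁ h₂]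
  have hmem : MemSobolevHalf (oblateSurfaceMeasure a₁ a₂ R)
      (f ∘ stretch (a₁ * R)⁻¹ (a₂ * R)⁻¹) := by
    rw [memSobolevHalf_oblate_iff h₁ h₂, hfe]
    exact hf
  refine ⟨f ∘ stretch (a₁ * R)⁻¹ (a₂ * R)⁻¹, hmem, ?_, ?_, fun φ' hφ' hφ'a => ?_⟩
  · rw [isNPImage_oblate_iff h₁ h₂ hmem.1, hfe]
    convert hfa using 2
    simp only [Function.comp_apply, stretch_inv_stretch h₁ h₂]
  · refine (hD _).1.trans ?_
    rw [hfe, ENNReal.coe_mul, ENNReal.coe_mul, mul_assoc, mul_assoc]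
    gcongr
    exact hfn.trans (mul_le_mul_right (hD ψ).2 _)
  · have h := hfu _ ((memSobolevHalf_oblate_iff h₁ h₂).1 hφ')
      ((isNPImage_oblate_iff h₁ h₂ hφ'.1).1 hφ'a)
    rw [Filter.EventuallyEq, ae_oblateSurfaceMeasure_iff h₁ h₂]
    filter_upwards [h] with x hx
    simpa only [Function.comp_apply, stretch_inv_stretch h₁ h₂] using hx

/-- With right-hand side zero, uniqueness in the resolvent set would make the eigenfunction vanish.
-/
theorem IsNPEigenvalue.mem_npSpectrum {S : Measure (EuclideanSpace ℝ (Fin 3))}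
    {ν : EuclideanSpace ℝ (Fin 3) → EuclideanSpace ℝ (Fin 3)} {z : ℂ}
    (h : IsNPEigenvalue S ν z) : z ∈ npSpectrum S ν := by
  obtain ⟨φ, hφ, hne, hφz⟩ := h
  rintro ⟨C, hC⟩
  have h0 : MemSobolevHalf S (fun _ => 0) := ⟨aestronglyMeasurable_const, by
    simp [sobolevHalfNormSq]⟩
  obtain ⟨f, -, -, -, hu⟩ := hC _ h0
  apply hne
  have e1 := hu φ hφ (by simpa using hφz)
  have e2 := hu (fun _ => 0) h0 (by simp [IsNPImage])
  exact e1.trans e2.symm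

end Spectrum

/-! ### Tensor powers as homogeneous polynomials. -/

section TensorPower

/-- The tensor power of a vector of `ℂ³`, in coordinates. -/
noncomputable def tensorPower (n : ℕ) (x : Fin 3 → ℂ) : EuclideanSpace ℂ (Fin n → Fin 3) :=
  WithLp.toLp 2 fun i => ∏ k, x (i k)

theorem tensorPower_apply (n : ℕ) (x : Fin 3 → ℂ) (i : Fin n → Fin 3) :
    tensorPower n x i = ∏ k, x (i k) := rfl

theorem inner_tensorPower (n : ℕ) (x y : Fin 3 → ℂ) :
    inner ℂ (tensorPower n x) (tensorPower n y) = (∑ j, starRingEnd ℂ (x j) * y j) ^ n := by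
  rw [Fintype.sum_pow, PiLp.inner_apply]
  refine Finset.sum_congr rfl fun i _ => ?_
  rw [RCLike.inner_apply, tensorPower_apply, tensorPower_apply, map_prod, mul_comm,
    ← Finset.prod_mul_distrib]

/-- The vector `x + w y` of `ℂ³`, for vectors `x`, `y` of `ℝ³`. -/
noncomputable def complexVector (x y : EuclideanSpace ℝ (Fin 3)) (w : ℂ) : Fin 3 → ℂ :=
  fun j => (x j : ℂ) + w * (y j : ℂ)

/-- A point of `ℝ³` as a vector of `ℂ³`. -/
noncomputable def realVector (x : EuclideanSpace ℝ (Fin 3)) : Fin 3 → ℂ := fun j => (x j : ℂ)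

/-- The tensors that are orthogonal to all powers of real vectors. -/
noncomputable def realAnnihilator (n : ℕ) : Submodule ℂ (EuclideanSpace ℂ (Fin n → Fin 3)) where
  carrier := {t | ∀ x, inner ℂ (tensorPower n (realVector x)) t = 0}
  add_mem' h h' x := by rw [inner_add_right, h x, h' x, add_zero]
  zero_mem' x := inner_zero_right _
  smul_mem' c t h x := by rw [inner_smul_right, h x, mul_zero]

theorem inner_tensorPower_realVector (n : ℕ) (x : EuclideanSpace ℝ (Fin 3))
    (t : EuclideanSpace ℂ (Fin n → Fin 3)) :
    inner ℂ (tensorPower n (realVector x)) t = ∑ i, t i * ∏ k, (x (i k) : ℂ) := by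
  rw [PiLp.inner_apply]
  refine Finset.sum_congr rfl fun i _ => ?_
  rw [RCLike.inner_apply, tensorPower_apply, map_prod]
  simp [realVector]

/-- A tensor orthogonal to the powers of all x + s y with s real defines a polynomial in s with
infinitely many zeros, hence also vanishes at complex s. -/
theorem tensorPower_complexVector_mem (n : ℕ) (x y : EuclideanSpace ℝ (Fin 3)) (w : ℂ) :
    tensorPower n (complexVector x y w) ∈ (realAnnihilator n)ᗮ := by
  rw [Submodule.mem_orthogonal']
  intro t ht
  let p : Polynomial ℂ := ∑ i, Polynomial.C (t i) *
    ∏ k, (Polynomial.C (x (i k) : ℂ) + Polynomial.X * Polynomial.C (y (i k) : ℂ))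
  have heval : ∀ s : ℂ, p.eval s = ∑ i, t i * ∏ k, ((x (i k) : ℂ) + s * (y (i k) : ℂ)) := by
    intro s
    simp [p, Polynomial.eval_finsetSum, Polynomial.eval_prod, mul_comm s]
  have hp : p = 0 := by
    refine Polynomial.eq_zero_of_infinite_isRoot p ?_
    refine Set.Infinite.mono (s := Set.range fun s : ℝ => (s : ℂ)) ?_
      (Set.infinite_range_of_injective Complex.ofReal_injective)
    rintro _ ⟨s, rfl⟩
    have h := ht (x + s • y)
    rw [inner_tensorPower_realVector] at h
    change p.eval (s : ℂ) = 0
    rw [heval, ← h]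
    refine Finset.sum_congr rfl fun i _ => ?_
    simp
  -- The conjugate appears because the inner product is conjugate linear in its first argument.
  have h := heval (starRingEnd ℂ w)
  rw [hp, Polynomial.eval_zero] at h
  rw [h, PiLp.inner_apply]
  refine Finset.sum_congr rfl fun i _ => ?_
  rw [RCLike.inner_apply, tensorPower_apply, map_prod]
  simp [complexVector]

end TensorPower

/-! ### Approximate eigenvectors of symmetric operators. -/

section Eigenvalue

variable {E : Type*} [NormedAddCommGroup E] [InnerProductSpace ℂ E] [FiniteDimensional ℂ E]

/-- An approximate eigenvector of a symmetric operator has an eigenvalue nearby. -/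
theorem LinearMap.IsSymmetric.exists_eigenvalue_near {M : E →ₗ[ℂ] E} (hM : M.IsSymmetric) {w : E}
    (hw : w ≠ 0) {l ε : ℝ} (h : ‖M w - (l : ℂ) • w‖ ≤ ε * ‖w‖) :
    ∃ (μ : ℝ) (t : E), |μ - l| ≤ ε ∧ t ≠ 0 ∧ M t = (μ : ℂ) • t := by
  by_contra! hcon
  have hε : 0 ≤ ε := by
    have := (norm_nonneg _).trans h
    exact nonneg_of_mul_nonneg_left this (norm_pos_iff.2 hw)
  set b := hM.eigenvectorBasis rfl
  have hgap : ∀ i, ε < |hM.eigenvalues rfl i - l| := by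
    intro i
    by_contra! hi
    exact hcon _ (b i) hi (b.orthonormal.ne_zero i) (hM.apply_eigenvectorBasis rfl i)
  have hin : ∀ i, inner ℂ (b i) (M w - (l : ℂ) • w) =
      ((hM.eigenvalues rfl i - l : ℝ) : ℂ) * inner ℂ (b i) w := by
    intro i
    rw [inner_sub_right, ← hM, hM.apply_eigenvectorBasis rfl i, inner_smul_left, inner_smul_right]
    simp
    ring
  -- If all eigenvalues are farther than ε from l, expanding in an eigenbasis gives ‖(M - l)w‖ >
  -- ε‖w‖; a nonzero coefficient makes the inequality strict.
  obtain ⟨i, hi⟩ : ∃ i, inner ℂ (b i) w ≠ 0 := by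
    by_contra! h0
    apply hw
    rw [← b.sum_repr' w]
    simp [h0]
  have h1 : ‖M w - (l : ℂ) • w‖ ^ 2 =
      ∑ i, (hM.eigenvalues rfl i - l) ^ 2 * ‖inner ℂ (b i) w‖ ^ 2 := by
    rw [← b.sum_sq_norm_inner_right]
    refine Finset.sum_congr rfl fun i _ => ?_
    rw [hin, norm_mul, mul_pow, Complex.norm_real, Real.norm_eq_abs, sq_abs]
  have h2 : ε ^ 2 * ‖w‖ ^ 2 < ‖M w - (l : ℂ) • w‖ ^ 2 := by
    rw [h1, ← b.sum_sq_norm_inner_right, Finset.mul_sum]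
    have hlt : ∀ i, ε ^ 2 < (hM.eigenvalues rfl i - l) ^ 2 := fun i => by
      rw [← sq_abs (hM.eigenvalues rfl i - l)]
      exact pow_lt_pow_left₀ (hgap i) hε two_ne_zero
    refine Finset.sum_lt_sum (fun i _ => mul_le_mul_of_nonneg_right (hlt i).le (sq_nonneg _))
      ⟨i, Finset.mem_univ i, mul_lt_mul_of_pos_right (hlt i) ?_⟩
    positivity
  have h3 : ‖M w - (l : ℂ) • w‖ ^ 2 ≤ ε ^ 2 * ‖w‖ ^ 2 := by
    rw [← mul_pow]
    gcongr
  linarith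

/-- Keeps the eigenvector inside an invariant subspace. This is used to exclude tensors whose
polynomial vanishes identically. -/
theorem LinearMap.IsSymmetric.exists_eigenvalue_near_of_mem {M : E →ₗ[ℂ] E} (hM : M.IsSymmetric)
    {N : Submodule ℂ E} (hN : ∀ t ∈ N, M t ∈ N) {w : E} (hwN : w ∈ N)
    (hw : w ≠ 0) {l ε : ℝ} (h : ‖M w - (l : ℂ) • w‖ ≤ ε * ‖w‖) :
    ∃ (μ : ℝ) (t : E), |μ - l| ≤ ε ∧ t ≠ 0 ∧ t ∈ N ∧ M t = (μ : ℂ) • t := by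
  obtain ⟨μ, t, h1, h2, h3⟩ := (hM.restrict_invariant hN).exists_eigenvalue_near (w := ⟨w, hwN⟩)
    (l := l) (ε := ε) (by simpa [Subtype.ext_iff] using hw) (by simpa using h)
  refine ⟨μ, t, h1, by simpa using h2, t.2, ?_⟩
  simpa using congrArg Subtype.val h3

end Eigenvalue

/-! ### Random reflections acting on tensors. -/

section AveragedTensor

variable {Ω : Type*} [MeasurableSpace Ω] {γ : Measure Ω}
  {u : Ω → EuclideanSpace ℝ (Fin 3)}

/-- The matrix of a reflection. -/
noncomputable def reflectMatrix (u : EuclideanSpace ℝ (Fin 3)) (i j : Fin 3) : ℝ :=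
  reflect u (EuclideanSpace.single j 1) i

theorem reflectMatrix_eq (u : EuclideanSpace ℝ (Fin 3)) (i j : Fin 3) :
    reflectMatrix u i j = (if i = j then 1 else 0) - 2 * u j * u i / ‖u‖ ^ 2 := by
  simp [reflectMatrix, reflect, EuclideanSpace.inner_single_right]
  ring

theorem reflectMatrix_comm (u : EuclideanSpace ℝ (Fin 3)) (i j : Fin 3) :
    reflectMatrix u i j = reflectMatrix u j i := by
  rw [reflectMatrix_eq, reflectMatrix_eq]
  simp only [eq_comm (a := i)]
  ring

theorem sum_reflectMatrix_mul (u x : EuclideanSpace ℝ (Fin 3)) (i : Fin 3) :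
    ∑ j, reflectMatrix u i j * x j = reflect u x i := by
  simp only [reflectMatrix_eq, sub_mul, ite_mul, one_mul, zero_mul, Finset.sum_sub_distrib]
  simp [reflect, PiLp.inner_apply, Fin.sum_univ_three]
  ring

theorem abs_reflectMatrix_le (u : EuclideanSpace ℝ (Fin 3)) (i j : Fin 3) :
    |reflectMatrix u i j| ≤ 1 := by
  have h := PiLp.norm_apply_le (reflect u (EuclideanSpace.single j 1)) i
  rw [norm_reflect] at h
  simpa [reflectMatrix] using h

theorem measurable_reflectMatrix (hu : Measurable u) (i j : Fin 3) :
    Measurable fun ω => reflectMatrix (u ω) i j := by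
  simp only [reflectMatrix_eq]
  fun_prop

theorem integrable_prod_reflectMatrix [IsProbabilityMeasure γ] (hu : Measurable u) {n : ℕ}
    (i j : Fin n → Fin 3) :
    Integrable (fun ω => ∏ k, reflectMatrix (u ω) (i k) (j k)) γ := by
  refine Integrable.of_bound (C := 1) ?_ (Filter.Eventually.of_forall fun ω => ?_)
  · exact (Finset.measurable_prod _ fun k _ =>
      measurable_reflectMatrix hu (i k) (j k)).aestronglyMeasurable
  · rw [norm_prod]
    exact Finset.prod_le_one (fun _ _ => norm_nonneg _) fun k _ => abs_reflectMatrix_le _ _ _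

/-- Half of the average of the tensor powers of random reflections. -/
noncomputable def averageMatrix (γ : Measure Ω) (u : Ω → EuclideanSpace ℝ (Fin 3)) (n : ℕ) :
    Matrix (Fin n → Fin 3) (Fin n → Fin 3) ℂ :=
  Matrix.of fun i j => ((1 / 2 * ∫ ω, ∏ k, reflectMatrix (u ω) (i k) (j k) ∂γ : ℝ) : ℂ)

theorem isHermitian_averageMatrix (n : ℕ) : (averageMatrix γ u n).IsHermitian := by
  ext i j
  rw [Matrix.conjTranspose_apply]
  simp only [averageMatrix, Matrix.of_apply, Complex.star_def, Complex.conj_ofReal,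
    reflectMatrix_comm]

/-- The action of a reflection on complex vectors. -/
noncomputable def complexReflect (u : EuclideanSpace ℝ (Fin 3)) (x : Fin 3 → ℂ) : Fin 3 → ℂ :=
  fun i => ∑ j, (reflectMatrix u i j : ℂ) * x j

theorem complexReflect_realVector (u x : EuclideanSpace ℝ (Fin 3)) :
    complexReflect u (realVector x) = realVector (reflect u x) := by
  funext i
  rw [realVector, ← sum_reflectMatrix_mul, complexReflect]
  simp [realVector]

theorem complexReflect_complexVector (u x y : EuclideanSpace ℝ (Fin 3)) (w : ℂ) :
    complexReflect u (complexVector x y w) = complexVector (reflect u x) (reflect u y) w := by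
  funext i
  rw [complexVector, ← sum_reflectMatrix_mul, ← sum_reflectMatrix_mul, complexReflect]
  simp only [complexVector, mul_add, Finset.sum_add_distrib, Complex.ofReal_sum, Finset.mul_sum,
    Complex.ofReal_mul]
  congr 1
  refine Finset.sum_congr rfl fun j _ => ?_
  ring

theorem tensorPower_complexReflect (u : EuclideanSpace ℝ (Fin 3)) {n : ℕ} (x : Fin 3 → ℂ)
    (i : Fin n → Fin 3) : tensorPower n (complexReflect u x) i =
      ∑ j : Fin n → Fin 3, ((∏ k, reflectMatrix u (i k) (j k) : ℝ) : ℂ) * ∏ k, x (j k) := by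
  simp only [tensorPower_apply, complexReflect]
  rw [Finset.prod_univ_sum, Fintype.piFinset_univ]
  refine Finset.sum_congr rfl fun j _ => ?_
  rw [Finset.prod_mul_distrib, Complex.ofReal_prod]

theorem integrable_tensorPower_complexReflect [IsProbabilityMeasure γ] (hu : Measurable u) {n : ℕ}
    (x : Fin 3 → ℂ)
    (i : Fin n → Fin 3) :
    Integrable (fun ω => tensorPower n (complexReflect (u ω) x) i) γ := by
  simp only [tensorPower_complexReflect]
  exact integrable_finsetSum _ fun j _ =>
    (integrable_prod_reflectMatrix hu i j).ofReal.mul_const _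

theorem toEuclideanLin_averageMatrix_tensorPower [IsProbabilityMeasure γ] (hu : Measurable u)
    {n : ℕ} (x : Fin 3 → ℂ)
    (i : Fin n → Fin 3) :
    Matrix.toEuclideanLin (averageMatrix γ u n) (tensorPower n x) i =
      (1 / 2 : ℂ) * ∫ ω, tensorPower n (complexReflect (u ω) x) i ∂γ := by
  simp only [tensorPower_complexReflect]
  rw [integral_finsetSum _ fun j _ => (integrable_prod_reflectMatrix hu i j).ofReal.mul_const _,
    Finset.mul_sum, Matrix.toLpLin_apply]
  refine Finset.sum_congr rfl fun j _ => ?_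
  rw [integral_mul_const, integral_complex_ofReal, ← mul_assoc]
  simp only [averageMatrix, Matrix.of_apply, tensorPower_apply]
  push_cast
  ring

theorem isSymmetric_averageMatrix (n : ℕ) :
    (Matrix.toEuclideanLin (averageMatrix γ u n)).IsSymmetric :=
  Matrix.isSymmetric_toEuclideanLin_iff.2 (isHermitian_averageMatrix n)

/-- Tensors act on the sphere as homogeneous polynomials; random reflections act through the
averaged matrix. -/
theorem half_integral_inner_tensorPower [IsProbabilityMeasure γ] (hu : Measurable u) {n : ℕ}
    (t : EuclideanSpace ℂ (Fin n → Fin 3)) (x : EuclideanSpace ℝ (Fin 3)) :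
    Integrable (fun ω => inner ℂ (tensorPower n (realVector (reflect (u ω) x))) t) γ ∧
    (1 / 2 : ℂ) * ∫ ω, inner ℂ (tensorPower n (realVector (reflect (u ω) x))) t ∂γ =
      inner ℂ (tensorPower n (realVector x))
        (Matrix.toEuclideanLin (averageMatrix γ u n) t) := by
  have e : ∀ ω, inner ℂ (tensorPower n (realVector (reflect (u ω) x))) t =
      ∑ i, t i * tensorPower n (complexReflect (u ω) (realVector x)) i := fun ω => by
    rw [inner_tensorPower_realVector, complexReflect_realVector]
    rfl
  have hI : ∀ i, Integrable
      (fun ω => t i * tensorPower n (complexReflect (u ω) (realVector x)) i) γ := fun i =>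
    (integrable_tensorPower_complexReflect hu _ i).const_mul _
  simp only [e]
  refine ⟨integrable_finsetSum _ fun i _ => hI i, ?_⟩
  rw [integral_finsetSum _ fun i _ => hI i, ← isSymmetric_averageMatrix, PiLp.inner_apply,
    Finset.mul_sum]
  refine Finset.sum_congr rfl fun i _ => ?_
  rw [RCLike.inner_apply, toEuclideanLin_averageMatrix_tensorPower hu, integral_const_mul, map_mul,
    ← integral_conj]
  -- Powers of real vectors have real entries, so the conjugation from the inner product has no
  -- effect.
  have hc : ∀ ω, starRingEnd ℂ (tensorPower n (complexReflect (u ω) (realVector x)) i) =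
      tensorPower n (complexReflect (u ω) (realVector x)) i := fun ω => by
    rw [complexReflect_realVector, tensorPower_apply, map_prod]
    simp [realVector]
  simp only [hc]
  simp [Complex.conj_ofNat]
  ring

/-- The matrix maps tensors with zero polynomial to such tensors, the average of zero being zero;
being symmetric, it also preserves the orthogonal complement. -/
theorem averageMatrix_mem_realAnnihilator_orthogonal [IsProbabilityMeasure γ] (hu : Measurable u)
    {n : ℕ}
    {t : EuclideanSpace ℂ (Fin n → Fin 3)} (ht : t ∈ (realAnnihilator n)ᗮ) :
    Matrix.toEuclideanLin (averageMatrix γ u n) t ∈ (realAnnihilator n)ᗮ := by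
  rw [Submodule.mem_orthogonal] at ht ⊢
  intro s hs
  rw [← isSymmetric_averageMatrix]
  refine ht _ fun x => ?_
  rw [← (half_integral_inner_tensorPower hu s x).2]
  simp [fun ω => hs (reflect (u ω) x)]

end AveragedTensor

/-! ### From eigentensors to eigenfunctions in H^{1/2}. -/

section Eigenfunction

open ProbabilityTheory

variable {a₁ a₂ R : ℝ}

theorem lintegral_inv_norm_sub {θ : EuclideanSpace ℝ (Fin 3)} (hθ : ‖θ‖ = 1) :
    ∫⁻ ω, ENNReal.ofReal ‖ω - θ‖⁻¹ ∂sphereSurface = sphereSurface Set.univ := by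
  have h := lintegral_reflect (g := fun _ => 1) measurable_const hθ
  simpa using h.symm

/-- A Lipschitz bound on the ball reduces the Sobolev integrand to C²/|x - y|, whose integral over
the sphere is finite by the law of a reflection applied to the constant 1. -/
theorem memSobolevHalf_of_contDiff {f : EuclideanSpace ℝ (Fin 3) → ℂ} (hf : ContDiff ℝ 1 f) :
    MemSobolevHalf sphereSurface f := by
  refine ⟨hf.continuous.aestronglyMeasurable, ENNReal.add_lt_top.2 ⟨?_, ?_⟩⟩
  · obtain ⟨C, hC⟩ := (isCompact_sphere
    (0 : EuclideanSpace ℝ (Fin 3)) 1).exists_bound_of_continuousOn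
      hf.continuous.continuousOn
    calc ∫⁻ x, ‖f x‖ₑ ^ 2 ∂sphereSurface ≤ ∫⁻ _, ENNReal.ofReal C ^ 2 ∂sphereSurface := by
          refine lintegral_mono_ae ?_
          filter_upwards [ae_norm_eq_one] with x hx
          rw [← ofReal_norm]
          gcongr
          exact hC x (by simpa using hx)
      _ < ⊤ := by
          rw [lintegral_const]
          exact ENNReal.mul_lt_top (by simp) (measure_lt_top _ _)
  · obtain ⟨C, hC⟩ := (isCompact_closedBall
      (0 : EuclideanSpace ℝ (Fin 3)) 1).exists_bound_of_continuousOn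
      (hf.continuous_fderiv one_ne_zero).continuousOn
    have hlip : ∀ x y : EuclideanSpace ℝ (Fin 3), ‖x‖ = 1 → ‖y‖ = 1 →
        ‖f x - f y‖ ≤ C * ‖x - y‖ := by
      intro x y hx hy
      exact (convex_closedBall (0 : EuclideanSpace ℝ (Fin 3)) 1).norm_image_sub_le_of_norm_fderiv_le
        (fun z _ => (hf.differentiable one_ne_zero) z) hC (by simp [hy]) (by simp [hx])
    calc ∫⁻ X, ∫⁻ Y, ‖f X - f Y‖ₑ ^ 2 / ‖X - Y‖ₑ ^ 3 ∂sphereSurface ∂sphereSurface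
        ≤ ∫⁻ _, ENNReal.ofReal C ^ 2 * sphereSurface Set.univ ∂sphereSurface := by
          refine lintegral_mono_ae ?_
          filter_upwards [ae_norm_eq_one] with x hx
          rw [← lintegral_inv_norm_sub hx, ← lintegral_const_mul _ (by fun_prop)]
          refine lintegral_mono_ae ?_
          filter_upwards [ae_norm_eq_one] with y hy
          rcases eq_or_ne x y with rfl | hxy
          · simp
          have hpos : 0 < ‖x - y‖ := norm_pos_iff.2 (sub_ne_zero.2 hxy)
          have hl := hlip x y hx hy
          have hC0 : 0 ≤ C := by
            have := (norm_nonneg _).trans hl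
            exact nonneg_of_mul_nonneg_left this hpos
          rw [← ofReal_norm, ← ofReal_norm, ← ENNReal.ofReal_pow (norm_nonneg _),
            ← ENNReal.ofReal_pow (norm_nonneg _), ← ENNReal.ofReal_div_of_pos (by positivity),
            ← ENNReal.ofReal_pow hC0, ← ENNReal.ofReal_mul (by positivity), norm_sub_rev y x]
          refine ENNReal.ofReal_le_ofReal ?_
          rw [div_le_iff₀ (by positivity)]
          calc ‖f x - f y‖ ^ 2 ≤ (C * ‖x - y‖) ^ 2 := by gcongr
            _ = C ^ 2 * ‖x - y‖⁻¹ * ‖x - y‖ ^ 3 := by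
              field_simp
      _ < ⊤ := by
          rw [lintegral_const]
          exact ENNReal.mul_lt_top (ENNReal.mul_lt_top (by simp) (measure_lt_top _ _))
            (measure_lt_top _ _)

theorem contDiff_inner_tensorPower {n : ℕ} (t : EuclideanSpace ℂ (Fin n → Fin 3)) :
    ContDiff ℝ 1 fun x => inner ℂ (tensorPower n (realVector x)) t := by
  simp only [inner_tensorPower_realVector]
  refine ContDiff.sum fun i _ => contDiff_const.mul (contDiff_prod fun k _ => ?_)
  exact Complex.ofRealCLM.contDiff.comp
    (EuclideanSpace.proj (i k) : EuclideanSpace ℝ (Fin 3) →L[ℝ] ℝ).contDiff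

/-- A homogeneous continuous function that vanishes almost everywhere on the sphere is zero. -/
theorem eq_zero_of_ae_sphereSurface {f : EuclideanSpace ℝ (Fin 3) → ℂ} (hf : Continuous f) {n : ℕ}
    (hhom : ∀ (r : ℝ) x, f (r • x) = (r : ℂ) ^ n * f x) (h : f =ᵐ[sphereSurface] fun _ => 0) :
    f = fun _ => 0 := by
  rw [← Continuous.ae_eq_iff_eq volume hf continuous_const]
  have hm : Measurable fun x => ‖f x‖ₑ := hf.measurable.enorm
  have h0 : ∫⁻ x, ‖f x‖ₑ = 0 := by
    rw [lintegral_polar hm]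
    rw [lintegral_congr_ae (g := fun _ => 0), lintegral_zero]
    filter_upwards [h] with ω hω
    simp [hhom, hω]
  rw [lintegral_eq_zero_iff hm] at h0
  filter_upwards [h0] with x hx
  simpa using hx

/-- The eigenfunction is the polynomial of `t`, moved to the ellipsoid. If it vanished almost
everywhere on the sphere, homogeneity would make it zero everywhere, and `t` would lie both in the
annihilator and in its orthogonal complement. -/
theorem isNPEigenvalue_of_tensor (h₁ : 0 < a₁ * R) (h₂ : 0 < a₂ * R) {n : ℕ} {μ : ℝ}
    {t : EuclideanSpace ℂ (Fin n → Fin 3)} (ht0 : t ≠ 0) (ht : t ∈ (realAnnihilator n)ᗮ)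
    (h : Matrix.toEuclideanLin (averageMatrix (stdGaussian (EuclideanSpace ℝ (Fin 3)))
      (stretch (a₁ * R)⁻¹ (a₂ * R)⁻¹) n) t = (μ : ℂ) • t) :
    IsNPEigenvalue (oblateSurfaceMeasure a₁ a₂ R) (oblateNormal a₁ a₂ R) μ := by
  set f : EuclideanSpace ℝ (Fin 3) → ℂ := fun x => inner ℂ (tensorPower n (realVector x)) t with hf
  have hfe : (f ∘ stretch (a₁ * R)⁻¹ (a₂ * R)⁻¹) ∘ stretch (a₁ * R) (a₂ * R) = f := by
    funext x
    simp only [Function.comp_apply, stretch_inv_stretch h₁ h₂]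
  have hmem : MemSobolevHalf (oblateSurfaceMeasure a₁ a₂ R)
      (f ∘ stretch (a₁ * R)⁻¹ (a₂ * R)⁻¹) := by
    rw [memSobolevHalf_oblate_iff h₁ h₂, hfe]
    exact memSobolevHalf_of_contDiff (contDiff_inner_tensorPower t)
  refine ⟨f ∘ stretch (a₁ * R)⁻¹ (a₂ * R)⁻¹, hmem, fun hz => ht0 ?_, ?_⟩
  · have hz' : f =ᵐ[sphereSurface] fun _ => 0 := by
      rw [Filter.EventuallyEq, ae_oblateSurfaceMeasure_iff h₁ h₂] at hz
      simp only [Function.comp_apply, stretch_inv_stretch h₁ h₂] at hz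
      exact hz
    have h0 := eq_zero_of_ae_sphereSurface (contDiff_inner_tensorPower t).continuous (n := n)
      (fun r x => by
        simp only [inner_tensorPower_realVector, Finset.mul_sum]
        refine Finset.sum_congr rfl fun i _ => ?_
        simp [Finset.prod_mul_distrib]
        ring) hz'
    have hN : t ∈ realAnnihilator n := fun x => congrFun h0 x
    exact inner_self_eq_zero.1 ((Submodule.mem_orthogonal _ _).1 ht t hN)
  · rw [isNPImage_oblate_iff h₁ h₂ hmem.1, hfe]
    refine Filter.Eventually.of_forall fun x => ?_
    have hx := half_integral_inner_tensorPower (γ := stdGaussian (EuclideanSpace ℝ (Fin 3)))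
      (measurable_stretch (a₁ * R)⁻¹ (a₂ * R)⁻¹) t x
    refine ⟨hx.1, hx.2.trans ?_⟩
    rw [h, inner_smul_right]
    simp only [Function.comp_apply, stretch_inv_stretch h₁ h₂, hf]

end Eigenfunction

/-! ### Approximate eigenvectors from powers of isotropic vectors. -/

section Quasimode

variable {Ω : Type*} [MeasurableSpace Ω] {γ : Measure Ω} [IsProbabilityMeasure γ]
  {u : Ω → EuclideanSpace ℝ (Fin 3)} {x y : EuclideanSpace ℝ (Fin 3)}

theorem norm_sub_proj_sq {E : Type*} [NormedAddCommGroup E] [InnerProductSpace ℂ E] (v w : E)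
    {c : ℝ} (hc : 0 < c) (hw : ‖w‖ ^ 2 = c) :
    ‖v - (inner ℂ w v / (c : ℂ)) • w‖ ^ 2 = ‖v‖ ^ 2 - ‖inner ℂ w v‖ ^ 2 / c := by
  rw [@norm_sub_sq ℂ, inner_smul_right, norm_smul, norm_div, mul_pow, hw, ← inner_conj_symm v w]
  have h1 : inner ℂ w v / (c : ℂ) * (starRingEnd ℂ) (inner ℂ w v) =
      ((‖inner ℂ w v‖ ^ 2 / c : ℝ) : ℂ) := by
    rw [div_mul_eq_mul_div, Complex.mul_conj, Complex.normSq_eq_norm_sq]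
    push_cast
    rfl
  rw [h1]
  simp only [RCLike.re_eq_complex_re, Complex.ofReal_re, Complex.norm_real, Real.norm_eq_abs,
    abs_of_pos hc]
  field_simp
  ring

theorem norm_tensorPower_complexVector_sq (n : ℕ) (hx : ‖x‖ = 1) (hy : ‖y‖ = 1) {w : ℂ}
    (hw : w = Complex.I ∨ w = -Complex.I) : ‖tensorPower n (complexVector x y w)‖ ^ 2 = 2 ^ n := by
  have h : ∑ j, starRingEnd ℂ (complexVector x y w j) * complexVector x y w j = (2 : ℂ) := by
    have hx2 : ‖x‖ ^ 2 = 1 := by rw [hx, one_pow]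
    have hy2 : ‖y‖ ^ 2 = 1 := by rw [hy, one_pow]
    rw [EuclideanSpace.real_norm_sq_eq, Fin.sum_univ_three] at hx2 hy2
    have hx3 : ((x 0 : ℂ) ^ 2 + (x 1 : ℂ) ^ 2 + (x 2 : ℂ) ^ 2) = 1 := by exact_mod_cast hx2
    have hy3 : ((y 0 : ℂ) ^ 2 + (y 1 : ℂ) ^ 2 + (y 2 : ℂ) ^ 2) = 1 := by exact_mod_cast hy2
    rw [Fin.sum_univ_three]
    rcases hw with rfl | rfl <;>
    · simp [complexVector]
      linear_combination hx3 + hy3 - ((y 0 : ℂ) ^ 2 + (y 1 : ℂ) ^ 2 + (y 2 : ℂ) ^ 2) * Complex.I_sq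
  have h2 := inner_self_eq_norm_sq_to_K (𝕜 := ℂ) (tensorPower n (complexVector x y w))
  rw [inner_tensorPower, h] at h2
  refine Complex.ofReal_injective ?_
  push_cast
  exact h2.symm

/-- The symmetric bilinear form of `x + i y` and its reflection. -/
noncomputable def reflectionForm (x y u : EuclideanSpace ℝ (Fin 3)) : ℂ :=
  ((inner ℝ x (reflect u x) - inner ℝ y (reflect u y) : ℝ) : ℂ) +
    ((inner ℝ x (reflect u y) + inner ℝ y (reflect u x) : ℝ) : ℂ) * Complex.I

theorem inner_tensorPower_complexVector (n : ℕ) (x y x' y' : EuclideanSpace ℝ (Fin 3)) :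
    inner ℂ (tensorPower n (complexVector x y (-Complex.I)))
      (tensorPower n (complexVector x' y' Complex.I)) =
    (((inner ℝ x x' - inner ℝ y y' : ℝ) : ℂ) +
      ((inner ℝ x y' + inner ℝ y x' : ℝ) : ℂ) * Complex.I) ^ n := by
  rw [inner_tensorPower]
  congr 1
  simp [PiLp.inner_apply, Fin.sum_univ_three, complexVector]
  linear_combination (y 0 * y' 0 + y 1 * y' 1 + y 2 * y' 2 : ℂ) * Complex.I_sq

/-- Pythagoras: the subtracted term is the orthogonal projection of the reflected power onto the
conjugate power. The error is small exactly when the coefficient is nearly unimodular. -/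
theorem norm_tensorPower_reflect_sub_sq (n : ℕ) (hx : ‖x‖ = 1) (hy : ‖y‖ = 1)
    (u : EuclideanSpace ℝ (Fin 3)) :
    ‖tensorPower n (complexReflect u (complexVector x y Complex.I)) -
      (reflectionForm x y u / 2) ^ n • tensorPower n (complexVector x y (-Complex.I))‖ ^ 2 =
      2 ^ n * (1 - ‖(reflectionForm x y u / 2) ^ n‖ ^ 2) := by
  have h := norm_sub_proj_sq (tensorPower n (complexReflect u (complexVector x y Complex.I)))
    (tensorPower n (complexVector x y (-Complex.I))) (c := 2 ^ n) (by positivity)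
    (norm_tensorPower_complexVector_sq n hx hy (Or.inr rfl))
  rw [complexReflect_complexVector, inner_tensorPower_complexVector,
    norm_tensorPower_complexVector_sq n (by rw [norm_reflect, hx]) (by rw [norm_reflect, hy])
    (Or.inl rfl)] at h
  change ‖_ - (reflectionForm x y u ^ n / _) • _‖ ^ 2 = _ - ‖reflectionForm x y u ^ n‖ ^ 2 / _ at h
  rw [complexReflect_complexVector, div_pow]
  push_cast at h
  rw [h, norm_div]
  simp
  field_simp

theorem norm_reflectionForm_pow_le (n : ℕ) (hx : ‖x‖ = 1) (hy : ‖y‖ = 1)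
    (u : EuclideanSpace ℝ (Fin 3)) : ‖(reflectionForm x y u / 2) ^ n‖ ≤ 1 := by
  have h := norm_tensorPower_reflect_sub_sq n hx hy u
  have h2 : (0 : ℝ) ≤ 2 ^ n * (1 - ‖(reflectionForm x y u / 2) ^ n‖ ^ 2) := h ▸ sq_nonneg _
  have h3 := nonneg_of_mul_nonneg_right h2 (by positivity)
  exact (sq_le_one_iff₀ (norm_nonneg _)).1 (by linarith)

theorem measurable_reflectionForm (hu : Measurable u) :
    Measurable fun ω => reflectionForm x y (u ω) := by
  unfold reflectionForm
  fun_prop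

theorem integrable_reflectionForm (hu : Measurable u) (n : ℕ) (hx : ‖x‖ = 1) (hy : ‖y‖ = 1) :
    Integrable (fun ω => (reflectionForm x y (u ω) / 2) ^ n) γ :=
  Integrable.of_bound
    (((measurable_reflectionForm hu).div_const 2).pow_const n).aestronglyMeasurable 1
    (Filter.Eventually.of_forall fun _ => norm_reflectionForm_pow_le n hx hy _)

theorem norm_averageMatrix_sub_le (hu : Measurable u) (n : ℕ) (hx : ‖x‖ = 1) (hy : ‖y‖ = 1)
    (l : ℂ) :
    ‖Matrix.toEuclideanLin (averageMatrix γ u n) (tensorPower n (complexVector x y Complex.I)) -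
      l • tensorPower n (complexVector x y (-Complex.I))‖ ≤
    √(2 ^ n) * (1 / 2 * ∫ ω, √(1 - ‖(reflectionForm x y (u ω) / 2) ^ n‖ ^ 2) ∂γ +
      ‖1 / 2 * ∫ ω, (reflectionForm x y (u ω) / 2) ^ n ∂γ - l‖) := by
  set V := tensorPower n (complexVector x y Complex.I) with hV
  set V' := tensorPower n (complexVector x y (-Complex.I)) with hV'
  have hnV' : ‖V'‖ = √(2 ^ n) := by
    rw [← norm_tensorPower_complexVector_sq n hx hy (Or.inr rfl), Real.sqrt_sq (norm_nonneg _)]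
  set Q : Ω → ℂ := fun ω => (reflectionForm x y (u ω) / 2) ^ n with hQ
  have hQI : Integrable Q γ := integrable_reflectionForm hu n hx hy
  set F : Ω → EuclideanSpace ℂ (Fin n → Fin 3) := fun ω =>
    tensorPower n (complexReflect (u ω) (complexVector x y Complex.I)) - Q ω • V' with hF
  have hFn : ∀ ω, ‖F ω‖ = √(2 ^ n) * √(1 - ‖Q ω‖ ^ 2) := fun ω => by
    rw [← Real.sqrt_mul (by positivity), ← norm_tensorPower_reflect_sub_sq n hx hy,
      Real.sqrt_sq (norm_nonneg _)]
  have hFi : ∀ i, Integrable (fun ω => F ω i) γ := fun i =>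
    (integrable_tensorPower_complexReflect hu _ i).sub (hQI.mul_const _)
  have hFI : Integrable F γ := by
    have : Integrable (fun ω => (WithLp.ofLp (F ω))) γ := Integrable.of_eval hFi
    exact (PiLp.continuousLinearEquiv 2 ℂ
      (fun _ : Fin n → Fin 3 => ℂ)).symm.toContinuousLinearMap.integrable_comp this
  -- Each reflected power splits into its component along `V'` and the remainder `F`; the mean of
  -- `F` is then bounded by the mean of its norm.
  have hdecomp : Matrix.toEuclideanLin (averageMatrix γ u n) V - l • V' =
      (1 / 2 : ℂ) • ∫ ω, F ω ∂γ + (1 / 2 * ∫ ω, Q ω ∂γ - l) • V' := by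
    ext i
    have h1 : (∫ ω, F ω ∂γ) i = ∫ ω, F ω i ∂γ :=
      ((EuclideanSpace.proj i : EuclideanSpace ℂ (Fin n → Fin 3) →L[ℂ] ℂ).integral_comp_comm
        hFI).symm
    have h2 : ∫ ω, F ω i ∂γ =
        ∫ ω, tensorPower n (complexReflect (u ω) (complexVector x y Complex.I)) i ∂γ -
          (∫ ω, Q ω ∂γ) * V' i := by
      rw [← integral_mul_const, ← integral_sub (integrable_tensorPower_complexReflect hu _ i)
        (hQI.mul_const _)]
      rfl
    rw [PiLp.sub_apply, PiLp.add_apply, PiLp.smul_apply, PiLp.smul_apply, PiLp.smul_apply, h1, h2,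
      toEuclideanLin_averageMatrix_tensorPower hu]
    simp only [smul_eq_mul]
    ring
  rw [hdecomp]
  refine (norm_add_le _ _).trans ?_
  rw [norm_smul, norm_smul, hnV', mul_add, mul_comm ‖_ - l‖]
  refine add_le_add ?_ le_rfl
  have h3 : ‖(1 / 2 : ℂ)‖ = 1 / 2 := by norm_num
  rw [h3, mul_left_comm, ← integral_const_mul]
  refine mul_le_mul_of_nonneg_left ?_ (by norm_num)
  refine (norm_integral_le_integral_norm _).trans_eq ?_
  simp only [hFn, hQ]

theorem reflectionForm_neg (x y u : EuclideanSpace ℝ (Fin 3)) :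
    reflectionForm x (-y) u = starRingEnd ℂ (reflectionForm x y u) := by
  have h : reflect u (-y) = -reflect u y := by
    rw [reflect_eq_reflection, reflect_eq_reflection, map_neg]
  simp [reflectionForm, h]
  ring

theorem complexVector_neg (x y : EuclideanSpace ℝ (Fin 3)) (w : ℂ) :
    complexVector x (-y) w = complexVector x y (-w) := by
  funext j
  simp [complexVector]

/-- Approximate eigenvectors of the averaged matrix, from an isotropic vector. -/
theorem exists_eigenvector_averageMatrix (hu : Measurable u) {n : ℕ} (hn : n ≠ 0) (hx : ‖x‖ = 1)
    (hy : ‖y‖ = 1) (hxy : inner ℝ x y = 0) (l : ℝ) {s : ℝ} (hs : s = 1 ∨ s = -1) :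
    ∃ (μ : ℝ) (t : EuclideanSpace ℂ (Fin n → Fin 3)),
      |μ - s * l| ≤ ∫ ω, √(1 - ‖(reflectionForm x y (u ω) / 2) ^ n‖ ^ 2) ∂γ +
        2 * ‖1 / 2 * ∫ ω, (reflectionForm x y (u ω) / 2) ^ n ∂γ - l‖ ∧
      t ≠ 0 ∧ t ∈ (realAnnihilator n)ᗮ ∧
      Matrix.toEuclideanLin (averageMatrix γ u n) t = (μ : ℂ) • t := by
  have b1 := norm_averageMatrix_sub_le (γ := γ) hu n hx hy l
  -- Replacing y by -y exchanges `V` and `V'` and conjugates the coefficient. As `l` is real, the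
  -- same error bound holds in both directions.
  have b2 := norm_averageMatrix_sub_le (γ := γ) hu n hx (y := -y) (by rwa [norm_neg]) l
  simp only [complexVector_neg, reflectionForm_neg, neg_neg] at b2
  have hconj : ∀ ω, (starRingEnd ℂ (reflectionForm x y (u ω)) / 2) ^ n =
      starRingEnd ℂ ((reflectionForm x y (u ω) / 2) ^ n) := fun ω => by
    simp [Complex.conj_ofNat]
  simp only [hconj, RCLike.norm_conj, integral_conj] at b2
  have hconj2 : (1 / 2 : ℂ) * starRingEnd ℂ (∫ ω, (reflectionForm x y (u ω) / 2) ^ n ∂γ) - (l : ℂ) =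
      starRingEnd ℂ (1 / 2 * ∫ ω, (reflectionForm x y (u ω) / 2) ^ n ∂γ - l) := by
    simp [Complex.conj_ofNat]
  rw [hconj2, RCLike.norm_conj] at b2
  set V := tensorPower n (complexVector x y Complex.I) with hV
  set V' := tensorPower n (complexVector x y (-Complex.I)) with hV'
  set M := Matrix.toEuclideanLin (averageMatrix γ u n)
  have hs2 : ((s : ℂ)) * s = 1 := by rcases hs with rfl | rfl <;> simp
  have hsn : ‖(s : ℂ)‖ = 1 := by rcases hs with rfl | rfl <;> simp
  have hVn : ‖V‖ ^ 2 = 2 ^ n := norm_tensorPower_complexVector_sq n hx hy (Or.inl rfl)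
  have hVn' : ‖V'‖ ^ 2 = 2 ^ n := norm_tensorPower_complexVector_sq n hx hy (Or.inr rfl)
  -- This is the n-th power of ⟨x,x⟩ - ⟨y,y⟩ + 2i⟨x,y⟩ = 0, the isotropy of x + iy; it needs n ≠ 0.
  have horth : inner ℂ V' V = 0 := by
    have hyx : inner ℝ y x = 0 := by rw [real_inner_comm, hxy]
    rw [inner_tensorPower_complexVector, real_inner_self_eq_norm_sq, real_inner_self_eq_norm_sq, hx,
      hy, hxy, hyx]
    simp [hn]
  have hwn : ‖V + (s : ℂ) • V'‖ ^ 2 = 2 * 2 ^ n := by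
    have h0 : inner ℂ V V' = 0 := by rw [← inner_conj_symm, horth, map_zero]
    rw [@norm_add_sq ℂ, inner_smul_right, h0, norm_smul, hsn, hVn, one_mul, hVn']
    simp
    ring
  have hw0 : V + (s : ℂ) • V' ≠ 0 := by
    intro h
    rw [h, norm_zero] at hwn
    have : (0 : ℝ) < 2 ^ n := by positivity
    norm_num at hwn
  have hle : √(2 ^ n) ≤ ‖V + (s : ℂ) • V'‖ := by
    rw [Real.sqrt_le_left (norm_nonneg _), hwn]
    have : (0 : ℝ) < 2 ^ n := by positivity
    linarith
  have hK : V + (s : ℂ) • V' ∈ (realAnnihilator n)ᗮ :=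
    Submodule.add_mem _ (tensorPower_complexVector_mem n x y _)
      (Submodule.smul_mem _ _ (tensorPower_complexVector_mem n x y _))
  refine (isSymmetric_averageMatrix n).exists_eigenvalue_near_of_mem
    (fun t => averageMatrix_mem_realAnnihilator_orthogonal hu) hK hw0 (l := s * l) ?_
  -- Since s² = 1, an exchange of `V` and `V'` with factor l acts on V + sV' as multiplication by
  -- sl.
  have hsplit : M (V + (s : ℂ) • V') - ((s * l : ℝ) : ℂ) • (V + (s : ℂ) • V') =
      (M V - (l : ℂ) • V') + (s : ℂ) • (M V' - (l : ℂ) • V) := by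
    rw [map_add, map_smul, smul_add, smul_smul, smul_sub, smul_smul]
    push_cast
    rw [show (s : ℂ) * l * s = l by linear_combination (l : ℂ) * hs2]
    abel
  change ‖M (V + (s : ℂ) • V') - _‖ ≤ _
  rw [hsplit]
  refine (norm_add_le _ _).trans ?_
  rw [norm_smul, hsn, one_mul]
  refine (add_le_add b1 b2).trans ?_
  rw [← two_mul, mul_left_comm, mul_comm _ ‖V + (s : ℂ) • V'‖]
  refine (mul_le_mul_of_nonneg_right hle ?_).trans_eq ?_
  · refine mul_nonneg zero_le_two (add_nonneg (mul_nonneg (by norm_num) ?_) (norm_nonneg _))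
    exact integral_nonneg fun _ => Real.sqrt_nonneg _
  · ring

end Quasimode

/-! ### The limit R → ∞ with exponent proportional to R. -/

section Limit

open Filter ProbabilityTheory Topology

variable {a₁ a₂ R : ℝ}

theorem reflectionForm_div_two {u : EuclideanSpace ℝ (Fin 3)} (hu : u ≠ 0) :
    reflectionForm (EuclideanSpace.single 0 1) (EuclideanSpace.single 2 1) u / 2 =
      ((u 2 : ℂ) - u 0 * Complex.I) ^ 2 / ((u 0 ^ 2 + u 1 ^ 2 + u 2 ^ 2 : ℝ) : ℂ) := by
  have hn : ‖u‖ ^ 2 = u 0 ^ 2 + u 1 ^ 2 + u 2 ^ 2 := by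
    rw [EuclideanSpace.real_norm_sq_eq, Fin.sum_univ_three]
  have h0 : u 0 ^ 2 + u 1 ^ 2 + u 2 ^ 2 ≠ 0 := by
    rw [← hn]
    simpa using hu
  have h0' : ((u 0 : ℂ) ^ 2 + (u 1 : ℂ) ^ 2 + (u 2 : ℂ) ^ 2) ≠ 0 := by
    intro h
    apply h0
    apply Complex.ofReal_injective
    push_cast
    exact h
  simp only [reflectionForm, reflect, hn, inner_sub_right, inner_smul_right,
    EuclideanSpace.inner_single_left, EuclideanSpace.inner_single_right]
  simp
  field_simp
  linear_combination (-(u 0 : ℂ) ^ 2) * Complex.I_sq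

/-- The power of the form with exponent proportional to `R` converges as `R → ∞`. -/
theorem tendsto_reflectionForm_pow (ha₁ : a₁ ≠ 0) {τ : ℝ} (hτ : 0 ≤ τ)
    {Y : EuclideanSpace ℝ (Fin 3)} (hY : Y 2 ≠ 0) :
    Tendsto (fun R : ℝ => (reflectionForm (EuclideanSpace.single 0 1) (EuclideanSpace.single 2 1)
      (stretch (a₁ * R)⁻¹ (a₂ * R)⁻¹ Y) / 2) ^ ⌈τ * R⌉₊) atTop
      (𝓝 (Complex.exp (((-(2 * τ / (a₁ * Y 2))) * Y 0 : ℝ) * Complex.I))) := by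
  set D : ℝ → ℝ := fun ρ => ρ ^ 2 * ((Y 0 / a₁) ^ 2 + (Y 1 / a₂) ^ 2) + Y 2 ^ 2 with hD
  have hD0 : ∀ ρ, D ρ ≠ 0 := fun ρ => by positivity
  set N : ℝ → ℂ := fun ρ => (-(2 * (Y 0 / a₁) * Y 2 : ℝ) * Complex.I) -
    ((ρ * (2 * (Y 0 / a₁) ^ 2 + (Y 1 / a₂) ^ 2) : ℝ) : ℂ) with hN
  -- The base is 1 + ρN(ρ)/D(ρ) with ρ = 1/R, where D is the squared norm of the stretched vector.
  -- The value N(0)/D(0) = -2iY₀/(a₁Y₂) is imaginary, so the powers tend to a pure phase.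
  have hbase : ∀ R : ℝ, reflectionForm (EuclideanSpace.single 0 1) (EuclideanSpace.single 2 1)
      (stretch (a₁ * R)⁻¹ (a₂ * R)⁻¹ Y) / 2 = 1 + (R⁻¹ : ℝ) * (N R⁻¹ / D R⁻¹) := by
    intro R
    have hu : stretch (a₁ * R)⁻¹ (a₂ * R)⁻¹ Y ≠ 0 := fun h => hY (by
      simpa [stretch_apply] using congrArg (fun X : EuclideanSpace ℝ (Fin 3) => X 2) h)
    have hDc : (D R⁻¹ : ℂ) ≠ 0 := by exact_mod_cast hD0 R⁻¹
    rw [reflectionForm_div_two hu, ← mul_div_assoc, eq_comm, add_comm, div_add_one hDc]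
    have hd : (stretch (a₁ * R)⁻¹ (a₂ * R)⁻¹ Y) 0 ^ 2 + (stretch (a₁ * R)⁻¹ (a₂ * R)⁻¹ Y) 1 ^ 2 +
        (stretch (a₁ * R)⁻¹ (a₂ * R)⁻¹ Y) 2 ^ 2 = D R⁻¹ := by
      simp [stretch_apply, hD, div_eq_mul_inv]
      ring
    rw [hd]
    congr 1
    simp [stretch_apply, hN, hD, div_eq_mul_inv]
    linear_combination (-(Y 0 * (a₁ : ℂ)⁻¹ * (R : ℂ)⁻¹) ^ 2) * Complex.I_sq
  have hlim0 : Tendsto (fun R : ℝ => (N R⁻¹ / D R⁻¹ : ℂ)) atTop (𝓝 (N 0 / D 0)) := by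
    have hc : ContinuousAt (fun ρ : ℝ => (N ρ / D ρ : ℂ)) 0 := by
      refine ContinuousAt.div ?_ ?_ (by exact_mod_cast hD0 0)
      · simp only [hN]
        fun_prop
      · simp only [hD]
        fun_prop
    exact hc.tendsto.comp tendsto_inv_atTop_zero
  have hg : Tendsto (fun R : ℝ => (R : ℂ) * ((R⁻¹ : ℝ) * (N R⁻¹ / D R⁻¹))) atTop
      (𝓝 (N 0 / D 0)) := by
    refine hlim0.congr' ?_
    filter_upwards [eventually_ne_atTop 0] with R hR
    have hRc : (R : ℂ) ≠ 0 := by exact_mod_cast hR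
    push_cast
    field_simp
  have hlog := Complex.tendsto_mul_log_one_add_of_tendsto hg
  have hceil : Tendsto (fun R : ℝ => ((⌈τ * R⌉₊ / R : ℝ) : ℂ)) atTop (𝓝 (τ : ℂ)) :=
    (Complex.continuous_ofReal.tendsto τ).comp (tendsto_nat_ceil_mul_div_atTop hτ)
  have hexp := (Complex.continuous_exp.tendsto _).comp (hceil.mul hlog)
  have htarget : (τ : ℂ) * (N 0 / D 0) = ((-(2 * τ / (a₁ * Y 2))) * Y 0 : ℝ) * Complex.I := by
    have hYc : (Y 2 : ℂ) ≠ 0 := by exact_mod_cast hY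
    have hac : (a₁ : ℂ) ≠ 0 := by exact_mod_cast ha₁
    simp [hN, hD]
    field_simp
  rw [htarget] at hexp
  refine hexp.congr' ?_
  have hne : ∀ᶠ R : ℝ in atTop, 1 + (R⁻¹ : ℝ) * (N R⁻¹ / D R⁻¹) ≠ (0 : ℂ) := by
    have h1 : Tendsto (fun R : ℝ => 1 + ((R⁻¹ : ℝ) : ℂ) * (N R⁻¹ / D R⁻¹)) atTop
        (𝓝 (1 + ((0 : ℝ) : ℂ) * (N 0 / D 0))) :=
      (((Complex.continuous_ofReal.tendsto 0).comp tendsto_inv_atTop_zero).mul hlim0).const_add 1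
    exact h1.eventually_ne (by simp)
  filter_upwards [hne, eventually_ne_atTop 0] with R hR hR0
  have hRc : (R : ℂ) ≠ 0 := by exact_mod_cast hR0
  rw [hbase, Function.comp_apply, ← mul_assoc]
  have : ((⌈τ * R⌉₊ / R : ℝ) : ℂ) * R = (⌈τ * R⌉₊ : ℂ) := by
    push_cast
    field_simp
  rw [this, Complex.exp_nat_mul, Complex.exp_log hR]

theorem ae_stdGaussian_last_ne_zero :
    ∀ᵐ Y ∂stdGaussian (EuclideanSpace ℝ (Fin 3)), Y 2 ≠ 0 := by
  have hmp := measurePreserving_vecThree (gaussianReal 0 1)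
  rw [map_pi_eq_stdGaussian] at hmp
  have hs : MeasurableSet {Y : EuclideanSpace ℝ (Fin 3) | Y 2 ≠ 0} :=
    (measurableSet_eq_fun (by fun_prop) measurable_const).compl
  rw [← hmp.map_eq, ae_map_iff hmp.measurable.aemeasurable hs]
  have : NullSingletonClass (gaussianReal 0 1) := nullSingletonClass_gaussianReal one_ne_zero
  have h : ∀ᵐ z ∂gaussianReal 0 1, z ∉ ({0} : Set ℝ) :=
    measure_eq_zero_iff_ae_notMem.1 (measure_singleton 0)
  exact Measure.quasiMeasurePreserving_snd.ae h

/-- The limit value of the averaged power, as a one-dimensional Gaussian integral. -/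
noncomputable def gaussianGap (a τ : ℝ) : ℝ :=
  ∫ z, Real.exp (-(2 * τ / (a * z)) ^ 2 / 2) ∂gaussianReal 0 1

/-- For fixed third coordinate, the integral over the first one is the characteristic function of
the Gaussian. In particular the limit value is real. -/
theorem integral_exp_stdGaussian (a τ : ℝ) :
    ∫ Y, Complex.exp (((-(2 * τ / (a * Y 2))) * Y 0 : ℝ) * Complex.I)
      ∂stdGaussian (EuclideanSpace ℝ (Fin 3)) = gaussianGap a τ := by
  have hmp := measurePreserving_vecThree (gaussianReal 0 1)
  rw [map_pi_eq_stdGaussian] at hmp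
  have hF : Measurable fun Y : EuclideanSpace ℝ (Fin 3) =>
      Complex.exp (((-(2 * τ / (a * Y 2))) * Y 0 : ℝ) * Complex.I) := by fun_prop
  rw [← hmp.map_eq, integral_map hmp.measurable.aemeasurable hF.aestronglyMeasurable]
  have hG : Measurable fun p : (ℝ × ℝ) × ℝ =>
      Complex.exp (((-(2 * τ / (a * p.2))) * p.1.1 : ℝ) * Complex.I) := by fun_prop
  change ∫ p : (ℝ × ℝ) × ℝ, Complex.exp (((-(2 * τ / (a * p.2))) * p.1.1 : ℝ) * Complex.I)
    ∂((gaussianReal 0 1).prod (gaussianReal 0 1)).prod (gaussianReal 0 1) = _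
  rw [integral_prod_symm _ (Integrable.of_bound hG.aestronglyMeasurable 1
    (Eventually.of_forall fun p => (Complex.norm_exp_ofReal_mul_I _).le)), gaussianGap,
    ← integral_complex_ofReal]
  refine integral_congr_ae (Eventually.of_forall fun z => ?_)
  have h1 := integral_fun_fst (μ := gaussianReal 0 1) (ν := gaussianReal 0 1)
    (f := fun x : ℝ => Complex.exp (((-(2 * τ / (a * z))) * x : ℝ) * Complex.I))
  have h2 := charFun_gaussianReal (μ := 0) (v := 1) (-(2 * τ / (a * z)))
  rw [charFun_apply_real] at h2
  push_cast at h1 h2 ⊢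
  rw [h1, h2]
  simp
  ring_nf

theorem continuous_gaussianGap (a : ℝ) : Continuous (gaussianGap a) := by
  refine continuous_of_dominated (bound := fun _ => 1) (fun τ => ?_) (fun τ => ?_)
    (integrable_const 1) (Eventually.of_forall fun z => ?_)
  · exact (by fun_prop : Measurable fun z : ℝ =>
      Real.exp (-(2 * τ / (a * z)) ^ 2 / 2)).aestronglyMeasurable
  · refine Eventually.of_forall fun z => ?_
    rw [Real.norm_eq_abs, Real.abs_exp, Real.exp_le_one_iff]
    nlinarith [sq_nonneg (2 * τ / (a * z))]
  · fun_prop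

theorem gaussianGap_zero (a : ℝ) : gaussianGap a 0 = 1 := by
  simp [gaussianGap]

theorem tendsto_gaussianGap {a : ℝ} (ha : a ≠ 0) : Tendsto (gaussianGap a) atTop (𝓝 0) := by
  have : NullSingletonClass (gaussianReal 0 1) := nullSingletonClass_gaussianReal one_ne_zero
  have h := tendsto_integral_filter_of_dominated_convergence (μ := gaussianReal 0 1) (l := atTop)
    (F := fun τ z => Real.exp (-(2 * τ / (a * z)) ^ 2 / 2)) (f := fun _ => 0) (fun _ => 1)
    (Eventually.of_forall fun τ => (by fun_prop : Measurable fun z : ℝ =>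
      Real.exp (-(2 * τ / (a * z)) ^ 2 / 2)).aestronglyMeasurable)
    (Eventually.of_forall fun τ => Eventually.of_forall fun z => by
      rw [Real.norm_eq_abs, Real.abs_exp, Real.exp_le_one_iff]
      nlinarith [sq_nonneg (2 * τ / (a * z))])
    (integrable_const 1) ?_
  · rw [integral_zero] at h
    exact h
  · filter_upwards [(measure_eq_zero_iff_ae_notMem.1 (measure_singleton (0 : ℝ)) :
      ∀ᵐ z ∂gaussianReal 0 1, z ∉ ({0} : Set ℝ))] with z hz
    have hz0 : z ≠ 0 := hz
    refine Real.tendsto_exp_atBot.comp ?_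
    have hc : 0 < (2 / (a * z)) ^ 2 / 2 := by positivity
    have h2 : Tendsto (fun τ : ℝ => τ ^ 2 * ((2 / (a * z)) ^ 2 / 2)) atTop atTop :=
      (tendsto_pow_atTop two_ne_zero).atTop_mul_const hc
    refine (tendsto_neg_atTop_atBot.comp h2).congr fun τ => ?_
    simp only [Function.comp_apply]
    ring

/-- Intermediate values: the function is continuous, equals 1 at τ = 0 and tends to 0 as τ → ∞. -/
theorem exists_gaussianGap_eq {a : ℝ} (ha : a ≠ 0) {m : ℝ} (h0 : 0 < m) (h1 : m < 1) :
    ∃ τ, 0 < τ ∧ gaussianGap a τ = m := by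
  obtain ⟨T, hT, hT0⟩ := (((tendsto_gaussianGap ha).eventually_lt_const h0).and
    (eventually_ge_atTop 0)).exists
  have hivt := intermediate_value_Icc' hT0 (continuous_gaussianGap a).continuousOn
  rw [gaussianGap_zero] at hivt
  obtain ⟨τ, hτ, hm⟩ := hivt ⟨hT.le, h1.le⟩
  refine ⟨τ, hτ.1.lt_of_ne fun h => ?_, hm⟩
  rw [← h, gaussianGap_zero] at hm
  exact h1.ne' hm

/-- Every value in `(-1/2, 1/2)` is approximated by eigenvalues as `R → ∞`. -/
theorem eventually_exists_isNPEigenvalue (ha₁ : 0 < a₁) (ha₂ : 0 < a₂) {l : ℝ} (hl0 : 0 < l)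
    (hl : l < 1 / 2) {s : ℝ} (hs : s = 1 ∨ s = -1) {ε : ℝ} (hε : 0 < ε) :
    ∀ᶠ R : ℝ in atTop, ∃ μ : ℝ, |μ - s * l| < ε ∧
      IsNPEigenvalue (oblateSurfaceMeasure a₁ a₂ R) (oblateNormal a₁ a₂ R) μ := by
  -- The factor 2 compensates the half in the averaged matrix.
  obtain ⟨τ, hτ, hm⟩ := exists_gaussianGap_eq ha₁.ne' (m := 2 * l) (by linarith) (by linarith)
  set x : EuclideanSpace ℝ (Fin 3) := EuclideanSpace.single 0 1 with hx
  set y : EuclideanSpace ℝ (Fin 3) := EuclideanSpace.single 2 1 with hy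
  have hxn : ‖x‖ = 1 := by simp [hx]
  have hyn : ‖y‖ = 1 := by simp [hy]
  have hxy : inner ℝ x y = 0 := by simp [hx, hy, EuclideanSpace.inner_single_left]
  set Q : ℝ → EuclideanSpace ℝ (Fin 3) → ℂ := fun R Y =>
    (reflectionForm x y (stretch (a₁ * R)⁻¹ (a₂ * R)⁻¹ Y) / 2) ^ ⌈τ * R⌉₊ with hQ
  have hQm : ∀ R, Measurable (Q R) := fun R =>
    ((measurable_reflectionForm (measurable_stretch _ _)).div_const 2).pow_const _
  have hQ1 : ∀ R Y, ‖Q R Y‖ ≤ 1 := fun R Y => norm_reflectionForm_pow_le _ hxn hyn _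
  have hlimQ : Tendsto (fun R => ∫ Y, Q R Y ∂stdGaussian (EuclideanSpace ℝ (Fin 3))) atTop
      (𝓝 ((2 * l : ℝ) : ℂ)) := by
    rw [← hm, ← integral_exp_stdGaussian]
    refine tendsto_integral_filter_of_dominated_convergence (fun _ => 1)
      (Eventually.of_forall fun R => (hQm R).aestronglyMeasurable)
      (Eventually.of_forall fun R => Eventually.of_forall (hQ1 R)) (integrable_const 1) ?_
    filter_upwards [ae_stdGaussian_last_ne_zero] with Y hY
    exact tendsto_reflectionForm_pow ha₁.ne' hτ.le hY
  have hlimS : Tendsto (fun R => ∫ Y, √(1 - ‖Q R Y‖ ^ 2)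
      ∂stdGaussian (EuclideanSpace ℝ (Fin 3))) atTop (𝓝 0) := by
    have h := tendsto_integral_filter_of_dominated_convergence
      (μ := stdGaussian (EuclideanSpace ℝ (Fin 3))) (l := atTop)
      (F := fun R Y => √(1 - ‖Q R Y‖ ^ 2)) (f := fun _ => 0) (fun _ => 1)
      (Eventually.of_forall fun R =>
        (((hQm R).norm.pow_const 2).const_sub 1).sqrt.aestronglyMeasurable)
      (Eventually.of_forall fun R => Eventually.of_forall fun Y => by
        rw [Real.norm_eq_abs, abs_of_nonneg (Real.sqrt_nonneg _), Real.sqrt_le_one]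
        linarith [sq_nonneg ‖Q R Y‖]) (integrable_const 1) ?_
    · simpa using h
    filter_upwards [ae_stdGaussian_last_ne_zero] with Y hY
    -- The limiting phase has modulus one, so the projection error disappears pointwise.
    have h2 := ((tendsto_reflectionForm_pow (a₂ := a₂) ha₁.ne' hτ.le hY).norm.pow 2).const_sub 1
    rw [Complex.norm_exp_ofReal_mul_I] at h2
    have h3 := (Real.continuous_sqrt.tendsto _).comp h2
    rw [one_pow, sub_self, Real.sqrt_zero] at h3
    exact h3
  have hlim : Tendsto (fun R => ∫ Y, √(1 - ‖Q R Y‖ ^ 2) ∂stdGaussian (EuclideanSpace ℝ (Fin 3)) +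
      2 * ‖1 / 2 * ∫ Y, Q R Y ∂stdGaussian (EuclideanSpace ℝ (Fin 3)) - (l : ℂ)‖) atTop (𝓝 0) := by
    have h := hlimS.add ((((hlimQ.const_mul (1 / 2 : ℂ)).sub_const (l : ℂ)).norm).const_mul 2)
    have hz : (1 / 2 : ℂ) * ((2 * l : ℝ) : ℂ) - l = 0 := by
      push_cast
      ring
    rwa [hz, norm_zero, mul_zero, add_zero] at h
  filter_upwards [hlim.eventually_lt_const hε, eventually_gt_atTop 0] with R hR hR0
  obtain ⟨μ, t, hμ, ht0, ht, he⟩ := exists_eigenvector_averageMatrix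
    (γ := stdGaussian (EuclideanSpace ℝ (Fin 3))) (measurable_stretch (a₁ * R)⁻¹ (a₂ * R)⁻¹)
    (n := ⌈τ * R⌉₊) (Nat.ceil_pos.2 (mul_pos hτ hR0)).ne' hxn hyn hxy l hs
  exact ⟨μ, hμ.trans_lt hR,
    isNPEigenvalue_of_tensor (mul_pos ha₁ hR0) (mul_pos ha₂ hR0) ht0 ht he⟩

end Limit

/-! ### Closure of the spectra. -/

theorem theorem1p4 (a₁ a₂ : ℝ) (ha₁ : 0 < a₁) (ha₂ : 0 < a₂)
    (R : ℕ → ℝ) (hR : ∀ j, 0 < R j) (hlim : Filter.Tendsto R Filter.atTop Filter.atTop) :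
    closure (⋃ j, npSpectrum (oblateSurfaceMeasure a₁ a₂ (R j)) (oblateNormal a₁ a₂ (R j))) =
        (fun t : ℝ => (t : ℂ)) '' Set.Icc (-(1 / 2) : ℝ) (1 / 2) ∧
      closure (⋃ j, {t : ℝ | t < 0 ∧
          IsNPEigenvalue (oblateSurfaceMeasure a₁ a₂ (R j)) (oblateNormal a₁ a₂ (R j)) (t : ℂ)}) =
        Set.Icc (-(1 / 2) : ℝ) 0 := by
  have hsub : ∀ j, npSpectrum (oblateSurfaceMeasure a₁ a₂ (R j)) (oblateNormal a₁ a₂ (R j)) ⊆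
      (fun t : ℝ => (t : ℂ)) '' Set.Icc (-(1 / 2) : ℝ) (1 / 2) := fun j =>
    npSpectrum_oblate_subset (mul_pos ha₁ (hR j)) (mul_pos ha₂ (hR j))
  have happrox : ∀ l ∈ Set.Ioo (0 : ℝ) (1 / 2), ∀ s : ℝ, s = 1 ∨ s = -1 → ∀ ε > 0,
      ∃ j, ∃ μ : ℝ, |μ - s * l| < ε ∧ IsNPEigenvalue (oblateSurfaceMeasure a₁ a₂ (R j))
        (oblateNormal a₁ a₂ (R j)) μ := fun l hl s hs ε hε =>
    (hlim.eventually (eventually_exists_isNPEigenvalue ha₁ ha₂ hl.1 hl.2 hs hε)).exists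
  have hneg : Set.Icc (-(1 / 2) : ℝ) 0 ⊆ closure (⋃ j, {t : ℝ | t < 0 ∧
      IsNPEigenvalue (oblateSurfaceMeasure a₁ a₂ (R j)) (oblateNormal a₁ a₂ (R j)) (t : ℂ)}) := by
    -- The approximation covers 0 < |l| < 1/2 only; the endpoints come from the closure.
    rw [← closure_Ioo (by norm_num : (-(1 / 2) : ℝ) ≠ 0)]
    refine closure_minimal (fun l hl => Metric.mem_closure_iff.2 fun ε hε => ?_) isClosed_closure
    -- The tolerance is capped by -l = |l| so that the eigenvalue found is itself negative.
    obtain ⟨j, μ, hμ, he⟩ := happrox (-l) ⟨by linarith [hl.2], by linarith [hl.1]⟩ (-1) (Or.inr rfl)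
      (min ε (-l)) (lt_min hε (by linarith [hl.2]))
    rw [neg_one_mul, neg_neg] at hμ
    refine ⟨μ, Set.mem_iUnion.2 ⟨j, ?_, he⟩, ?_⟩
    · linarith [(abs_lt.1 (hμ.trans_le (min_le_right _ _))).2]
    · rw [dist_comm, Real.dist_eq]
      exact hμ.trans_le (min_le_left _ _)
  have hpos : Set.Icc (0 : ℝ) (1 / 2) ⊆ closure (⋃ j, {t : ℝ |
      IsNPEigenvalue (oblateSurfaceMeasure a₁ a₂ (R j)) (oblateNormal a₁ a₂ (R j)) (t : ℂ)}) := by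
    rw [← closure_Ioo (by norm_num : (0 : ℝ) ≠ 1 / 2)]
    refine closure_minimal (fun l hl => Metric.mem_closure_iff.2 fun ε hε => ?_) isClosed_closure
    obtain ⟨j, μ, hμ, he⟩ := happrox l hl 1 (Or.inl rfl) ε hε
    rw [one_mul] at hμ
    refine ⟨μ, Set.mem_iUnion.2 ⟨j, he⟩, ?_⟩
    rwa [dist_comm, Real.dist_eq]
  refine ⟨Set.Subset.antisymm ?_ ?_, Set.Subset.antisymm ?_ hneg⟩
  · exact closure_minimal (Set.iUnion_subset hsub)
      (isCompact_Icc.image Complex.continuous_ofReal).isClosed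
  · rintro _ ⟨t, ht, rfl⟩
    have hmem : t ∈ closure (⋃ j, {t : ℝ | IsNPEigenvalue (oblateSurfaceMeasure a₁ a₂ (R j))
        (oblateNormal a₁ a₂ (R j)) (t : ℂ)}) := by
      rcases le_total t 0 with h | h
      · exact closure_mono (Set.iUnion_mono fun j _ h => h.2) (hneg ⟨ht.1, h⟩)
      · exact hpos ⟨h, ht.2⟩
    refine map_mem_closure Complex.continuous_ofReal hmem fun μ hμ => ?_
    obtain ⟨j, hj⟩ := Set.mem_iUnion.1 hμ
    exact Set.mem_iUnion.2 ⟨j, hj.mem_npSpectrum⟩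
  · refine closure_minimal (Set.iUnion_subset fun j t ht => ⟨?_, ht.1.le⟩) isClosed_Icc
    obtain ⟨t', ht', h⟩ := hsub j ht.2.mem_npSpectrum
    rw [← Complex.ofReal_injective h]
    exact ht'.1
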